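/- Let $k\ge 3$ be a fixed integer. A $k$-graph on $n\ge 1$ vertices is a hypergraph with vertex set $\{0,\dots,n-1\}$ all of whose edges are $k$-element sets of vertices; a $2$-coloring of it is an assignment of one of two colors to every vertex such that every edge contains two vertices of different colors; and it is $2$-colorable if it has a $2$-coloring. A randomized algorithm is a single finite program (depending on $k$ but not on $n$) for a random access machine that is given $n$ and can access the input $k$-graph $\mathcal H$ only by edge queries "is $\{v_1,\dots,v_k\}$ an edge of $\mathcal H$?". In one time step the machine can make an edge query, draw a fresh independent uniformly random vertex, output a color for a vertex, or perform an elementary operation (load a constant, copy, increment or decrement a register, read or write a memory cell by indirect addressing, or branch on a comparison of two registers). A randomized $2$-coloring algorithm is a randomized algorithm that, on every $2$-colorable $k$-graph, halts with probability $1$ and, whenever it halts, has output a $2$-coloring of the $k$-graph. For such an algorithm $A$, let $T_A(\mathcal H)$ be the expected number of steps of $A$ on input $\mathcal H$, and let $T_A(n)$ be the average of $T_A(\mathcal H)$ over all $2$-colorable $k$-graphs $\mathcal H$ on $n$ vertices. **Theorem.** For every $k\ge 3$ there is a randomized $2$-coloring algorithm $A$ with $T_A(n)=O(n)$; that is, there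 is a constant $C=C(k)$ such that $T_A(n)\le C\,n$ for all $n\ge 1$. -/

import Mathlib

open MeasureTheory
open scoped ENNReal

/-- A `k`-graph (`k`-uniform hypergraph) on the vertex set `{0, …, n - 1}`: a set of edges, each of
which is a set of exactly `k` vertices. -/
abbrev KGraph (k n : ℕ) : Type :=
  {E : Finset (Finset (Fin n)) // ∀ e ∈ E, e.card = k}

namespace KGraph

variable {k n : ℕ}

/-- `c` is a (legal) `2`-coloring of `H`: every edge has two vertices of different colors. -/
def IsTwoColoring (H : KGraph k n) (c : Fin n → Bool) : Prop :=
  ∀ e ∈ H.1, ∃ u ∈ e, ∃ v ∈ e, c u ≠ c v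

/-- `H` has a `2`-coloring. -/
def TwoColorable (H : KGraph k n) : Prop :=
  ∃ c : Fin n → Bool, H.IsTwoColoring c

/-- The answer to the query "is `(q 0, …, q (k-1))` an edge of `H`?". It is negative if some `q i`
is not a vertex or if two of the `q i` coincide, since then the set `{q 0, …, q (k-1)}` is not
an edge. -/
def IsEdge (H : KGraph k n) (q : Fin k → ℕ) : Prop :=
  ∃ e ∈ H.1, e.map Fin.valEmbedding = Finset.univ.image q

instance (H : KGraph k n) (q : Fin k → ℕ) : Decidable (H.IsEdge q) := by
  unfold IsEdge; infer_instance

end KGraph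

/-! ### A randomized random access machine with edge queries

The machine has registers, a random access memory (both indexed by `ℕ` and holding natural
numbers) and a write-only output. Programs are finite structured programs. The arithmetic is
that of a successor RAM: in `t` steps, a register exceeds the values present at the start
and the constants of the program by at most `t`, so charging every instruction one unit of time does
not hide any arithmetic on long words. -/

/-- The elementary instructions. -/
inductive RAMInstr (k : ℕ) : Type
  /-- `r := m` -/
  | const (r m : ℕ)
  /-- `r := s` -/
  | copy (r s : ℕ)
  /-- `r := r + 1` -/
  | inc (r : ℕ)
  /-- `r := r - 1`, or `0` if `r = 0` -/
  | dec (r : ℕ)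
  /-- `r := mem[s]` -/
  | load (r s : ℕ)
  /-- `mem[r] := s` -/
  | store (r s : ℕ)
  /-- `r :=` a fresh uniformly random vertex -/
  | sample (r : ℕ)
  /-- `r := 1` if the contents of the registers `q 0, …, q (k-1)` form an edge of the input,
  and `r := 0` otherwise -/
  | query (r : ℕ) (q : Fin k → ℕ)
  /-- output the color of the vertex whose number is in `r`: `false` if `s = 0` and `true`
  otherwise -/
  | color (r s : ℕ)

/-- Finite programs; the tests compare the contents of two registers by `<`. -/
inductive RAMProg (k : ℕ) : Type
  | instr (i : RAMInstr k)
  | seq (P Q : RAMProg k)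
  /-- if `r < s` then `P` else `Q` -/
  | ifLT (r s : ℕ) (P Q : RAMProg k)
  /-- while `r < s` do `P` -/
  | whileLT (r s : ℕ) (P : RAMProg k)

/-- The data part of a configuration: registers, memory, and the colors output so far (`none` for
no color). -/
structure RAMState : Type where
  reg : ℕ → ℕ
  mem : ℕ → ℕ
  out : ℕ → Option Bool

/-- The effect of an elementary instruction on input `H`; `x` is the random vertex that a `sample`
instruction receives. -/
def RAMInstr.exec {k n : ℕ} (H : KGraph k n) (x : Fin n) (σ : RAMState) : RAMInstr k → RAMState
  | .const r m => { σ with reg := Function.update σ.reg r m }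
  | .copy r s => { σ with reg := Function.update σ.reg r (σ.reg s) }
  | .inc r => { σ with reg := Function.update σ.reg r (σ.reg r + 1) }
  | .dec r => { σ with reg := Function.update σ.reg r (σ.reg r - 1) }
  | .load r s => { σ with reg := Function.update σ.reg r (σ.mem (σ.reg s)) }
  | .store r s => { σ with mem := Function.update σ.mem (σ.reg r) (σ.reg s) }
  | .sample r => { σ with reg := Function.update σ.reg r x }
  | .query r q =>
      { σ with reg := Function.update σ.reg r (if H.IsEdge (fun i => σ.reg (q i)) then 1 else 0) }
  | .color r s => { σ with out := Function.update σ.out (σ.reg r) (some (decide (σ.reg s ≠ 0))) }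

/-- A configuration: the list of programs that remain to be executed, and the data. The machine has
halted when nothing remains to be executed. -/
abbrev RAMConfig (k : ℕ) : Type := List (RAMProg k) × RAMState

/-- One time step on input `H`. Every elementary instruction, every evaluation of a test, and every
opening of a sequential composition takes one step. -/
def RAMConfig.step {k n : ℕ} (H : KGraph k n) (x : Fin n) : RAMConfig k → RAMConfig k
  | ([], σ) => ([], σ)
  | (.instr i :: S, σ) => (S, i.exec H x σ)
  | (.seq P Q :: S, σ) => (P :: Q :: S, σ)
  | (.ifLT r s P Q :: S, σ) => ((if σ.reg r < σ.reg s then P else Q) :: S, σ)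
  | (.whileLT r s P :: S, σ) =>
      (if σ.reg r < σ.reg s then P :: .whileLT r s P :: S else S, σ)

namespace RAMProg

variable {k n : ℕ}

/-- The start: register `0` holds the number `n` of vertices, all other registers and all memory
cells hold `0`, and no color has been output. The edges can only be accessed by queries. -/
def start (P : RAMProg k) (n : ℕ) : RAMConfig k :=
  ([P], { reg := Function.update (fun _ => 0) 0 n, mem := fun _ => 0, out := fun _ => none })

/-- The configuration after `t` steps of `P` on input `H`, where `ω t` is the random vertex that
is available in step number `t` (it is ignored unless that step is a `sample` instruction). -/
def run (P : RAMProg k) (H : KGraph k n) (ω : ℕ → Fin n) : ℕ → RAMConfig k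
  | 0 => P.start n
  | t + 1 => (run P H ω t).step H (ω t)

/-- `P` has halted after at most `t` steps. -/
def HaltedAt (P : RAMProg k) (H : KGraph k n) (ω : ℕ → Fin n) (t : ℕ) : Prop :=
  (P.run H ω t).1 = []

/-- The running time: the number of steps until `P` halts, and `∞` if it never does. -/
noncomputable def runTime (P : RAMProg k) (H : KGraph k n) (ω : ℕ → Fin n) : ℝ≥0∞ :=
  ⨅ (t : ℕ) (_ : P.HaltedAt H ω t), (t : ℝ≥0∞)

/-- The law of the random source: independent uniformly random vertices. -/
noncomputable def randomSource (n : ℕ) [NeZero n] : Measure (ℕ → Fin n) :=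
  Measure.infinitePi fun _ => (PMF.uniformOfFintype (Fin n)).toMeasure

/-- `T_P(H)`, the expected running time of `P` on input `H`. -/
noncomputable def expectedTime (P : RAMProg k) [NeZero n] (H : KGraph k n) : ℝ≥0∞ :=
  ∫⁻ ω, P.runTime H ω ∂(randomSource n)

open Classical in
/-- `T_P(n)`, the average of `T_P(H)` over all `2`-colorable `k`-graphs `H` on `n` vertices. -/
noncomputable def averageTime (P : RAMProg k) (n : ℕ) [NeZero n] : ℝ≥0∞ :=
  (∑ H : {H : KGraph k n // H.TwoColorable}, P.expectedTime H.1) /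
    (Fintype.card {H : KGraph k n // H.TwoColorable} : ℝ≥0∞)

/-- `P` is a randomized `2`-coloring algorithm: on every `2`-colorable `k`-graph it halts almost
surely, and whenever it halts, it has given every vertex a color, and these colors form a
`2`-coloring. -/
def IsTwoColoringAlgorithm (P : RAMProg k) : Prop :=
  ∀ (n : ℕ) [NeZero n] (H : KGraph k n), H.TwoColorable →
    (∀ᵐ ω ∂(randomSource n), ∃ t, P.HaltedAt H ω t) ∧
    ∀ (ω : ℕ → Fin n) (t : ℕ), P.HaltedAt H ω t →
      ∃ c : Fin n → Bool, H.IsTwoColoring c ∧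
        ∀ v : Fin n, (P.run H ω t).2.out v = some (c v)

end RAMProg

/-! ### Total correctness with time bounds -/

/-- The configuration after `t` steps, where `ω i` is available in step number `i`. -/
def RAMConfig.steps {k n : ℕ} (H : KGraph k n) : (ℕ → Fin n) → ℕ → RAMConfig k → RAMConfig k
  | _, 0, a => a
  | ω, t + 1, a => steps H (fun i => ω (i + 1)) t (RAMConfig.step H (ω 0) a)

namespace RAMConfig

variable {k n : ℕ} (H : KGraph k n)

theorem steps_add (s : ℕ) : ∀ (ω : ℕ → Fin n) (t : ℕ) (a : RAMConfig k),
    steps H ω (s + t) a = steps H (fun i => ω (s + i)) t (steps H ω s a) := by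
  induction s with
  | zero => intro ω t a; simp [steps]
  | succ s ih =>
    intro ω t a
    rw [Nat.add_right_comm]
    simp only [steps, ih]
    congr 1
    funext i
    congr 1
    omega

theorem steps_halted (ω : ℕ → Fin n) (t : ℕ) (σ : RAMState) :
    steps H ω t (([], σ) : RAMConfig k) = ([], σ) := by
  induction t generalizing ω with
  | zero => rfl
  | succ t ih => exact ih _

end RAMConfig

namespace RAMProg

variable {k n : ℕ} (H : KGraph k n)

/-- `run` recurses on the last step; `steps` recurses on the first one and may start anywhere, as
the composition rules require. -/
theorem run_eq_steps (P : RAMProg k) (ω : ℕ → Fin n) (t : ℕ) :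
    P.run H ω t = RAMConfig.steps H ω t (P.start n) := by
  induction t with
  | zero => rfl
  | succ t ih => rw [RAMConfig.steps_add, ← ih]; rfl

/-- Started in the state `σ`, the program `P` terminates within `T` steps, whatever the random
source yields, in a state that satisfies `Q`. -/
def Wp (P : RAMProg k) (σ : RAMState) (T : ℕ) (Q : RAMState → Prop) : Prop :=
  ∃ t ≤ T, ∃ σ', Q σ' ∧ ∀ (ω : ℕ → Fin n) (S : List (RAMProg k)),
    RAMConfig.steps H ω t (P :: S, σ) = (S, σ')

variable {H} {P P' : RAMProg k} {σ : RAMState} {T T' T₁ T₂ : ℕ} {Q Q' : RAMState → Prop}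

theorem Wp.mono (h : Wp H P σ T Q) (hT : T ≤ T') (hQ : ∀ σ', Q σ' → Q' σ') : Wp H P σ T' Q' := by
  obtain ⟨t, ht, σ', hσ', hr⟩ := h
  exact ⟨t, ht.trans hT, σ', hQ _ hσ', hr⟩

theorem Wp.le (h : Wp H P σ T Q) (hT : T ≤ T') : Wp H P σ T' Q := h.mono hT fun _ => id

theorem Wp.imp (h : Wp H P σ T Q) (hQ : ∀ σ', Q σ' → Q' σ') : Wp H P σ T Q' := h.mono le_rfl hQ

theorem Wp.const {r m : ℕ} (h : Q { σ with reg := Function.update σ.reg r m }) :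
    Wp H (.instr (.const r m)) σ 1 Q :=
  ⟨1, le_rfl, _, h, fun _ _ => rfl⟩

theorem Wp.copy {r s : ℕ} (h : Q { σ with reg := Function.update σ.reg r (σ.reg s) }) :
    Wp H (.instr (.copy r s)) σ 1 Q :=
  ⟨1, le_rfl, _, h, fun _ _ => rfl⟩

theorem Wp.inc {r : ℕ} (h : Q { σ with reg := Function.update σ.reg r (σ.reg r + 1) }) :
    Wp H (.instr (.inc r)) σ 1 Q :=
  ⟨1, le_rfl, _, h, fun _ _ => rfl⟩

theorem Wp.dec {r : ℕ} (h : Q { σ with reg := Function.update σ.reg r (σ.reg r - 1) }) :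
    Wp H (.instr (.dec r)) σ 1 Q :=
  ⟨1, le_rfl, _, h, fun _ _ => rfl⟩

theorem Wp.load {r s : ℕ} (h : Q { σ with reg := Function.update σ.reg r (σ.mem (σ.reg s)) }) :
    Wp H (.instr (.load r s)) σ 1 Q :=
  ⟨1, le_rfl, _, h, fun _ _ => rfl⟩

theorem Wp.store {r s : ℕ} (h : Q { σ with mem := Function.update σ.mem (σ.reg r) (σ.reg s) }) :
    Wp H (.instr (.store r s)) σ 1 Q :=
  ⟨1, le_rfl, _, h, fun _ _ => rfl⟩

theorem Wp.query {r : ℕ} {q : Fin k → ℕ}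
    (h : Q { σ with
      reg := Function.update σ.reg r (if H.IsEdge (fun i => σ.reg (q i)) then 1 else 0) }) :
    Wp H (.instr (.query r q)) σ 1 Q :=
  ⟨1, le_rfl, _, h, fun _ _ => rfl⟩

theorem Wp.color {r s : ℕ}
    (h : Q { σ with out := Function.update σ.out (σ.reg r) (some (decide (σ.reg s ≠ 0))) }) :
    Wp H (.instr (.color r s)) σ 1 Q :=
  ⟨1, le_rfl, _, h, fun _ _ => rfl⟩

theorem Wp.seq (h : Wp H P σ T₁ fun σ' => Wp H P' σ' T₂ Q) :
    Wp H (.seq P P') σ (T₁ + T₂ + 1) Q := by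
  obtain ⟨t, ht, σ', ⟨t', ht', σ'', h, hr'⟩, hr⟩ := h
  refine ⟨1 + (t + t'), by omega, σ'', h, fun ω S => ?_⟩
  rw [RAMConfig.steps_add, RAMConfig.steps_add]
  change RAMConfig.steps H _ t' (RAMConfig.steps H _ t (P :: P' :: S, σ)) = _
  rw [hr, hr']

theorem Wp.ifLT {r s : ℕ} (h : σ.reg r < σ.reg s → Wp H P σ T₁ Q)
    (h' : ¬σ.reg r < σ.reg s → Wp H P' σ T₂ Q) : Wp H (.ifLT r s P P') σ (max T₁ T₂ + 1) Q := by
  by_cases hlt : σ.reg r < σ.reg s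
  · obtain ⟨t, ht, σ', hQ, hr⟩ := h hlt
    refine ⟨1 + t, by omega, σ', hQ, fun ω S => ?_⟩
    rw [RAMConfig.steps_add]
    change RAMConfig.steps H _ t ((if σ.reg r < σ.reg s then P else P') :: S, σ) = _
    rw [if_pos hlt, hr]
  · obtain ⟨t, ht, σ', hQ, hr⟩ := h' hlt
    refine ⟨1 + t, by omega, σ', hQ, fun ω S => ?_⟩
    rw [RAMConfig.steps_add]
    change RAMConfig.steps H _ t ((if σ.reg r < σ.reg s then P else P') :: S, σ) = _
    rw [if_neg hlt, hr]

theorem Wp.ifLT_pos {r s : ℕ} (hlt : σ.reg r < σ.reg s) (h : Wp H P σ T₁ Q) :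
    Wp H (.ifLT r s P P') σ (T₁ + 1) Q :=
  (Wp.ifLT (T₂ := 0) (fun _ => h) fun h' => absurd hlt h').le (by simp)

theorem Wp.ifLT_neg {r s : ℕ} (hlt : ¬σ.reg r < σ.reg s) (h : Wp H P' σ T₁ Q) :
    Wp H (.ifLT r s P P') σ (T₁ + 1) Q :=
  (Wp.ifLT (T₁ := 0) (fun h' => absurd h' hlt) fun _ => h).le (by simp)

theorem Wp.while_done {r s : ℕ} (hlt : ¬σ.reg r < σ.reg s) (h : Q σ) :
    Wp H (.whileLT r s P) σ 1 Q := by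
  refine ⟨1, le_rfl, σ, h, fun ω S => ?_⟩
  change (if σ.reg r < σ.reg s then _ else _, σ) = _
  rw [if_neg hlt]

theorem Wp.while_unfold {r s : ℕ} (hlt : σ.reg r < σ.reg s)
    (h : Wp H P σ T₁ fun σ' => Wp H (.whileLT r s P) σ' T₂ Q) :
    Wp H (.whileLT r s P) σ (T₁ + T₂ + 1) Q := by
  obtain ⟨t, ht, σ', ⟨t', ht', σ'', h, hr'⟩, hr⟩ := h
  refine ⟨1 + (t + t'), by omega, σ'', h, fun ω S => ?_⟩
  rw [RAMConfig.steps_add, RAMConfig.steps_add]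
  change RAMConfig.steps H _ t' (RAMConfig.steps H _ t
    (if σ.reg r < σ.reg s then P :: .whileLT r s P :: S else S, σ)) = _
  rw [if_pos hlt, hr, hr']

/-- `I i` is the invariant before iteration `i`. The bounds `τ i` may vary, so that a few expensive
iterations do not spoil the sum, and `hend` lets the loop run on after the `m` counted iterations.
-/
theorem Wp.while_steps {r s : ℕ} (I : ℕ → RAMState → Prop) (m : ℕ) (τ : ℕ → ℕ)
    (hstep : ∀ i < m, ∀ σ, I i σ → σ.reg r < σ.reg s ∧ Wp H P σ (τ i) (I (i + 1)))
    (hend : ∀ σ, I m σ → Wp H (.whileLT r s P) σ T Q) (h0 : I 0 σ) :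
    Wp H (.whileLT r s P) σ (∑ i ∈ Finset.range m, (τ i + 1) + T) Q := by
  induction m generalizing I τ σ with
  | zero => simpa using hend σ h0
  | succ m ih =>
    rw [Finset.sum_range_succ']
    obtain ⟨hlt, hb⟩ := hstep 0 (Nat.succ_pos m) σ h0
    refine (Wp.while_unfold (T₂ := ∑ i ∈ Finset.range m, (τ (i + 1) + 1) + T) hlt
      (hb.imp fun σ' hσ' => ?_)).le (by omega)
    exact ih (fun i => I (i + 1)) (fun i => τ (i + 1))
      (fun i hi σ h => hstep (i + 1) (by omega) σ h) hend hσ'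

/-- The rule for a loop that makes exactly `m` iterations, each of at most `T` steps. -/
theorem Wp.while_count {r s : ℕ} (I : ℕ → RAMState → Prop) (m : ℕ)
    (hstep : ∀ i < m, ∀ σ, I i σ → σ.reg r < σ.reg s ∧ Wp H P σ T (I (i + 1)))
    (hend : ∀ σ, I m σ → ¬σ.reg r < σ.reg s) (h0 : I 0 σ) :
    Wp H (.whileLT r s P) σ (m * (T + 1) + 1) (I m) :=
  (Wp.while_steps I m (fun _ => T) hstep
    (fun σ h => Wp.while_done (Q := I m) (hend σ h) h) h0).le (by simp)

/-- A halted configuration no longer changes, so the states at any two halting times both equal the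
state at the sum of these times. -/
theorem Wp.run [NeZero n] (h : Wp H P (P.start n).2 T Q) :
    ∃ σ', Q σ' ∧ (∀ ω, P.runTime H ω ≤ T) ∧ (∀ ω, P.HaltedAt H ω T) ∧
      ∀ ω t, P.HaltedAt H ω t → (P.run H ω t).2 = σ' := by
  obtain ⟨t, ht, σ', hQ, hr⟩ := h
  have hrun : ∀ ω, P.run H ω t = ([], σ') := fun ω => by rw [run_eq_steps]; exact hr ω []
  have hrun' : ∀ ω s, P.run H ω (t + s) = ([], σ') := fun ω s => by
    rw [run_eq_steps, RAMConfig.steps_add, ← run_eq_steps, hrun, RAMConfig.steps_halted]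
  refine ⟨σ', hQ, fun ω => ?_, fun ω => ?_, fun ω s hs => ?_⟩
  · have : P.HaltedAt H ω t := by rw [HaltedAt, hrun]
    exact (iInf₂_le t this).trans (by exact_mod_cast ht)
  · obtain ⟨s, rfl⟩ := Nat.exists_eq_add_of_le ht
    rw [HaltedAt, hrun']
  · have h1 : P.run H ω (s + t) = ([], (P.run H ω s).2) := by
      rw [run_eq_steps, RAMConfig.steps_add, ← run_eq_steps]
      have : P.run H ω s = ([], (P.run H ω s).2) := by
        rw [HaltedAt] at hs; rw [← hs]
      rw [this, RAMConfig.steps_halted]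
    rw [Nat.add_comm, hrun'] at h1
    exact (congrArg Prod.snd h1).symm

end RAMProg

/-! ### Searching a list of queries -/

namespace RAMProg

variable {k n : ℕ} {H : KGraph k n} {σ : RAMState}

/-- Sets register `12` to `1` if one of the queries in the list is answered by `b`, and to `0`
otherwise. -/
def search (b : Bool) : List (Fin k → ℕ) → RAMProg k
  | [] => .instr (.const 12 0)
  | q :: qs => .seq (search b qs) (.seq (.instr (.query 6 q))
      (.ifLT 1 6 (.instr (.const (if b then 12 else 6) 1))
        (.instr (.const (if b then 6 else 12) 1))))

/-- The tail is searched first, so the head query can only raise register `12`. The branch for the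
wrong answer writes to the scratch register `6`; queries must avoid both registers, as they are
overwritten between queries. -/
theorem wp_search (b : Bool) (qs : List (Fin k → ℕ)) (h1 : σ.reg 1 = 0)
    (hq : ∀ q ∈ qs, ∀ i, q i ≠ 6 ∧ q i ≠ 12) :
    Wp H (search b qs) σ (6 * qs.length + 1) fun σ' =>
      (∀ r, r ≠ 6 → r ≠ 12 → σ'.reg r = σ.reg r) ∧ σ'.mem = σ.mem ∧ σ'.out = σ.out ∧
      (0 < σ'.reg 12 ↔ ∃ q ∈ qs, (H.IsEdge (fun i => σ.reg (q i)) ↔ b = true)) := by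
  induction qs with
  | nil =>
    refine Wp.const ⟨fun r _ h => ?_, rfl, rfl, ?_⟩
    · simp [h]
    · simp
  | cons q qs ih =>
    apply Wp.le
    · apply Wp.seq
      refine (ih fun q' hq' => hq q' (List.mem_cons_of_mem _ hq')).imp ?_
      rintro σ' ⟨hr, hm, ho, hc⟩
      have hq0 := hq q List.mem_cons_self
      have he : (fun i => σ'.reg (q i)) = fun i => σ.reg (q i) :=
        funext fun i => hr _ (hq0 i).1 (hq0 i).2
      apply Wp.seq
      apply Wp.query
      rw [he]
      have h1' : σ'.reg 1 = 0 := by rw [hr 1 (by decide) (by decide), h1]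
      by_cases hE : H.IsEdge fun i => σ.reg (q i)
      · apply Wp.ifLT_pos
        · simp [hE, h1']
        · apply Wp.const
          refine ⟨fun r h6 h12 => ?_, hm, ho, ?_⟩
          · cases b <;> simp [h6, h12, hr]
          · cases b
            · simp [hE, hc]
            · simp [hE]
      · apply Wp.ifLT_neg
        · simp [hE, h1']
        · apply Wp.const
          refine ⟨fun r h6 h12 => ?_, hm, ho, ?_⟩
          · cases b <;> simp [h6, h12, hr]
          · cases b
            · simp [hE]
            · simp [hE, hc]
    · simp only [List.length_cons]
      omega

end RAMProg

/-! ### Gadgets and the colors that they force -/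

namespace KGraph

variable {j n t : ℕ}

/-- `col` gives two different colors to every edge. -/
def ProperOn (H : KGraph (j + 3) n) (col : ℕ → Bool) : Prop :=
  ∀ q, H.IsEdge q → ∃ a b, col (q a) ≠ col (q b)

/-- The two groups of `t` vertices `z false` and `z true` span all edges that meet both groups. -/
def IsGadget (H : KGraph (j + 3) n) (z : Bool → Fin t → ℕ) : Prop :=
  ∀ f : Fin (j + 3) → Bool × Fin t, Function.Injective f → (∃ a b, (f a).1 ≠ (f b).1) →
    H.IsEdge fun a => z (f a).1 (f a).2

/-- Some edge consists of `v` and vertices of the group `z b`. -/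
def Hit (H : KGraph (j + 3) n) (z : Bool → Fin t → ℕ) (b : Bool) (v : ℕ) : Prop :=
  ∃ f : Fin (j + 2) → Fin t, Function.Injective f ∧
    H.IsEdge (Fin.cons v fun i => z b (f i) : Fin (j + 3) → ℕ)

/-- Some edge consists of `v`, `w` and vertices of the group `z b`. -/
def PairHit (H : KGraph (j + 3) n) (z : Bool → Fin t → ℕ) (b : Bool) (v w : ℕ) : Prop :=
  ∃ f : Fin (j + 1) → Fin t, Function.Injective f ∧
    H.IsEdge (Fin.cons v (Fin.cons w fun i => z b (f i) : Fin (j + 2) → ℕ) : Fin (j + 3) → ℕ)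

/-- Otherwise the edge behind the hit would be monochromatic of color `b`. This and
`ProperOn.pairHit` are the only inferences of colors that the algorithm makes. -/
theorem ProperOn.hit {H : KGraph (j + 3) n} {col : ℕ → Bool} (hcol : H.ProperOn col)
    {z : Bool → Fin t → ℕ} (hz : ∀ b i, col (z b i) = b) {b : Bool} {v : ℕ} (h : H.Hit z b v) :
    col v = !b := by
  obtain ⟨f, -, hf⟩ := h
  obtain ⟨a, a', ha⟩ := hcol _ hf
  by_contra hv
  have hv' : col v = b := by cases b <;> simpa using hv
  have : ∀ a, col ((Fin.cons v fun i => z b (f i) : Fin (j + 3) → ℕ) a) = b := by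
    intro a
    refine Fin.cases ?_ (fun i => ?_) a
    · simpa using hv'
    · simpa using hz b (f i)
  exact ha ((this a).trans (this a').symm)

theorem ProperOn.pairHit {H : KGraph (j + 3) n} {col : ℕ → Bool} (hcol : H.ProperOn col)
    {z : Bool → Fin t → ℕ} (hz : ∀ b i, col (z b i) = b) {b : Bool} {v w : ℕ} (hw : col w = b)
    (h : H.PairHit z b v w) : col v = !b := by
  obtain ⟨f, -, hf⟩ := h
  obtain ⟨a, a', ha⟩ := hcol _ hf
  by_contra hv
  have hv' : col v = b := by cases b <;> simpa using hv
  have : ∀ a, col ((Fin.cons v (Fin.cons w fun i => z b (f i) : Fin (j + 2) → ℕ) :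
      Fin (j + 3) → ℕ) a) = b := by
    intro a
    refine Fin.cases ?_ (fun i => ?_) a
    · simpa using hv'
    · refine Fin.cases ?_ (fun i => ?_) i
      · simpa using hw
      · simpa using hz b (f i)
  exact ha ((this a).trans (this a').symm)

/-- `v` is a vertex of the gadget. -/
def InGadget (z : Bool → Fin t → ℕ) (v : ℕ) : Prop := ∃ b i, z b i = v

/-- `v` is not in the gadget, and its color is forced by the gadget. -/
def Decided (H : KGraph (j + 3) n) (z : Bool → Fin t → ℕ) (col : ℕ → Bool) (v : ℕ) : Prop :=
  ¬InGadget z v ∧ H.Hit z (!col v) v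

/-- `v` is not in the gadget, and its color is not forced by the gadget. -/
def Undecided (H : KGraph (j + 3) n) (z : Bool → Fin t → ℕ) (col : ℕ → Bool) (v : ℕ) : Prop :=
  ¬InGadget z v ∧ ¬H.Hit z (!col v) v

open Classical in
/-- The decided vertices of color `b` below `v`. -/
noncomputable def decList (H : KGraph (j + 3) n) (z : Bool → Fin t → ℕ) (col : ℕ → Bool)
    (b : Bool) (v : ℕ) : List ℕ :=
  (List.range v).filter fun u => decide (H.Decided z col u ∧ col u = b)

theorem length_decList_le (H : KGraph (j + 3) n) (z : Bool → Fin t → ℕ) (col : ℕ → Bool)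
    (b : Bool) (v : ℕ) : (H.decList z col b v).length ≤ v :=
  (List.length_filter_le _ _).trans (by simp)

theorem decList_succ_of_mem {H : KGraph (j + 3) n} {z : Bool → Fin t → ℕ} {col : ℕ → Bool}
    {b : Bool} {v : ℕ} (h : H.Decided z col v ∧ col v = b) :
    H.decList z col b (v + 1) = H.decList z col b v ++ [v] := by
  simp [decList, List.range_succ, List.filter_append, h]

theorem decList_succ_of_not_mem {H : KGraph (j + 3) n} {z : Bool → Fin t → ℕ} {col : ℕ → Bool}
    {b : Bool} {v : ℕ} (h : ¬(H.Decided z col v ∧ col v = b)) :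
    H.decList z col b (v + 1) = H.decList z col b v := by
  simp [decList, List.range_succ, List.filter_append, h]

/-- The number of pairs that are available in order to decide further vertices. -/
noncomputable def pairCount (H : KGraph (j + 3) n) (z : Bool → Fin t → ℕ) (col : ℕ → Bool) : ℕ :=
  min (H.decList z col false n).length (H.decList z col true n).length

open Classical in
/-- The number of useless pairs that are inspected before `v` is decided. -/
noncomputable def missCount (H : KGraph (j + 3) n) (z : Bool → Fin t → ℕ) (col : ℕ → Bool)
    (v : ℕ) : ℕ :=
  ((H.decList z col (!col v) n).take (H.pairCount z col)).findIdx
    fun w => decide (H.PairHit z (!col v) v w)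

end KGraph

/-! ### The queries of the algorithm and the first pass over the vertices -/

namespace RAMProg

open KGraph

variable {j n t : ℕ} {H : KGraph (j + 3) n} {σ : RAMState}

/-- The register of a gadget vertex. -/
def gadReg (b : Bool) (i : Fin t) : ℕ := 20 + 2 * i + b.toNat

/-- The gadget candidate that is stored in the registers. -/
def gadOf (t : ℕ) (ζ : ℕ → ℕ) (b : Bool) (i : Fin t) : ℕ := ζ (gadReg b i)

theorem le_gadReg (b : Bool) (i : Fin t) : 20 ≤ gadReg b i := by unfold gadReg; omega

/-- The queries of `KGraph.IsGadget`. -/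
noncomputable def gadQueries (j t : ℕ) : List (Fin (j + 3) → ℕ) :=
  (Finset.univ.filter fun f : Fin (j + 3) → Bool × Fin t =>
    Function.Injective f ∧ ∃ a b, (f a).1 ≠ (f b).1).toList.map
      fun f a => gadReg (f a).1 (f a).2

/-- The queries of `KGraph.Hit` for the vertex in register `4`. -/
noncomputable def hitQueries (j t : ℕ) (b : Bool) : List (Fin (j + 3) → ℕ) :=
  (Finset.univ.filter fun f : Fin (j + 2) → Fin t => Function.Injective f).toList.map
    fun f => Fin.cons 4 fun i => gadReg b (f i)

/-- The queries of `KGraph.PairHit` for the vertices in the registers `4` and `5`. -/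
noncomputable def pairQueries (j t : ℕ) (b : Bool) : List (Fin (j + 3) → ℕ) :=
  (Finset.univ.filter fun f : Fin (j + 1) → Fin t => Function.Injective f).toList.map
    fun f => Fin.cons 4 (Fin.cons 5 fun i => gadReg b (f i) : Fin (j + 2) → ℕ)

/-- The registers that hold `n`, `0`, `1` and `ζ` in the entire computation. -/
structure Env (n : ℕ) (ζ : ℕ → ℕ) (σ : RAMState) : Prop where
  reg_zero : σ.reg 0 = n
  reg_one : σ.reg 1 = 0
  reg_two : σ.reg 2 = 1
  reg_high : ∀ r, 20 ≤ r → σ.reg r = ζ r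

/-- The number of steps of a search is at most this constant. -/
noncomputable def searchTime (j t : ℕ) : ℕ :=
  6 * ((gadQueries j t).length + (hitQueries j t false).length +
    (hitQueries j t true).length + (pairQueries j t false).length +
    (pairQueries j t true).length) + 1

theorem Env.gadOf_eq {ζ : ℕ → ℕ} (h : Env n ζ σ) : gadOf t σ.reg = gadOf t ζ := by
  funext b i
  exact h.reg_high _ (le_gadReg b i)

theorem Env.congr {ζ : ℕ → ℕ} (h : Env n ζ σ) {σ' : RAMState}
    (hreg : ∀ r, r < 3 ∨ 20 ≤ r → σ'.reg r = σ.reg r) : Env n ζ σ' where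
  reg_zero := by rw [hreg _ (by omega), h.reg_zero]
  reg_one := by rw [hreg _ (by omega), h.reg_one]
  reg_two := by rw [hreg _ (by omega), h.reg_two]
  reg_high r hr := by rw [hreg _ (by omega), h.reg_high r hr]

theorem Env.update {ζ : ℕ → ℕ} (h : Env n ζ σ) {r m : ℕ} (hr : 3 ≤ r) (hr' : r < 20)
    {μ : ℕ → ℕ} {o : ℕ → Option Bool} : Env n ζ ⟨Function.update σ.reg r m, μ, o⟩ :=
  h.congr fun _ _ => Function.update_of_ne (by omega) _ _

theorem wp_search_gad {ζ : ℕ → ℕ} (hE : Env n ζ σ) :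
    Wp H (search false (gadQueries j t)) σ (searchTime j t) fun σ' =>
      (∀ r, r ≠ 6 → r ≠ 12 → σ'.reg r = σ.reg r) ∧ σ'.mem = σ.mem ∧ σ'.out = σ.out ∧
      (0 < σ'.reg 12 ↔ ¬H.IsGadget (gadOf t ζ)) := by
  refine (wp_search false _ hE.reg_one ?_).mono (by unfold searchTime; omega) ?_
  · simp only [gadQueries, List.mem_map, forall_exists_index, and_imp]
    rintro q f - rfl i
    have := le_gadReg (f i).1 (f i).2
    dsimp only
    constructor <;> omega
  · rintro σ' ⟨h1, h2, h3, h4⟩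
    rw [← hE.gadOf_eq (t := t)]
    refine ⟨h1, h2, h3, h4.trans ?_⟩
    simp [gadQueries, IsGadget, gadOf, and_assoc]

theorem wp_search_hit {ζ : ℕ → ℕ} {v : ℕ} (b : Bool) (hE : Env n ζ σ) (hv : σ.reg 4 = v) :
    Wp H (search true (hitQueries j t b)) σ (searchTime j t) fun σ' =>
      (∀ r, r ≠ 6 → r ≠ 12 → σ'.reg r = σ.reg r) ∧ σ'.mem = σ.mem ∧ σ'.out = σ.out ∧
      (0 < σ'.reg 12 ↔ H.Hit (gadOf t ζ) b v) := by
  refine (wp_search true _ hE.reg_one ?_).mono (by unfold searchTime; cases b <;> omega) ?_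
  · simp only [hitQueries, List.mem_map, forall_exists_index, and_imp]
    rintro q f - rfl i
    refine Fin.cases (by simp) (fun i => ?_) i
    have := le_gadReg b (f i)
    simp only [Fin.cons_succ]
    constructor <;> omega
  · rintro σ' ⟨h1, h2, h3, h4⟩
    subst hv
    rw [← hE.gadOf_eq (t := t)]
    refine ⟨h1, h2, h3, h4.trans ?_⟩
    simp only [hitQueries, List.mem_map, Finset.mem_toList, Finset.mem_filter, Finset.mem_univ,
      true_and, iff_true, exists_exists_and_eq_and, Hit, gadOf]
    refine exists_congr fun f => and_congr_right fun _ => ?_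
    refine iff_of_eq (congrArg _ (funext fun i => ?_))
    refine Fin.cases (by simp) (fun i => by simp) i

theorem wp_search_pair {ζ : ℕ → ℕ} {v w : ℕ} (b : Bool) (hE : Env n ζ σ)
    (hv : σ.reg 4 = v) (hw : σ.reg 5 = w) :
    Wp H (search true (pairQueries j t b)) σ (searchTime j t) fun σ' =>
      (∀ r, r ≠ 6 → r ≠ 12 → σ'.reg r = σ.reg r) ∧ σ'.mem = σ.mem ∧ σ'.out = σ.out ∧
      (0 < σ'.reg 12 ↔ H.PairHit (gadOf t ζ) b v w) := by
  refine (wp_search true _ hE.reg_one ?_).mono (by unfold searchTime; cases b <;> omega) ?_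
  · simp only [pairQueries, List.mem_map, forall_exists_index, and_imp]
    rintro q f - rfl i
    refine Fin.cases (by simp) (fun i => ?_) i
    refine Fin.cases (by simp) (fun i => ?_) i
    have := le_gadReg b (f i)
    simp only [Fin.cons_succ]
    constructor <;> omega
  · rintro σ' ⟨h1, h2, h3, h4⟩
    subst hv hw
    rw [← hE.gadOf_eq (t := t)]
    refine ⟨h1, h2, h3, h4.trans ?_⟩
    simp only [pairQueries, List.mem_map, Finset.mem_toList, Finset.mem_filter, Finset.mem_univ,
      true_and, iff_true, exists_exists_and_eq_and, PairHit, gadOf]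
    refine exists_congr fun f => and_congr_right fun _ => ?_
    refine iff_of_eq (congrArg _ (funext fun i => ?_))
    refine Fin.cases (by simp) (fun i => ?_) i
    refine Fin.cases (by simp) (fun i => by simp) i

/-- Gives the color `b` to the vertex in register `4` and appends it to the list of decided vertices
of color `b`. -/
def assign (b : Bool) : RAMProg (j + 3) :=
  .seq (.instr (.const 11 (1 + b.toNat))) (.seq (.instr (.store 4 11))
    (.seq (.instr (.store (7 + b.toNat) 4)) (.instr (.inc (7 + b.toNat)))))

/-- The first attempt to decide the vertex in register `4`. -/
noncomputable def firstVisit (j t : ℕ) : RAMProg (j + 3) :=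
  .seq (.instr (.load 11 4)) (.ifLT 1 11 (.instr (.const 6 0))
    (.seq (search true (hitQueries j t false)) (.ifLT 1 12 (assign true)
      (.seq (search true (hitQueries j t true)) (.ifLT 1 12 (assign false)
        (.instr (.const 6 0)))))))

open Classical in
/-- The state in the first pass when the vertices below `v` have been visited. -/
structure FirstPass (H : KGraph (j + 3) n) (ζ : ℕ → ℕ) (t : ℕ) (col : ℕ → Bool) (v : ℕ)
    (σ : RAMState) : Prop extends Env n ζ σ where
  reg_three : σ.reg 3 = 0
  reg_four : σ.reg 4 = v
  reg_base : σ.reg 14 = n + n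
  -- Memory layout: cells below `n` hold marks (`0` for no color, else `1` plus the color), and the
  -- blocks of length `n` starting at `n` and `2 * n` hold the decided vertices of color `false` and
  -- `true`. Registers `7` and `8` point behind the last entries.
  reg_ptr : ∀ b : Bool, σ.reg (7 + b.toNat) =
    n * (1 + b.toNat) + (H.decList (gadOf t ζ) col b v).length
  mem_mark : ∀ u < n, σ.mem u =
    if InGadget (gadOf t ζ) u ∨ (u < v ∧ H.Decided (gadOf t ζ) col u)
    then 1 + (col u).toNat else 0
  mem_list : ∀ b i w, (H.decList (gadOf t ζ) col b v)[i]? = some w →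
    σ.mem (n * (1 + b.toNat) + i) = w

variable {ζ : ℕ → ℕ} {col : ℕ → Bool} {v : ℕ}

theorem FirstPass.skip {v : ℕ} (h : FirstPass H ζ t col v σ)
    (hv : ¬H.Decided (gadOf t ζ) col v) {σ' : RAMState}
    (hreg : ∀ r, r ≠ 4 → r ≠ 6 → r ≠ 11 → r ≠ 12 → σ'.reg r = σ.reg r) (h4 : σ'.reg 4 = v + 1)
    (hmem : σ'.mem = σ.mem) : FirstPass H ζ t col (v + 1) σ' where
  reg_zero := by rw [hreg] <;> first | exact h.reg_zero | decide
  reg_one := by rw [hreg] <;> first | exact h.reg_one | decide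
  reg_two := by rw [hreg] <;> first | exact h.reg_two | decide
  reg_high r hr := by rw [hreg] <;> first | exact h.reg_high r hr | omega
  reg_three := by rw [hreg] <;> first | exact h.reg_three | decide
  reg_four := h4
  reg_base := by rw [hreg] <;> first | exact h.reg_base | decide
  reg_ptr b := by
    rw [hreg, h.reg_ptr, decList_succ_of_not_mem (fun h => hv h.1)] <;> cases b <;> decide
  mem_mark u hu := by
    rw [hmem, h.mem_mark u hu]
    have : (u < v + 1 ∧ H.Decided (gadOf t ζ) col u) ↔ (u < v ∧ H.Decided (gadOf t ζ) col u) := by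
      refine and_congr_left fun hd => ?_
      have : u ≠ v := by rintro rfl; exact hv hd
      omega
    classical exact if_congr (or_congr_right this.symm) rfl rfl
  mem_list b i w hi := by
    rw [decList_succ_of_not_mem (fun h => hv h.1)] at hi
    rw [hmem, h.mem_list b i w hi]

theorem FirstPass.assign {v : ℕ} (hvn : v < n) (h : FirstPass H ζ t col v σ) {b : Bool}
    (hv : H.Decided (gadOf t ζ) col v) (hb : col v = b) {σ' : RAMState}
    (hreg : ∀ r, r ≠ 4 → r ≠ 6 → r ≠ 11 → r ≠ 12 → r ≠ 7 + b.toNat → σ'.reg r = σ.reg r)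
    (h4 : σ'.reg 4 = v + 1) (hptr : σ'.reg (7 + b.toNat) = σ.reg (7 + b.toNat) + 1)
    (hmem : σ'.mem = Function.update (Function.update σ.mem v (1 + b.toNat))
      (σ.reg (7 + b.toNat)) v) : FirstPass H ζ t col (v + 1) σ' := by
  -- A list has at most `v < n` entries, so appending to it stays inside its own block and damages
  -- neither the marks nor the other list.
  have hlen : ∀ b, (H.decList (gadOf t ζ) col b v).length ≤ v := fun b => length_decList_le _ _ _ _ _
  have hne : ∀ u < n, u ≠ σ.reg (7 + b.toNat) := fun u hu => by
    have := h.reg_ptr b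
    cases b <;> simp at this ⊢ <;> omega
  have hmem' : ∀ a, a ≠ v → a ≠ σ.reg (7 + b.toNat) → σ'.mem a = σ.mem a := fun a h1 h2 => by
    rw [hmem]; simp [h1, h2]
  have hlow : 7 + b.toNat < 9 ∧ 7 ≤ 7 + b.toNat := by cases b <;> decide
  refine ⟨⟨?_, ?_, ?_, fun r hr => ?_⟩, ?_, h4, ?_, fun b' => ?_, fun u hu => ?_, fun b' i w hi => ?_⟩
  · rw [hreg] <;> first | exact h.reg_zero | omega
  · rw [hreg] <;> first | exact h.reg_one | omega
  · rw [hreg] <;> first | exact h.reg_two | omega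
  · rw [hreg] <;> first | exact h.reg_high r hr | omega
  · rw [hreg] <;> first | exact h.reg_three | omega
  · rw [hreg] <;> first | exact h.reg_base | omega
  · by_cases hbb : b' = b
    · subst hbb
      rw [hptr, h.reg_ptr, decList_succ_of_mem ⟨hv, hb⟩]
      simp [add_assoc]
    · have : 7 + b'.toNat ≠ 7 + b.toNat := by revert hbb; cases b <;> cases b' <;> decide
      have h2 : 7 + b'.toNat < 9 ∧ 7 ≤ 7 + b'.toNat := by cases b' <;> decide
      rw [hreg _ (by omega) (by omega) (by omega) (by omega) this, h.reg_ptr,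
        decList_succ_of_not_mem (fun h => hbb (h.2.symm.trans hb))]
  · by_cases huv : u = v
    · subst huv
      rw [if_pos (Or.inr ⟨Nat.lt_succ_self _, hv⟩), hmem, hb]
      simp [hne u hu]
    · rw [hmem' u huv (hne u hu), h.mem_mark u hu]
      have : (u < v) ↔ (u < v + 1) := by omega
      classical exact if_congr (or_congr_right (and_congr_left' this)) rfl rfl
  · by_cases hbb : b' = b
    · subst hbb
      rw [decList_succ_of_mem ⟨hv, hb⟩] at hi
      by_cases hil : i < (H.decList (gadOf t ζ) col b' v).length
      · rw [List.getElem?_append_left hil] at hi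
        rw [hmem' _ ?_ ?_]
        · exact h.mem_list _ _ _ hi
        · have := Nat.le_mul_of_pos_right n (show 0 < 1 + b'.toNat by omega)
          omega
        · rw [h.reg_ptr]; omega
      · rw [List.getElem?_append_right (by omega)] at hi
        have hil' : i = (H.decList (gadOf t ζ) col b' v).length := by
          by_contra hne
          have : 1 ≤ i - (H.decList (gadOf t ζ) col b' v).length := by omega
          rw [List.getElem?_eq_none (by simpa using this)] at hi
          cases hi
        subst hil'
        simp only [Nat.sub_self, List.getElem?_cons_zero, Option.some.injEq] at hi
        rw [hmem, h.reg_ptr, Function.update_self, hi]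
    · rw [decList_succ_of_not_mem (fun h => hbb (h.2.symm.trans hb))] at hi
      have hil : i < (H.decList (gadOf t ζ) col b' v).length :=
        (List.getElem?_eq_some_iff.1 hi).1
      rw [hmem' _ ?_ ?_]
      · exact h.mem_list _ _ _ hi
      · have := Nat.le_mul_of_pos_right n (show 0 < 1 + b'.toNat by omega)
        omega
      · have h1 := hlen b
        have h2 := hlen b'
        rw [h.reg_ptr]
        revert hbb
        cases b <;> cases b' <;> simp <;> omega

end RAMProg

namespace RAMProg

open KGraph

variable {j n t : ℕ} {H : KGraph (j + 3) n} {σ : RAMState} {ζ : ℕ → ℕ} {col : ℕ → Bool} {v : ℕ}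

theorem wp_firstVisit (hcol : H.ProperOn col) (hz : ∀ b (i : Fin t), col (gadOf t ζ b i) = b)
    (hv : v < n) (h : FirstPass H ζ t col v σ) :
    Wp H (.seq (firstVisit j t) (.instr (.inc 4))) σ (2 * searchTime j t + 20)
      (FirstPass H ζ t col (v + 1)) := by
  have hmark := h.mem_mark v hv
  have h4 := h.reg_four
  have h1 := h.reg_one
  apply Wp.le
  · apply Wp.seq
    apply Wp.seq
    apply Wp.load
    by_cases hg : InGadget (gadOf t ζ) v
    · apply Wp.ifLT_pos
      · simp [h4, h1, hmark, hg]
      · apply Wp.le (T' := 2 * searchTime j t + 15)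
        · apply Wp.const
          apply Wp.inc
          refine h.skip (fun h => h.1 hg) (fun r h4 h6 h11 h12 => ?_) ?_ rfl
          · simp [h4, h6, h11]
          · simp [h4]
        · omega
    · apply Wp.ifLT_neg
      · simp [h4, h1, hmark, hg]
      · apply Wp.le (T' := 2 * searchTime j t + 15)
        · apply Wp.seq
          refine (wp_search_hit (v := v) false (h.toEnv.update (by decide) (by decide))
            (by simp [h4])).imp ?_
          rintro σ₁ ⟨hr₁, hm₁, ho₁, hc₁⟩
          dsimp only at hr₁ hm₁
          have hE₁ : Env n ζ σ₁ := h.toEnv.congr fun r hr => by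
            rw [hr₁ r (by omega) (by omega), Function.update_of_ne (by omega)]
          have h1' : σ₁.reg 1 = 0 := hE₁.reg_one
          have h4' : σ₁.reg 4 = v := by simp [hr₁, h4]
          apply Wp.ifLT
          · intro hlt
            rw [h1', hc₁] at hlt
            have hb : col v = true := hcol.hit hz hlt
            apply Wp.seq
            apply Wp.const
            apply Wp.seq
            apply Wp.store
            apply Wp.seq
            apply Wp.store
            apply Wp.inc
            apply Wp.inc
            refine h.assign hv (b := true) ⟨hg, by rwa [hb]⟩ hb (fun r _ h6 h11 h12 h8 => ?_) ?_ ?_ ?_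
            · simp at h8
              simp [*]
            · simp [h4']
            · simp [hr₁]
            · simp [hm₁, h4', hr₁]
          · intro hlt
            rw [h1', hc₁] at hlt
            apply Wp.seq
            refine (wp_search_hit true hE₁ h4').imp ?_
            rintro σ₂ ⟨hr₂, hm₂, ho₂, hc₂⟩
            have h1₂ : σ₂.reg 1 = 0 := by simp [hr₂, h1']
            have h4₂ : σ₂.reg 4 = v := by simp [hr₂, h4']
            apply Wp.ifLT
            · intro hlt'
              rw [h1₂, hc₂] at hlt'
              have hb : col v = false := hcol.hit hz hlt'
              apply Wp.seq
              apply Wp.const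
              apply Wp.seq
              apply Wp.store
              apply Wp.seq
              apply Wp.store
              apply Wp.inc
              apply Wp.inc
              refine h.assign hv (b := false) ⟨hg, by rwa [hb]⟩ hb (fun r _ h6 h11 h12 h8 => ?_)
                ?_ ?_ ?_
              · simp at h8
                simp [*]
              · simp [h4₂]
              · simp [hr₁, hr₂]
              · simp [hm₁, hm₂, h4₂, hr₁, hr₂]
            · intro hlt'
              rw [h1₂, hc₂] at hlt'
              apply Wp.const
              apply Wp.inc
              refine h.skip (fun hd => ?_) (fun r h4 h6 h11 h12 => ?_) ?_ ?_
              · have := hd.2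
                cases hb : col v <;> simp only [hb, Bool.not_true, Bool.not_false] at this <;> contradiction
              · simp [*]
              · simp [h4₂]
              · simp [hm₁, hm₂]
        · omega
  · omega

end RAMProg

/-! ### The second pass: scanning pairs of decided vertices -/

namespace KGraph

variable {j n t : ℕ} {H : KGraph (j + 3) n} {z : Bool → Fin t → ℕ} {col : ℕ → Bool}

theorem color_of_mem_decList {b : Bool} {v w : ℕ} (h : w ∈ H.decList z col b v) : col w = b := by
  simp only [decList, List.mem_filter, decide_eq_true_eq] at h
  exact h.2.2

theorem pairCount_le (b : Bool) : H.pairCount z col ≤ (H.decList z col b n).length := by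
  cases b
  · exact min_le_left _ _
  · exact min_le_right _ _

theorem missCount_le (v : ℕ) : H.missCount z col v ≤ H.pairCount z col := by
  refine List.findIdx_le_length.trans ?_
  simp

/-- The color of `v` is unknown to the machine, so the entries number `i` of both lists are tested.
Only the list of color `!col v` can yield a hit, by `ProperOn.pairHit`; hence the first success is
at `i = missCount`. -/
theorem ProperOn.pairHit_iff (hcol : H.ProperOn col) (hz : ∀ b (i : Fin t), col (z b i) = b)
    {v i : ℕ} (hi : i < H.pairCount z col) :
    ∃ w : Bool → ℕ, (∀ b, (H.decList z col b n)[i]? = some (w b)) ∧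
      (i < H.missCount z col v → ∀ b, ¬H.PairHit z b v (w b)) ∧
      (i = H.missCount z col v → ∀ b, H.PairHit z b v (w b) ↔ col v = !b) := by
  have hlen : ∀ b, i < (H.decList z col b n).length := fun b => hi.trans_le (pairCount_le b)
  have hw : ∀ b, col ((H.decList z col b n)[i]'(hlen b)) = b := fun b =>
    color_of_mem_decList (List.getElem_mem _)
  refine ⟨fun b => (H.decList z col b n)[i]'(hlen b), fun b => List.getElem?_eq_getElem _,
    fun him b hb => ?_, fun him b => ⟨hcol.pairHit hz (hw b), fun hv => ?_⟩⟩
  · have hv := hcol.pairHit hz (hw b) hb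
    have := List.not_of_lt_findIdx him
    rw [List.getElem_take] at this
    obtain rfl : b = !col v := by rw [hv, Bool.not_not]
    simp only [decide_eq_false_iff_not] at this
    exact this hb
  · obtain rfl : b = !col v := by rw [hv, Bool.not_not]
    classical
    have h' : H.missCount z col v < ((H.decList z col (!col v) n).take (H.pairCount z col)).length := by
      rw [List.length_take, ← him]
      exact lt_min hi (hlen _)
    have := List.findIdx_getElem (w := h')
    subst him
    have e := List.getElem_take (xs := H.decList z col (!col v) n) (h := h')
    dsimp only
    rw [← e]
    exact of_decide_eq_true this

end KGraph

namespace RAMProg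

open KGraph

variable {j n t : ℕ} {H : KGraph (j + 3) n} {σ : RAMState} {ζ : ℕ → ℕ} {col : ℕ → Bool} {v : ℕ}

/-- Gives the color `b` to the vertex in register `4` and ends the scan. -/
def found (b : Bool) : RAMProg (j + 3) :=
  .seq (.instr (.const 11 (1 + b.toNat))) (.seq (.instr (.store 4 11)) (.instr (.copy 9 7)))

/-- Inspects the vertices that the registers `9` and `10` point to. -/
noncomputable def scanBody (j t : ℕ) : RAMProg (j + 3) :=
  .seq (.instr (.load 5 9)) (.seq (search true (pairQueries j t false)) (.ifLT 1 12 (found true)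
    (.seq (.instr (.load 5 10)) (.seq (search true (pairQueries j t true))
      (.ifLT 1 12 (found false) (.seq (.instr (.inc 9)) (.instr (.inc 10))))))))

/-- Inspects pairs of decided vertices until the vertex in register `4` is decided. -/
noncomputable def scan (j t : ℕ) : RAMProg (j + 3) :=
  .whileLT 9 7 (.ifLT 10 8 (scanBody j t) (.instr (.copy 9 7)))

/-- The second attempt to decide the vertex in register `4`. -/
noncomputable def secondVisit (j t : ℕ) : RAMProg (j + 3) :=
  .seq (.instr (.load 11 4)) (.ifLT 1 11 (.instr (.const 6 0))
    (.seq (.instr (.copy 9 0)) (.seq (.instr (.copy 10 14)) (.seq (scan j t)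
      (.ifLT 1 11 (.instr (.const 6 0)) (.instr (.const 17 0)))))))

open Classical in
/-- The state in the second pass when the vertices below `v` have been visited and the vertices
in `D` are decided; `F` says that no visit was in vain. -/
structure SecondPass (H : KGraph (j + 3) n) (ζ : ℕ → ℕ) (t : ℕ) (col : ℕ → Bool) (D : Set ℕ)
    (F : Prop) (v : ℕ) (σ : RAMState) : Prop extends Env n ζ σ where
  reg_three : σ.reg 3 = 0
  reg_four : σ.reg 4 = v
  reg_base : σ.reg 14 = n + n
  reg_flag : σ.reg 17 = if F then 1 else 0
  reg_ptr : ∀ b : Bool, σ.reg (7 + b.toNat) =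
    n * (1 + b.toNat) + (H.decList (gadOf t ζ) col b n).length
  mem_mark : ∀ u < n, σ.mem u = if u ∈ D then 1 + (col u).toNat else 0
  mem_list : ∀ b i w, (H.decList (gadOf t ζ) col b n)[i]? = some w →
    σ.mem (n * (1 + b.toNat) + i) = w

/-- The registers that a scan may change. -/
def scanRegs : Finset ℕ := {5, 6, 9, 10, 11, 12}

variable {D : Set ℕ} {F : Prop}

theorem SecondPass.frame (h : SecondPass H ζ t col D F v σ) {σ' : RAMState}
    (hreg : ∀ r ∉ scanRegs, σ'.reg r = σ.reg r) (hmem : σ'.mem = σ.mem) :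
    SecondPass H ζ t col D F v σ' where
  toEnv := h.toEnv.congr fun r hr => hreg r (by simp [scanRegs]; omega)
  reg_three := by rw [hreg _ (by decide), h.reg_three]
  reg_four := by rw [hreg _ (by decide), h.reg_four]
  reg_base := by rw [hreg _ (by decide), h.reg_base]
  reg_flag := by rw [hreg _ (by decide), h.reg_flag]
  reg_ptr b := by rw [hreg _ (by cases b <;> decide), h.reg_ptr]
  mem_mark := by rw [hmem]; exact h.mem_mark
  mem_list := by rw [hmem]; exact h.mem_list

/-- As `i ≤ missCount`, the `else` branch is the case of equality, where `v` is decided; setting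
register `9` to register `7` then ends the scan. -/
theorem wp_scanBody (hcol : H.ProperOn col) (hz : ∀ b (i : Fin t), col (gadOf t ζ b i) = b)
    (h : SecondPass H ζ t col D F v σ) {i : ℕ} (h9 : σ.reg 9 = n + i)
    (h10 : σ.reg 10 = n + n + i) (hi : i < H.pairCount (gadOf t ζ) col)
    (him : i ≤ H.missCount (gadOf t ζ) col v) :
    Wp H (scanBody j t) σ (2 * searchTime j t + 15) fun σ' =>
      (∀ r ∉ scanRegs, σ'.reg r = σ.reg r) ∧
      if i < H.missCount (gadOf t ζ) col v then
        σ'.mem = σ.mem ∧ σ'.reg 9 = n + (i + 1) ∧ σ'.reg 10 = n + n + (i + 1) ∧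
          σ'.reg 11 = σ.reg 11
      else σ'.mem = Function.update σ.mem v (1 + (col v).toNat) ∧ σ'.reg 9 = σ'.reg 7 ∧
          σ'.reg 11 = 1 + (col v).toNat := by
  obtain ⟨w, hw, hlt, heq⟩ := hcol.pairHit_iff hz (v := v) hi
  have hload : ∀ b : Bool, σ.mem (n * (1 + b.toNat) + i) = w b := fun b => h.mem_list b i _ (hw b)
  have hl0 : σ.mem (n + i) = w false := by simpa using hload false
  have hl1 : σ.mem (n + n + i) = w true := by
    rw [← hload true]; congr 1; simp; ring
  have h4 := h.reg_four
  have hfound : ∀ b : Bool, H.PairHit (gadOf t ζ) b v (w b) →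
      col v = (!b) ∧ ¬i < H.missCount (gadOf t ζ) col v := fun b hb => by
    have hi' : ¬i < H.missCount (gadOf t ζ) col v := fun hi => hlt hi b hb
    exact ⟨(heq (by omega) b).1 hb, hi'⟩
  apply Wp.le
  · apply Wp.seq
    apply Wp.load
    apply Wp.seq
    refine (wp_search_pair (v := v) (w := w false) false (h.toEnv.update (by decide) (by decide))
      (by simp [h4]) (by simp [h9, hl0])).imp ?_
    rintro σ₁ ⟨hr₁, hm₁, ho₁, hc₁⟩
    dsimp only at hr₁ hm₁
    have hE₁ : Env n ζ σ₁ := h.toEnv.congr fun r hr => by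
      rw [hr₁ r (by omega) (by omega), Function.update_of_ne (by omega)]
    have h1₁ : σ₁.reg 1 = 0 := hE₁.reg_one
    have h4₁ : σ₁.reg 4 = v := by simp [hr₁, h4]
    apply Wp.ifLT
    · intro hlt
      rw [h1₁, hc₁] at hlt
      obtain ⟨hv, hi'⟩ := hfound _ hlt
      simp only [if_neg hi', hv]
      apply Wp.seq
      apply Wp.const
      apply Wp.seq
      apply Wp.store
      apply Wp.copy
      refine ⟨fun r hr => ?_, ?_, ?_, ?_⟩
      · simp only [scanRegs, Finset.mem_insert, Finset.mem_singleton, not_or] at hr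
        simp [hr₁, hr]
      · simp [h4₁, hm₁]
      · simp
      · simp
    · intro hlt0
      rw [h1₁, hc₁] at hlt0
      apply Wp.seq
      apply Wp.load
      apply Wp.seq
      refine (wp_search_pair (v := v) (w := w true) true (hE₁.update (by decide) (by decide))
        (by simp [h4₁]) (by simp [hr₁, hm₁, h10, hl1])).imp ?_
      rintro σ₂ ⟨hr₂, hm₂, ho₂, hc₂⟩
      dsimp only at hr₂ hm₂
      have h1₂ : σ₂.reg 1 = 0 := by simp [hr₂, h1₁]
      have h4₂ : σ₂.reg 4 = v := by simp [hr₂, h4₁]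
      apply Wp.ifLT
      · intro hlt
        rw [h1₂, hc₂] at hlt
        obtain ⟨hv, hi'⟩ := hfound _ hlt
        simp only [if_neg hi', hv]
        apply Wp.seq
        apply Wp.const
        apply Wp.seq
        apply Wp.store
        apply Wp.copy
        refine ⟨fun r hr => ?_, ?_, ?_, ?_⟩
        · simp only [scanRegs, Finset.mem_insert, Finset.mem_singleton, not_or] at hr
          simp [hr₁, hr₂, hr]
        · simp [h4₂, hm₁, hm₂]
        · simp
        · simp
      · intro hlt1
        rw [h1₂, hc₂] at hlt1
        have hi' : i < H.missCount (gadOf t ζ) col v := by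
          by_contra hcon
          have := heq (by omega)
          cases hv : col v
          · exact hlt1 ((this true).2 hv)
          · exact hlt0 ((this false).2 hv)
        simp only [if_pos hi']
        apply Wp.seq
        apply Wp.inc
        apply Wp.inc
        refine ⟨fun r hr => ?_, ?_, ?_, ?_, ?_⟩
        · simp only [scanRegs, Finset.mem_insert, Finset.mem_singleton, not_or] at hr
          simp [hr₁, hr₂, hr]
        · simp [hm₁, hm₂]
        · simp [hr₁, hr₂, h9, add_assoc]
        · simp [hr₁, hr₂, h10, add_assoc]
        · simp [hr₁, hr₂]
  · omega

theorem wp_scan (hcol : H.ProperOn col) (hz : ∀ b (i : Fin t), col (gadOf t ζ b i) = b)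
    (h : SecondPass H ζ t col D F v σ) (h9 : σ.reg 9 = n) (h10 : σ.reg 10 = n + n)
    (h11 : σ.reg 11 = 0) :
    Wp H (scan j t) σ ((H.missCount (gadOf t ζ) col v + 1) * (2 * searchTime j t + 17) + 1)
      fun σ' => (∀ r ∉ scanRegs, σ'.reg r = σ.reg r) ∧
      if H.missCount (gadOf t ζ) col v < H.pairCount (gadOf t ζ) col then
        σ'.mem = Function.update σ.mem v (1 + (col v).toNat) ∧ σ'.reg 11 = 1 + (col v).toNat
      else σ'.mem = σ.mem ∧ σ'.reg 11 = 0 := by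
  set κ := H.missCount (gadOf t ζ) col v with hκ
  have hκm : κ ≤ H.pairCount (gadOf t ζ) col := missCount_le v
  have hlen := fun b => pairCount_le (H := H) (z := gadOf t ζ) (col := col) b
  have hp7 : σ.reg 7 = n + (H.decList (gadOf t ζ) col false n).length := by
    simpa using h.reg_ptr false
  have hp8 : σ.reg 8 = n + n + (H.decList (gadOf t ζ) col true n).length := by
    have := h.reg_ptr true
    simp only [Bool.toNat_true] at this
    rw [this]; ring
  -- There are `κ` iterations without a hit; the last part of the rule covers one further iteration,
  -- which finds a hit or notices that a list is exhausted.
  refine Wp.le (Wp.while_steps (T := 2 * searchTime j t + 18) (fun i σ' => (∀ r ∉ scanRegs, σ'.reg r = σ.reg r) ∧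
    σ'.mem = σ.mem ∧ σ'.reg 9 = n + i ∧ σ'.reg 10 = n + n + i ∧ σ'.reg 11 = 0) κ
    (fun _ => 2 * searchTime j t + 16) ?_ ?_ ?_) ?_
  · rintro i hi σ₁ ⟨hr, hm, h9₁, h10₁, h11₁⟩
    have h₁ := h.frame hr hm
    have hi' := hi.trans_le hκm
    have h7₁ : σ₁.reg 7 = σ.reg 7 := hr 7 (by decide)
    have h8₁ : σ₁.reg 8 = σ.reg 8 := hr 8 (by decide)
    have := hlen false
    have := hlen true
    refine ⟨by omega, Wp.ifLT_pos (by omega) ?_⟩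
    refine (wp_scanBody hcol hz h₁ h9₁ h10₁ hi' hi.le).imp ?_
    rintro σ₂ ⟨hr₂, hif⟩
    rw [if_pos hi] at hif
    obtain ⟨hm₂, h9₂, h10₂, h11₂⟩ := hif
    exact ⟨fun r hr' => (hr₂ r hr').trans (hr r hr'), hm₂.trans hm, h9₂, h10₂, h11₂.trans h11₁⟩
  · rintro σ₁ ⟨hr, hm, h9₁, h10₁, h11₁⟩
    have h₁ := h.frame hr hm
    have h7₁ : σ₁.reg 7 = σ.reg 7 := hr 7 (by decide)
    have h8₁ : σ₁.reg 8 = σ.reg 8 := hr 8 (by decide)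
    by_cases hκ' : κ < H.pairCount (gadOf t ζ) col
    · simp only [if_pos hκ']
      have := hlen false
      have := hlen true
      refine Wp.while_unfold (T₂ := 1) (by omega) (Wp.ifLT_pos (T₁ := 2 * searchTime j t + 15)
        (by omega) ?_)
      refine (wp_scanBody hcol hz h₁ h9₁ h10₁ hκ' le_rfl).imp ?_
      rintro σ₂ ⟨hr₂, hif⟩
      rw [if_neg (lt_irrefl _)] at hif
      obtain ⟨hm₂, h9₂, h11₂⟩ := hif
      exact Wp.while_done (by omega)
        ⟨fun r hr' => (hr₂ r hr').trans (hr r hr'), hm₂.trans (by rw [hm]), h11₂⟩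
    · simp only [if_neg hκ']
      have hκ'' : κ = H.pairCount (gadOf t ζ) col := by omega
      by_cases h97 : σ₁.reg 9 < σ₁.reg 7
      · have h108 : ¬σ₁.reg 10 < σ₁.reg 8 := by
          unfold pairCount at hκ''
          omega
        refine (Wp.while_unfold (T₂ := 1) h97 (Wp.ifLT_neg h108 (Wp.copy ?_))).le (by omega)
        refine Wp.while_done (by simp) ⟨fun r hr' => ?_, hm, ?_⟩
        · have : r ≠ 9 := by rintro rfl; exact hr' (by decide)
          simp [this, hr r hr']
        · simp [h11₁]
      · exact (Wp.while_done h97 ⟨hr, hm, h11₁⟩).le (by omega)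
  · exact ⟨fun _ _ => rfl, rfl, by simpa using h9, by simpa using h10, h11⟩
  · simp only [Finset.sum_const, Finset.card_range, smul_eq_mul]
    ring_nf
    omega

end RAMProg

/-! ### Extending the coloring of a gadget to all vertices -/

namespace KGraph

variable {j n t : ℕ}

open Classical in
/-- The number of useless pairs that are inspected in total. -/
noncomputable def totalMiss (H : KGraph (j + 3) n) (z : Bool → Fin t → ℕ) (col : ℕ → Bool) : ℕ :=
  ∑ v ∈ Finset.range n, if H.Undecided z col v then H.missCount z col v else 0

/-- All vertices are decided in the end. -/
def AllDecided (H : KGraph (j + 3) n) (z : Bool → Fin t → ℕ) (col : ℕ → Bool) : Prop :=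
  ∀ v < n, H.Undecided z col v → H.missCount z col v < H.pairCount z col

end KGraph

namespace RAMProg

open KGraph

section Emit

variable {k n : ℕ} {H : KGraph k n} {σ : RAMState} {ζ : ℕ → ℕ} {col : ℕ → Bool}

/-- Outputs the coloring that is stored in memory and reports success. -/
def emit : RAMProg k :=
  .seq (.instr (.const 4 0)) (.seq (.whileLT 4 0 (.seq (.instr (.load 11 4))
    (.seq (.instr (.dec 11)) (.seq (.instr (.color 4 11)) (.instr (.inc 4))))))
      (.instr (.const 3 1)))

theorem wp_emit (hE : Env n ζ σ) (hmem : ∀ u < n, σ.mem u = 1 + (col u).toNat) :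
    Wp H emit σ (n * 10 + 10) fun σ' => Env n ζ σ' ∧ σ'.reg 3 = 1 ∧
      ∀ u < n, σ'.out u = some (col u) := by
  apply Wp.le
  · apply Wp.seq
    apply Wp.const
    apply Wp.seq
    refine (Wp.while_count (T := 7) (fun v σ' => Env n ζ σ' ∧ σ'.mem = σ.mem ∧ σ'.reg 4 = v ∧
      ∀ u < v, σ'.out u = some (col u)) n ?_ ?_ ?_).imp ?_
    · rintro v hv σ' ⟨hE', hm, h4, ho⟩
      refine ⟨by rw [h4, hE'.reg_zero]; exact hv, ?_⟩
      refine Wp.seq (Wp.load (Wp.seq (Wp.dec (Wp.seq (Wp.color (Wp.inc ⟨?_, hm, ?_, ?_⟩))))))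
      · refine hE'.congr fun r hr => ?_
        dsimp only
        rw [Function.update_of_ne (by omega), Function.update_of_ne (by omega),
          Function.update_of_ne (by omega)]
      · simp [h4]
      · intro u hu
        by_cases huv : u = v
        · subst huv
          cases hc : col u <;> simp [h4, hm, hmem u hv, hc]
        · simp [h4, huv, ho u (by omega)]
    · rintro σ' ⟨hE', hm, h4, ho⟩
      rw [h4, hE'.reg_zero]
      exact lt_irrefl _
    · exact ⟨hE.update (by decide) (by decide), rfl, by simp, by simp⟩
    · rintro σ' ⟨hE', hm, h4, ho⟩
      exact Wp.const ⟨hE'.update (by decide) (by decide), by simp, ho⟩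
  · omega

end Emit

variable {j n t : ℕ} {H : KGraph (j + 3) n} {σ : RAMState} {ζ : ℕ → ℕ} {col : ℕ → Bool} {v : ℕ}
  {D : Set ℕ} {F : Prop}

theorem SecondPass.visited (h : SecondPass H ζ t col D F v σ) {σ' : RAMState}
    (hreg : ∀ r ∉ scanRegs, r ≠ 4 → σ'.reg r = σ.reg r) (h4 : σ'.reg 4 = v + 1)
    (hmem : σ'.mem = σ.mem) : SecondPass H ζ t col D F (v + 1) σ' where
  toEnv := h.toEnv.congr fun r hr => hreg r (by simp [scanRegs]; omega) (by omega)
  reg_three := by rw [hreg _ (by decide) (by decide), h.reg_three]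
  reg_four := h4
  reg_base := by rw [hreg _ (by decide) (by decide), h.reg_base]
  reg_flag := by rw [hreg _ (by decide) (by decide), h.reg_flag]
  reg_ptr b := by rw [hreg _ (by cases b <;> decide) (by cases b <;> decide), h.reg_ptr]
  mem_mark := by rw [hmem]; exact h.mem_mark
  mem_list := by rw [hmem]; exact h.mem_list

theorem SecondPass.solve (hvn : v < n) (h : SecondPass H ζ t col D F v σ) {σ' : RAMState}
    (hreg : ∀ r ∉ scanRegs, r ≠ 4 → σ'.reg r = σ.reg r) (h4 : σ'.reg 4 = v + 1)
    (hmem : σ'.mem = Function.update σ.mem v (1 + (col v).toNat)) :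
    SecondPass H ζ t col (insert v D) F (v + 1) σ' where
  toEnv := h.toEnv.congr fun r hr => hreg r (by simp [scanRegs]; omega) (by omega)
  reg_three := by rw [hreg _ (by decide) (by decide), h.reg_three]
  reg_four := h4
  reg_base := by rw [hreg _ (by decide) (by decide), h.reg_base]
  reg_flag := by rw [hreg _ (by decide) (by decide), h.reg_flag]
  reg_ptr b := by rw [hreg _ (by cases b <;> decide) (by cases b <;> decide), h.reg_ptr]
  mem_mark u hu := by
    rw [hmem]
    by_cases huv : u = v
    · simp [huv]
    · rw [Function.update_of_ne huv, h.mem_mark u hu]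
      have : u ∈ insert v D ↔ u ∈ D := by simp [huv]
      by_cases hu' : u ∈ D <;> simp [this, hu']
  mem_list b i w hi := by
    have : n ≤ n * (1 + b.toNat) := Nat.le_mul_of_pos_right n (by omega)
    rw [hmem, Function.update_of_ne (by omega), h.mem_list b i w hi]

theorem SecondPass.fail (h : SecondPass H ζ t col D F v σ) {σ' : RAMState}
    (hreg : ∀ r ∉ scanRegs, r ≠ 4 → r ≠ 17 → σ'.reg r = σ.reg r) (h4 : σ'.reg 4 = v + 1)
    (h17 : σ'.reg 17 = 0) (hmem : σ'.mem = σ.mem) : SecondPass H ζ t col D False (v + 1) σ' where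
  toEnv := h.toEnv.congr fun r hr => hreg r (by simp [scanRegs]; omega) (by omega) (by omega)
  reg_three := by rw [hreg _ (by decide) (by decide) (by decide), h.reg_three]
  reg_four := h4
  reg_base := by rw [hreg _ (by decide) (by decide) (by decide), h.reg_base]
  reg_flag := by rw [h17]; simp
  reg_ptr b := by
    rw [hreg _ (by cases b <;> decide) (by cases b <;> decide) (by cases b <;> decide), h.reg_ptr]
  mem_mark := by rw [hmem]; exact h.mem_mark
  mem_list := by rw [hmem]; exact h.mem_list

theorem wp_secondVisit_of_mem (hv : v < n) (hD : v ∈ D) (h : SecondPass H ζ t col D F v σ) :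
    Wp H (.seq (secondVisit j t) (.instr (.inc 4))) σ 20 (SecondPass H ζ t col D F (v + 1)) := by
  have h4 := h.reg_four
  refine (Wp.seq (Wp.seq (Wp.load (Wp.ifLT_pos ?_ (Wp.const (Wp.inc (h.visited ?_ ?_ ?_))))))).le
    (by omega)
  · simp [h.reg_one, h4, h.mem_mark v hv, hD]
  · intro r hr h4
    simp only [scanRegs, Finset.mem_insert, Finset.mem_singleton, not_or] at hr
    simp [hr, h4]
  · simp [h4]
  · rfl

theorem wp_secondVisit_of_not_mem (hcol : H.ProperOn col)
    (hz : ∀ b (i : Fin t), col (gadOf t ζ b i) = b) (hv : v < n) (hD : v ∉ D)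
    (h : SecondPass H ζ t col D F v σ) :
    Wp H (.seq (secondVisit j t) (.instr (.inc 4))) σ
      ((H.missCount (gadOf t ζ) col v + 1) * (2 * searchTime j t + 17) + 20) fun σ' =>
      (H.missCount (gadOf t ζ) col v < H.pairCount (gadOf t ζ) col →
        SecondPass H ζ t col (insert v D) F (v + 1) σ') ∧
      (¬H.missCount (gadOf t ζ) col v < H.pairCount (gadOf t ζ) col →
        SecondPass H ζ t col D False (v + 1) σ') := by
  have h4 := h.reg_four
  have h0 := h.reg_zero
  have h1 := h.reg_one
  have hmv := h.mem_mark v hv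
  rw [if_neg hD] at hmv
  apply Wp.le
  · apply Wp.seq
    apply Wp.seq
    apply Wp.load
    apply Wp.ifLT_neg
    · simp [h1, h4, hmv]
    · apply Wp.seq
      apply Wp.copy
      apply Wp.seq
      apply Wp.copy
      apply Wp.seq
      refine (wp_scan hcol hz (v := v) (D := D) (F := F) (h.frame (fun r hr => ?_) (by rfl)) ?_ ?_ ?_).imp ?_
      · simp only [scanRegs, Finset.mem_insert, Finset.mem_singleton, not_or] at hr
        simp [hr]
      · simp [h0]
      · simp [h.reg_base]
      · simp [h4, hmv]
      · rintro σ₁ ⟨hr₁, hif⟩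
        dsimp only at hr₁ hif
        have hr₁' : ∀ r ∉ scanRegs, σ₁.reg r = σ.reg r := fun r hr => by
          rw [hr₁ r hr]
          simp only [scanRegs, Finset.mem_insert, Finset.mem_singleton, not_or] at hr
          simp [hr]
        have h1₁ : σ₁.reg 1 = 0 := by rw [hr₁' 1 (by decide), h1]
        have h4₁ : σ₁.reg 4 = v := by rw [hr₁' 4 (by decide), h4]
        apply Wp.ifLT
        · intro hlt
          split_ifs at hif with hm
          · apply Wp.const
            apply Wp.inc
            refine ⟨fun _ => h.solve hv (fun r hr hr4 => ?_) ?_ ?_, fun h => absurd hm h⟩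
            · have hr' := hr
              simp only [scanRegs, Finset.mem_insert, Finset.mem_singleton, not_or] at hr'
              simp [hr', hr4, hr₁' r hr]
            · simp [h4₁]
            · exact hif.1
          · omega
        · intro hlt
          split_ifs at hif with hm
          · omega
          · apply Wp.const
            apply Wp.inc
            refine ⟨fun h => absurd h hm, fun _ => h.fail (fun r hr hr4 hr17 => ?_) ?_ ?_ ?_⟩
            · simp [hr4, hr17, hr₁' r hr]
            · simp [h4₁]
            · simp
            · exact hif.1
  · omega

/-- Clears the marks. -/
def clearMarks : RAMProg (j + 3) :=
  .seq (.instr (.const 4 0)) (.seq (.instr (.copy 14 0))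
    (.whileLT 4 0 (.seq (.instr (.store 4 1)) (.seq (.instr (.inc 4)) (.instr (.inc 14))))))

/-- There is no addition instruction: the loop over the `n` marks also raises register `14` from `n`
to `2 * n`. The list blocks need no clearing, since only entries below the pointers are read. -/
theorem wp_clearMarks (hE : Env n ζ σ) (h3 : σ.reg 3 = 0) :
    Wp H clearMarks σ (n * 10 + 10) fun σ' => Env n ζ σ' ∧ σ'.reg 3 = 0 ∧ σ'.reg 14 = n + n ∧
      ∀ u < n, σ'.mem u = 0 := by
  apply Wp.le
  · apply Wp.seq
    apply Wp.const
    apply Wp.seq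
    apply Wp.copy
    refine (Wp.while_count (T := 5) (fun v σ' => Env n ζ σ' ∧ σ'.reg 3 = 0 ∧ σ'.reg 4 = v ∧
      σ'.reg 14 = n + v ∧ ∀ u < v, σ'.mem u = 0) n ?_ ?_ ?_).imp ?_
    · rintro v hv σ' ⟨hE', h3', h4, h14, hm⟩
      refine ⟨by rw [h4, hE'.reg_zero]; exact hv, ?_⟩
      refine Wp.seq (Wp.store (Wp.seq (Wp.inc (Wp.inc ⟨?_, by simp [h3'], ?_, ?_, ?_⟩))))
      · refine hE'.congr fun r hr => ?_
        dsimp only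
        rw [Function.update_of_ne (by omega), Function.update_of_ne (by omega)]
      · simp [h4]
      · simp [h14, add_assoc]
      · intro u hu
        by_cases huv : u = v
        · simp [huv, h4, hE'.reg_one]
        · simp [h4, huv, hm u (by omega)]
    · rintro σ' ⟨hE', h3', h4, h14, hm⟩
      rw [h4, hE'.reg_zero]
      exact lt_irrefl _
    · refine ⟨hE.congr fun r hr => ?_, by simp [h3], by simp, by simp [hE.reg_zero], by simp⟩
      dsimp only
      rw [Function.update_of_ne (by omega), Function.update_of_ne (by omega)]
    · rintro σ' ⟨hE', h3', h4, h14, hm⟩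
      exact ⟨hE', h3', h14, hm⟩
  · omega

/-- Marks the listed vertices of the gadget. -/
def markList : List (Bool × Fin t) → RAMProg (j + 3)
  | [] => .instr (.const 6 0)
  | p :: l => .seq (markList l) (.seq (.instr (.const 11 (1 + p.1.toNat)))
      (.instr (.store (gadReg p.1 p.2) 11)))

open Classical in
theorem wp_markList (hz : ∀ b (i : Fin t), col (gadOf t ζ b i) = b) (l : List (Bool × Fin t))
    (hE : Env n ζ σ) (h3 : σ.reg 3 = 0) (h14 : σ.reg 14 = n + n) (hm : ∀ u < n, σ.mem u = 0) :
    Wp H (markList l) σ (l.length * 5 + 1) fun σ' => Env n ζ σ' ∧ σ'.reg 3 = 0 ∧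
      σ'.reg 14 = n + n ∧ ∀ u < n, σ'.mem u =
        if ∃ p ∈ l, gadOf t ζ p.1 p.2 = u then 1 + (col u).toNat else 0 := by
  induction l with
  | nil => exact Wp.const ⟨hE.update (by decide) (by decide), by simp [h3], by simp [h14], by simpa⟩
  | cons p l ih =>
    refine (Wp.seq (T₂ := 3) (ih.imp ?_)).le (by simp; omega)
    rintro σ' ⟨hE', h3', h14', hm'⟩
    have hne : gadReg p.1 p.2 ≠ 11 := by have := le_gadReg p.1 p.2; omega
    have hg : σ'.reg (gadReg p.1 p.2) = gadOf t ζ p.1 p.2 := hE'.reg_high _ (le_gadReg _ _)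
    refine Wp.seq (Wp.const (Wp.store ⟨hE'.update (by decide) (by decide), by simp [h3'],
      by simp [h14'], fun u hu => ?_⟩))
    by_cases hu' : u = gadOf t ζ p.1 p.2
    · subst hu'
      simp [hne, hg, hz]
    · have : ¬gadOf t ζ p.1 p.2 = u := fun h => hu' h.symm
      simp [hne, hg, hu', hm' u hu, this]

/-- Visits every vertex once more with the program `P`. -/
def forVertices (P : RAMProg (j + 3)) : RAMProg (j + 3) :=
  .whileLT 4 0 (.seq P (.instr (.inc 4)))

/-- Extends the coloring of the gadget to all vertices, if possible. -/
noncomputable def extend (j t : ℕ) : RAMProg (j + 3) :=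
  .seq clearMarks (.seq (markList (Finset.univ : Finset (Bool × Fin t)).toList)
    (.seq (.instr (.const 4 0)) (.seq (.instr (.copy 7 0)) (.seq (.instr (.copy 8 14))
      (.seq (forVertices (firstVisit j t)) (.seq (.instr (.const 4 0))
        (.seq (.instr (.const 17 1)) (.seq (forVertices (secondVisit j t))
          (.ifLT 1 17 emit (.instr (.const 6 0)))))))))))

/-- A bound for the running time of `extend` per vertex and per useless pair. -/
noncomputable def extendConst (j t : ℕ) : ℕ := 4 * searchTime j t + 10 * t + 100

/-- Each visit has a constant cost, and an undecided vertex adds its `missCount`; these add up to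
`totalMiss`. -/
theorem wp_secondPass (hcol : H.ProperOn col) (hz : ∀ b (i : Fin t), col (gadOf t ζ b i) = b)
    (h : SecondPass H ζ t col {u | InGadget (gadOf t ζ) u ∨ H.Decided (gadOf t ζ) col u} True 0 σ) :
    Wp H (forVertices (secondVisit j t)) σ
      (n * (2 * searchTime j t + 38) +
        H.totalMiss (gadOf t ζ) col * (2 * searchTime j t + 17) + 1) fun σ' =>
      ∃ D, (H.AllDecided (gadOf t ζ) col → ∀ u < n, u ∈ D) ∧
        SecondPass H ζ t col D (H.AllDecided (gadOf t ζ) col) n σ' := by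
  classical
  set ok : ℕ → Prop := fun v => H.missCount (gadOf t ζ) col v < H.pairCount (gadOf t ζ) col
  set S : Set ℕ := {u | InGadget (gadOf t ζ) u ∨ H.Decided (gadOf t ζ) col u}
  have hS : ∀ v, v ∉ S ↔ H.Undecided (gadOf t ζ) col v := fun v => by
    simp only [S, Set.mem_ofPred_eq, Decided, Undecided]
    tauto
  -- The marked set before visit `v` consists of `S` and the earlier undecided vertices whose scan
  -- succeeded; the flag records whether all of these scans did.
  refine Wp.le (Wp.while_steps (T := 1) (fun v σ' => SecondPass H ζ t col
    (S ∪ {u | u < v ∧ H.Undecided (gadOf t ζ) col u ∧ ok u})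
    (∀ u < v, H.Undecided (gadOf t ζ) col u → ok u) v σ') n
    (fun v => 2 * searchTime j t + 37 + (if H.Undecided (gadOf t ζ) col v then H.missCount (gadOf t ζ) col v else 0) *
      (2 * searchTime j t + 17)) ?_ ?_ ?_) ?_
  · intro v hv σ₁ h₁
    refine ⟨by rw [h₁.reg_four, h₁.reg_zero]; exact hv, ?_⟩
    by_cases hvS : v ∈ S
    · have hu : ¬H.Undecided (gadOf t ζ) col v := by rw [← hS]; simpa using hvS
      refine (wp_secondVisit_of_mem hv (Or.inl hvS) h₁).mono (by omega) fun σ₂ h₂ => ?_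
      convert h₂ using 1
      · congr 1
        ext u
        simp only [Set.mem_ofPred_eq]
        refine and_congr_left fun h => ?_
        have : u ≠ v := by rintro rfl; exact hu h.1
        omega
      · refine Iff.intro (fun h u hu' => h u (by omega)) ?_
        intro h u hu' h'
        have : u ≠ v := by rintro rfl; exact hu h'
        exact h u (by omega) h'
    · have hu := (hS v).1 hvS
      rw [if_pos hu]
      refine (wp_secondVisit_of_not_mem hcol hz hv ?_ h₁).mono ?_ ?_
      · simp [hvS]
      · rw [add_one_mul]; omega
      · rintro σ₂ ⟨hok, hnok⟩
        by_cases hv' : ok v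
        · convert hok hv' using 1
          · ext u
            simp only [Set.mem_union, Set.mem_ofPred_eq, Set.mem_insert_iff, Nat.lt_succ_iff_lt_or_eq]
            constructor
            · rintro (h | ⟨h | h, h'⟩)
              · tauto
              · tauto
              · tauto
            · rintro (h | h | h)
              · subst h; tauto
              · tauto
              · tauto
          · refine Iff.intro (fun h u hu' => h u (by omega)) ?_
            intro h u hu' h'
            rcases Nat.lt_succ_iff_lt_or_eq.1 hu' with h'' | rfl
            · exact h u h'' h'
            · exact hv'
        · convert hnok hv' using 1
          · congr 1
            ext u
            simp only [Set.mem_ofPred_eq]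
            refine and_congr_left fun h => ?_
            have : u ≠ v := by rintro rfl; exact hv' h.2
            omega
          · exact iff_false_intro fun h => hv' (h v (Nat.lt_succ_self v) hu)
  · intro σ₁ h₁
    refine Wp.while_done (by rw [h₁.reg_four, h₁.reg_zero]; exact lt_irrefl _) ⟨_, ?_, h₁⟩
    intro hall u hu
    by_cases huS : u ∈ S
    · exact Or.inl huS
    · exact Or.inr ⟨hu, (hS u).1 huS, hall u hu ((hS u).1 huS)⟩
  · simpa using h
  · rw [Finset.sum_congr rfl fun v _ => Nat.add_right_comm _ _ 1, Finset.sum_add_distrib,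
      ← Finset.sum_mul, totalMiss]
    simp
    
/-- The program does not know `col`: it colors the groups by their labels and infers the rest. Any
proper coloring that agrees with the labels describes the run. -/
theorem wp_extend (hcol : H.ProperOn col) (hz : ∀ b (i : Fin t), col (gadOf t ζ b i) = b)
    (hE : Env n ζ σ) (h3 : σ.reg 3 = 0) :
    Wp H (extend j t) σ (extendConst j t * (n + H.totalMiss (gadOf t ζ) col + 1)) fun σ' =>
      Env n ζ σ' ∧ (H.AllDecided (gadOf t ζ) col →
        σ'.reg 3 = 1 ∧ ∀ u < n, σ'.out u = some (col u)) ∧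
      (¬H.AllDecided (gadOf t ζ) col → σ'.reg 3 = 0) := by
  classical
  apply Wp.le
  · apply Wp.seq
    refine (wp_clearMarks hE h3).imp ?_
    rintro σ₁ ⟨hE₁, h3₁, h14₁, hm₁⟩
    apply Wp.seq
    refine (wp_markList hz _ hE₁ h3₁ h14₁ hm₁).imp ?_
    rintro σ₂ ⟨hE₂, h3₂, h14₂, hm₂⟩
    apply Wp.seq
    apply Wp.const
    apply Wp.seq
    apply Wp.copy
    apply Wp.seq
    apply Wp.copy
    apply Wp.seq
    refine (Wp.while_count (T := 2 * searchTime j t + 20) (FirstPass H ζ t col) n ?_ ?_ ?_).imp ?_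
    · intro v hv σ' h
      exact ⟨by rw [h.reg_four, h.reg_zero]; exact hv, wp_firstVisit hcol hz hv h⟩
    · intro σ' h
      rw [h.reg_four, h.reg_zero]
      exact lt_irrefl _
    · refine ⟨hE₂.congr fun r hr => ?_, by simp [h3₂], by simp, by simp [h14₂], fun b => ?_,
        fun u hu => ?_, fun b i w hi => ?_⟩
      · dsimp only
        rw [Function.update_of_ne (by omega), Function.update_of_ne (by omega),
          Function.update_of_ne (by omega)]
      · cases b
        · simp [decList, hE₂.reg_zero]
        · simp [decList, h14₂]; ring
      · simp only [hm₂ u hu, InGadget]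
        congr 1
        simp
      · simp [decList] at hi
    · intro σ₃ h₃
      apply Wp.seq
      apply Wp.const
      apply Wp.seq
      apply Wp.const
      apply Wp.seq
      refine (wp_secondPass hcol hz ⟨h₃.toEnv.congr fun r hr => ?_, by simp [h₃.reg_three], by simp,
        by simp [h₃.reg_base], by simp, fun b => ?_, fun u hu => ?_, ?_⟩).imp ?_
      · dsimp only
        rw [Function.update_of_ne (by omega), Function.update_of_ne (by omega)]
      · have : 7 + b.toNat ≠ 17 ∧ 7 + b.toNat ≠ 4 := by cases b <;> decide
        simp [this, h₃.reg_ptr b]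
      · refine (h₃.mem_mark u hu).trans ?_
        simp only [hu, true_and, Set.mem_ofPred_eq]
        by_cases hu' : InGadget (gadOf t ζ) u ∨ H.Decided (gadOf t ζ) col u <;> simp [hu']
      · exact h₃.mem_list
      · rintro σ₄ ⟨D, hD, h₄⟩
        have h17 := h₄.reg_flag
        have h1 := h₄.reg_one
        apply Wp.ifLT
        · intro hlt
          have hall : H.AllDecided (gadOf t ζ) col := by
            by_contra hcon
            rw [if_neg hcon] at h17
            omega
          refine (wp_emit (col := col) h₄.toEnv fun u hu => ?_).imp ?_
          · rw [h₄.mem_mark u hu, if_pos (hD hall u hu)]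
          · rintro σ₅ ⟨hE₅, h3₅, ho₅⟩
            exact ⟨hE₅, fun _ => ⟨h3₅, ho₅⟩, fun h => absurd hall h⟩
        · intro hlt
          have hall : ¬H.AllDecided (gadOf t ζ) col := by
            intro hcon
            rw [if_pos hcon] at h17
            omega
          exact Wp.const ⟨h₄.toEnv.update (by decide) (by decide), fun h => absurd h hall,
            fun _ => by simp [h₄.reg_three]⟩
  · simp only [Finset.length_toList, Finset.card_univ, Fintype.card_prod, Fintype.card_bool,
      Fintype.card_fin, extendConst]
    rw [max_eq_left (by omega)]
    nlinarith

end RAMProg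

/-! ### Every gadget has exactly two candidate colorings -/

namespace KGraph

variable {j n t : ℕ} {H : KGraph (j + 3) n} {col : ℕ → Bool}

theorem ProperOn.not (h : H.ProperOn col) : H.ProperOn fun v => !col v := by
  intro q hq
  obtain ⟨a, b, hab⟩ := h q hq
  exact ⟨a, b, by simpa using hab⟩

theorem totalMiss_le (z : Bool → Fin t → ℕ) : H.totalMiss z col ≤ n * n := by
  classical
  refine (Finset.sum_le_card_nsmul _ _ n fun v _ => ?_).trans (by simp)
  split_ifs
  · exact (missCount_le v).trans ((pairCount_le true).trans (length_decList_le _ _ _ _ _))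
  · exact Nat.zero_le n

/-- A gadget contains all pairs of indices in one of its edges. -/
theorem exists_gadget_query (ht : j + 3 ≤ t) (p q : Bool × Fin t) :
    ∃ f : Fin (j + 3) → Bool × Fin t, Function.Injective f ∧ (∃ a b, (f a).1 ≠ (f b).1) ∧
      (∃ a, f a = p) ∧ ∃ a, f a = q := by
  classical
  -- A third index from the group opposite to `p` ensures that the set meets both groups.
  obtain ⟨r, hr⟩ : ∃ r : Bool × Fin t, ∃ s ∈ ({p, q, r} : Finset (Bool × Fin t)), s.1 ≠ r.1 :=
    ⟨(!p.1, p.2), p, by simp, by simp⟩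
  obtain ⟨s, hs, hsr⟩ := hr
  obtain ⟨B, hB, hcard⟩ : ∃ B : Finset (Bool × Fin t), {p, q, r} ⊆ B ∧ B.card = j + 3 := by
    obtain ⟨B, h1, -, h2⟩ := Finset.exists_subsuperset_card_eq (Finset.subset_univ {p, q, r})
      (n := j + 3) (Finset.card_le_three.trans (by omega)) (by simp; omega)
    exact ⟨B, h1, h2⟩
  let e := B.equivFinOfCardEq hcard
  have hmem : ∀ x ∈ B, ∃ a, ((e.symm a : B) : Bool × Fin t) = x := fun x hx => ⟨e ⟨x, hx⟩, by simp⟩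
  refine ⟨fun a => (e.symm a : B), fun a b h => e.symm.injective (Subtype.ext h), ?_,
    hmem p (hB (by simp)), hmem q (hB (by simp))⟩
  obtain ⟨a, ha⟩ := hmem s (hB hs)
  obtain ⟨b, hb⟩ := hmem r (hB (by simp))
  exact ⟨a, b, by dsimp only; rw [ha, hb]; exact hsr⟩

theorem IsEdge.lt {k : ℕ} {H : KGraph k n} {q : Fin k → ℕ} (h : H.IsEdge q) (a : Fin k) :
    q a < n := by
  obtain ⟨e, -, he⟩ := h
  have : q a ∈ e.map Fin.valEmbedding := by rw [he]; simp
  obtain ⟨x, -, hx⟩ := Finset.mem_map.1 this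
  rw [← hx]
  exact x.2

theorem IsEdge.injective {k : ℕ} {H : KGraph k n} {q : Fin k → ℕ} (h : H.IsEdge q) :
    Function.Injective q := by
  obtain ⟨e, heH, he⟩ := h
  have hc : (Finset.univ.image q).card = (Finset.univ : Finset (Fin k)).card := by
    rw [← he, Finset.card_map, H.2 e heH, Finset.card_univ, Fintype.card_fin]
  simpa using Finset.card_image_iff.1 hc

/-- One color occurs on at least `t` of the `2 * t` vertices. If its class met both groups, then `j
+ 3 ≤ t` of its vertices, including one of each group, would form a monochromatic edge. So the class
lies in one group and, by its size, is that group. -/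
theorem IsGadget.color {z : Bool → Fin t → ℕ} (ht : j + 3 ≤ t) (hz : H.IsGadget z)
    (hcol : H.ProperOn col) :
    (∀ b i, col (z b i) = b) ∨ ∀ b i, (!col (z b i)) = b := by
  classical
  set g : Bool × Fin t → Bool := fun p => col (z p.1 p.2) with hg
  -- a color class with at least `t` vertices is not mixed
  have key : ∀ b, t ≤ (Finset.univ.filter fun p => g p = b).card →
      ∀ p q, g p = b → g q = b → p.1 = q.1 := by
    intro b hb p q hp hq
    by_contra hpq
    obtain ⟨B, h1, h2, h3⟩ := Finset.exists_subsuperset_card_eq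
      (s := {p, q}) (t := Finset.univ.filter fun p => g p = b) (n := j + 3)
      (by intro x; simp only [Finset.mem_insert, Finset.mem_singleton]; rintro (rfl | rfl) <;> simpa)
      (Finset.card_le_two.trans (by omega)) (by omega)
    let e := B.equivFinOfCardEq h3
    have hedge := hz (fun a => (e.symm a : B))
      (fun a b h => e.symm.injective (Subtype.ext h))
      ⟨e ⟨p, h1 (by simp)⟩, e ⟨q, h1 (by simp)⟩, by simpa using hpq⟩
    obtain ⟨a, a', ha⟩ := hcol _ hedge
    have hcolB : ∀ x ∈ B, g x = b := fun x hx => (Finset.mem_filter.1 (h2 hx)).2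
    exact ha ((hcolB _ (e.symm a).2).trans (hcolB _ (e.symm a').2).symm)
  have hsum : (Finset.univ.filter fun p => g p = true).card +
      (Finset.univ.filter fun p => g p = false).card = 2 * t := by
    have := Finset.card_filter_add_card_filter_not (s := (Finset.univ : Finset (Bool × Fin t)))
      (fun p => g p = true)
    simpa using this
  -- one of the color classes contains exactly one group
  obtain ⟨b, hb⟩ : ∃ b, t ≤ (Finset.univ.filter fun p => g p = b).card := by
    by_contra hcon
    push Not at hcon
    have := hcon true
    have := hcon false
    omega
  have hne : (Finset.univ.filter fun p => g p = b).Nonempty := Finset.card_pos.1 (by omega)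
  obtain ⟨p, hp⟩ := hne
  simp only [Finset.mem_filter, Finset.mem_univ, true_and] at hp
  have hsub : (Finset.univ.filter fun q => g q = b) ⊆
      Finset.univ.filter fun q : Bool × Fin t => q.1 = p.1 := by
    intro q hq
    simp only [Finset.mem_filter, Finset.mem_univ, true_and] at hq ⊢
    exact key b hb q p hq hp
  have hcard : (Finset.univ.filter fun q : Bool × Fin t => q.1 = p.1).card = t := by
    have : (Finset.univ.filter fun q : Bool × Fin t => q.1 = p.1) =
        Finset.univ.image fun i => (p.1, i) := by
      ext ⟨x, y⟩
      simp [eq_comm]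
    rw [this, Finset.card_image_of_injective _ (Prod.mk_right_injective _)]
    simp
  have heq := Finset.eq_of_subset_of_card_le hsub (by omega)
  have hiff : ∀ q : Bool × Fin t, g q = b ↔ q.1 = p.1 := fun q => by
    simpa using Finset.ext_iff.1 heq q
  by_cases hbp : p.1 = b
  · left
    intro c i
    have := hiff (c, i)
    simp only [hg] at this
    rw [hbp] at this
    generalize col (z c i) = x at this ⊢
    clear * - this
    cases b <;> cases c <;> cases x <;> simp at this ⊢
  · right
    intro c i
    have := hiff (c, i)
    simp only [hg] at this
    generalize p.1 = y at this hbp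
    generalize col (z c i) = x at this ⊢
    clear * - this hbp
    cases b <;> cases c <;> cases y <;> cases x <;> simp at this hbp ⊢

end KGraph

/-! ### Loops over all tuples of vertices, and the exhaustive search -/

namespace RAMProg

section Nest

variable {k n : ℕ} {H : KGraph k n}

/-- Runs `P` for all contents of the registers `20, …, 20 + d - 1` that are vertices. -/
def nest (P : RAMProg k) : ℕ → RAMProg k
  | 0 => P
  | d + 1 => .seq (.instr (.const (20 + d) 0))
      (.whileLT (20 + d) 0 (.seq (nest P d) (.instr (.inc (20 + d)))))

/-- `I` is an invariant of all runs of `P`, and `D ξ` means that the register contents `ξ` have been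
treated. As `P` preserves `D` for every `ξ`, all tuples of vertices are treated in the end. The `-
3` in the time bound absorbs the overhead of each loop in the induction on `d`. -/
theorem wp_nest {P : RAMProg k} {T : ℕ} (I : RAMState → Prop) (D : (ℕ → ℕ) → RAMState → Prop)
    (hI : ∀ (σ : RAMState) r m, 20 ≤ r → I σ → I { σ with reg := Function.update σ.reg r m })
    (hD : ∀ ξ (σ : RAMState) r m, 20 ≤ r → D ξ σ → D ξ { σ with reg := Function.update σ.reg r m })
    (hP : ∀ ζ σ, Env n ζ σ → I σ → Wp H P σ T fun σ' =>
      Env n ζ σ' ∧ I σ' ∧ D ζ σ' ∧ ∀ ξ, D ξ σ → D ξ σ')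
    (d : ℕ) {ζ : ℕ → ℕ} {σ : RAMState} (hE : Env n ζ σ) (hσ : I σ) :
    Wp H (nest P d) σ ((T + 3) * (n + 3) ^ d - 3) fun σ' =>
      ∃ ζ', Env n ζ' σ' ∧ (∀ r, r < 20 ∨ 20 + d ≤ r → ζ' r = ζ r) ∧ I σ' ∧
        (∀ ξ, (∀ i < d, ξ (20 + i) < n) → (∀ r, r < 20 ∨ 20 + d ≤ r → ξ r = ζ r) → D ξ σ') ∧
        ∀ ξ, D ξ σ → D ξ σ' := by
  induction d generalizing ζ σ with
  | zero =>
    refine (hP ζ σ hE hσ).mono (by simp) ?_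
    rintro σ' ⟨hE', hσ', hd, hst⟩
    refine ⟨ζ, hE', fun _ _ => rfl, hσ', fun ξ _ hξ => ?_, hst⟩
    rwa [funext fun r => hξ r (by omega)]
  | succ d ih =>
    refine Wp.le (Wp.seq (Wp.const ?_)) (T := 1 + (n * ((T + 3) * (n + 3) ^ d - 3 + 1 + 1 + 1) + 1) + 1) ?_
    · refine (Wp.while_count (fun v σ' => ∃ ζ', Env n ζ' σ' ∧ ζ' (20 + d) = v ∧
        (∀ r, r < 20 ∨ 20 + (d + 1) ≤ r → ζ' r = ζ r) ∧ I σ' ∧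
        (∀ ξ, (∀ i < d, ξ (20 + i) < n) → ξ (20 + d) < v →
          (∀ r, r < 20 ∨ 20 + (d + 1) ≤ r → ξ r = ζ r) → D ξ σ') ∧
        ∀ ξ, D ξ σ → D ξ σ') n ?_ ?_ ?_).imp ?_
      · rintro v hv σ₁ ⟨ζ₁, hE₁, hv₁, hζ₁, hI₁, hD₁, hst₁⟩
        have hr₁ : σ₁.reg (20 + d) = v := by rw [hE₁.reg_high _ (by omega), hv₁]
        refine ⟨by rw [hr₁, hE₁.reg_zero]; exact hv, Wp.seq ((ih hE₁ hI₁).imp ?_)⟩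
        rintro σ₂ ⟨ζ₂, hE₂, hζ₂, hI₂, hD₂, hst₂⟩
        have hv₂ : ζ₂ (20 + d) = v := by rw [hζ₂ _ (by omega), hv₁]
        refine Wp.inc ⟨Function.update ζ₂ (20 + d) (v + 1), ⟨?_, ?_, ?_, fun r hr => ?_⟩,
          by simp, fun r hr => ?_, hI _ _ _ (by omega) hI₂, fun ξ h1 h2 h3 => ?_, fun ξ hξ => ?_⟩
        · dsimp only
          rw [Function.update_of_ne (by omega), hE₂.reg_zero]
        · dsimp only
          rw [Function.update_of_ne (by omega), hE₂.reg_one]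
        · dsimp only
          rw [Function.update_of_ne (by omega), hE₂.reg_two]
        · by_cases hrd : r = 20 + d
          · subst hrd
            simp [hE₂.reg_high, hv₂]
          · simp [hrd, hE₂.reg_high r hr]
        · rw [Function.update_of_ne (by omega), hζ₂ r (by omega), hζ₁ r (by omega)]
        · apply hD _ _ _ _ (by omega)
          by_cases hlt : ξ (20 + d) < v
          · exact hst₂ _ (hD₁ ξ h1 hlt h3)
          · refine hD₂ ξ h1 fun r hr => ?_
            by_cases hrd : r = 20 + d
            · subst hrd
              omega
            · rw [h3 r (by omega), hζ₁ r (by omega)]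
        · exact hD _ _ _ _ (by omega) (hst₂ _ (hst₁ _ hξ))
      · rintro σ₁ ⟨ζ₁, hE₁, hv₁, -⟩
        rw [hE₁.reg_high _ (by omega), hv₁, hE₁.reg_zero]
        exact lt_irrefl _
      · refine ⟨Function.update ζ (20 + d) 0, ⟨?_, ?_, ?_, fun r hr => ?_⟩, by simp, fun r hr => ?_,
          hI _ _ _ (by omega) hσ, fun ξ _ h => absurd h (by omega),
          fun ξ hξ => hD _ _ _ _ (by omega) hξ⟩
        · dsimp only
          rw [Function.update_of_ne (by omega), hE.reg_zero]
        · dsimp only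
          rw [Function.update_of_ne (by omega), hE.reg_one]
        · dsimp only
          rw [Function.update_of_ne (by omega), hE.reg_two]
        · by_cases hrd : r = 20 + d
          · subst hrd
            simp
          · simp [hrd, hE.reg_high r hr]
        · rw [Function.update_of_ne (by omega)]
      · rintro σ₁ ⟨ζ₁, hE₁, hv₁, hζ₁, hI₁, hD₁, hst₁⟩
        exact ⟨ζ₁, hE₁, hζ₁, hI₁, fun ξ h1 h2 => hD₁ ξ (fun i hi => h1 i (by omega))
          (h1 d (by omega)) h2, hst₁⟩
    · have : 1 ≤ (n + 3) ^ d := Nat.one_le_pow _ _ (by omega)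
      have h2 : 3 * 1 ≤ (T + 3) * (n + 3) ^ d := Nat.mul_le_mul (by omega) this
      rw [pow_succ, ← mul_assoc]
      generalize (T + 3) * (n + 3) ^ d = X at h2
      rw [show X - 3 + 1 + 1 + 1 = X by omega, show X * (n + 3) = n * X + 3 * X by ring]
      omega

end Nest

section Brute

variable {k n : ℕ} {H : KGraph k n} {σ : RAMState} {ζ : ℕ → ℕ}

/-- Sets register `15` to `1` if one of the listed vertices differs in color from the first one. -/
def compareColors : List ℕ → RAMProg k
  | [] => .instr (.const 15 0)
  | i :: l => .seq (compareColors l) (.seq (.instr (.load 5 (20 + i))) (.seq (.instr (.load 11 20))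
      (.ifLT 5 11 (.instr (.const 15 1)) (.ifLT 11 5 (.instr (.const 15 1)) (.instr (.const 6 0))))))

theorem wp_compareColors (l : List ℕ) (hE : Env n ζ σ) :
    Wp H (compareColors l) σ (l.length * 9 + 1) fun σ' => Env n ζ σ' ∧ σ'.mem = σ.mem ∧
      σ'.reg 3 = σ.reg 3 ∧ σ'.reg 13 = σ.reg 13 ∧
      (0 < σ'.reg 15 ↔ ∃ i ∈ l, σ.mem (ζ (20 + i)) ≠ σ.mem (ζ 20)) := by
  induction l with
  | nil => exact Wp.const ⟨hE.update (by decide) (by decide), rfl, by simp, by simp, by simp⟩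
  | cons i l ih =>
    apply Wp.le
    · apply Wp.seq
      refine ih.imp ?_
      rintro σ₁ ⟨hE₁, hm₁, h3₁, h13₁, h15₁⟩
      have hi : σ₁.reg (20 + i) = ζ (20 + i) := hE₁.reg_high _ (by omega)
      have h0 : σ₁.reg 20 = ζ 20 := hE₁.reg_high _ (by omega)
      apply Wp.seq
      apply Wp.load
      apply Wp.seq
      apply Wp.load
      have hE₂ : ∀ r m, 3 ≤ r → r < 20 → ∀ a b, Env n ζ ⟨Function.update
          (Function.update (Function.update σ₁.reg 5 a) 11 b) r m, σ₁.mem, σ₁.out⟩ :=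
        fun r m hr hr' a b => hE₁.congr fun s hs => by
          dsimp only
          rw [Function.update_of_ne (by omega), Function.update_of_ne (by omega),
            Function.update_of_ne (by omega)]
      apply Wp.ifLT
      · intro hlt
        refine Wp.const ⟨hE₂ _ _ (by decide) (by decide) _ _, hm₁, by simp [h3₁], by simp [h13₁], ?_⟩
        simp [hm₁, hi, h0] at hlt
        simp [hlt.ne]
      · intro hlt
        apply Wp.ifLT
        · intro hlt'
          refine Wp.const ⟨hE₂ _ _ (by decide) (by decide) _ _, hm₁, by simp [h3₁], by simp [h13₁], ?_⟩
          simp [hm₁, hi, h0] at hlt'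
          simp [hlt'.ne']
        · intro hlt'
          refine Wp.const ⟨hE₂ _ _ (by decide) (by decide) _ _, hm₁, by simp [h3₁], by simp [h13₁], ?_⟩
          simp [hm₁, hi, h0] at hlt hlt'
          simp [h15₁, le_antisymm hlt' hlt]
    · simp only [List.length_cons]
      omega

/-- Sets register `13` to `1` if the vertices in the registers `20, …` form an edge with only one
color. -/
def checkEdge (k : ℕ) : RAMProg k :=
  .seq (.instr (.query 6 fun i => 20 + i)) (.ifLT 1 6 (.seq (compareColors (List.range k))
    (.ifLT 1 15 (.instr (.const 6 0)) (.instr (.const 13 1)))) (.instr (.const 6 0)))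

/-- The vertices `ζ 20, …, ζ (20 + k - 1)` form an edge with only one color. -/
def BadEdge (H : KGraph k n) (μ ζ : ℕ → ℕ) : Prop :=
  H.IsEdge (fun i => ζ (20 + i)) ∧ ∀ i < k, μ (ζ (20 + i)) = μ (ζ 20)

theorem wp_checkEdge (hE : Env n ζ σ) :
    Wp H (checkEdge k) σ (k * 9 + 20) fun σ' => Env n ζ σ' ∧ σ'.mem = σ.mem ∧
      σ'.reg 3 = σ.reg 3 ∧ (σ'.reg 13 = 1 ∧ BadEdge H σ.mem ζ ∨
        σ'.reg 13 = σ.reg 13 ∧ ¬BadEdge H σ.mem ζ) := by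
  have he : (fun i : Fin k => σ.reg (20 + i)) = fun i : Fin k => ζ (20 + i) :=
    funext fun i => hE.reg_high _ (by omega)
  have h1 := hE.reg_one
  apply Wp.le
  · apply Wp.seq
    apply Wp.query
    rw [he]
    by_cases hq : H.IsEdge fun i => ζ (20 + i)
    · apply Wp.ifLT_pos
      · simp [h1, hq]
      · apply Wp.le (T' := k * 9 + 10)
        · apply Wp.seq
          refine (wp_compareColors _ (hE.update (by decide) (by decide))).imp ?_
          rintro σ₁ ⟨hE₁, hm₁, h3₁, h13₁, h15₁⟩
          have h1₁ := hE₁.reg_one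
          apply Wp.ifLT
          · intro hlt
            rw [h1₁, h15₁] at hlt
            refine Wp.const ⟨hE₁.update (by decide) (by decide), hm₁, by simp [h3₁], Or.inr ⟨?_, ?_⟩⟩
            · simp [h13₁]
            · rintro ⟨-, hbad⟩
              obtain ⟨i, hi, hne⟩ := hlt
              exact hne (hbad i (List.mem_range.1 hi))
          · intro hlt
            rw [h1₁, h15₁] at hlt
            refine Wp.const ⟨hE₁.update (by decide) (by decide), hm₁, by simp [h3₁], Or.inl ⟨?_, hq, ?_⟩⟩
            · simp
            · intro i hi
              by_contra hne
              exact hlt ⟨i, List.mem_range.2 hi, hne⟩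
        · simp only [List.length_range]
          omega
    · apply Wp.ifLT_neg
      · simp [h1, hq]
      · apply Wp.le (T' := k * 9 + 10)
        · refine Wp.const ⟨hE.congr fun r hr => ?_, rfl, by simp, Or.inr ⟨by simp, fun h => hq h.1⟩⟩
          dsimp only
          rw [Function.update_of_ne (by omega), Function.update_of_ne (by omega)]
        · omega
  · omega

/-- Sets register `13` to `1` if the coloring in memory has an edge with only one color, and to `0`
otherwise. -/
def checkColoring (k : ℕ) : RAMProg k :=
  .seq (.instr (.const 13 0)) (nest (checkEdge k) k)

theorem wp_checkColoring (hE : Env n ζ σ) (h3 : σ.reg 3 = 0) :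
    Wp H (checkColoring k) σ ((k * 9 + 25) * (n + 3) ^ k) fun σ' => (∃ ζ', Env n ζ' σ') ∧
      σ'.mem = σ.mem ∧ σ'.reg 3 = 0 ∧ (0 < σ'.reg 13 ↔ ∃ ζ, BadEdge H σ.mem ζ) := by
  have hpow : 1 ≤ (n + 3) ^ k := Nat.one_le_pow _ _ (by omega)
  refine Wp.le (Wp.seq (Wp.const ?_)) (T := 1 + ((k * 9 + 20 + 3) * (n + 3) ^ k - 3) + 1) ?_
  swap
  · have : (k * 9 + 25) * (n + 3) ^ k = (k * 9 + 20 + 3) * (n + 3) ^ k + 2 * (n + 3) ^ k := by ring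
    omega
  refine (wp_nest (fun σ' => σ'.mem = σ.mem ∧ σ'.reg 3 = 0 ∧
    (σ'.reg 13 = 0 ∨ σ'.reg 13 = 1 ∧ ∃ ζ, BadEdge H σ.mem ζ))
    (fun ξ σ' => BadEdge H σ.mem ξ → σ'.reg 13 = 1) ?_ ?_ ?_ k
    (hE.update (by decide) (by decide)) ?_).imp ?_
  · rintro σ' r m hr ⟨h1, h2, h3⟩
    refine ⟨h1, ?_, ?_⟩
    · dsimp only
      rwa [Function.update_of_ne (by omega)]
    · dsimp only
      rwa [Function.update_of_ne (by omega)]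
  · intro ξ σ' r m hr h hb
    dsimp only
    rw [Function.update_of_ne (by omega), h hb]
  · rintro ζ' σ' hE' ⟨h1, h2, h3⟩
    refine (wp_checkEdge hE').imp ?_
    rintro σ'' ⟨hE'', hm, h3'', hor⟩
    rw [h1] at hm hor
    refine ⟨hE'', ⟨hm, h3''.trans h2, ?_⟩, ?_, fun ξ hξ hb => ?_⟩
    · rcases hor with ⟨h, hb⟩ | ⟨h, hb⟩
      · exact Or.inr ⟨h, _, hb⟩
      · rwa [h]
    · rcases hor with ⟨h, hb⟩ | ⟨h, hb⟩
      · exact fun _ => h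
      · exact fun h => absurd h hb
    · rcases hor with ⟨h, -⟩ | ⟨h, -⟩
      · exact h
      · rw [h, hξ hb]
  · exact ⟨rfl, by simp [h3], by simp⟩
  · rintro σ' ⟨ζ', hE', -, ⟨hm, h3', h13⟩, hD, -⟩
    refine ⟨⟨ζ', hE'⟩, hm, h3', fun h => ?_, ?_⟩
    · rcases h13 with h13 | h13
      · omega
      · exact h13.2
    · rintro ⟨ξ, hξ⟩
      -- Only the registers `20, …, 20 + k - 1` matter for `BadEdge`, so a bad `ξ` may be changed
      -- elsewhere to agree with `ζ`, as the loops require.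
      have : BadEdge H σ.mem (fun r => if r < 20 ∨ 20 + k ≤ r then ζ r else ξ r) := by
        obtain ⟨h1, h2⟩ := hξ
        have h : ∀ i < k, ¬(20 + i < 20 ∨ 20 + k ≤ 20 + i) := fun i hi => by omega
        refine ⟨?_, fun i hi => ?_⟩
        · convert h1 using 2 with i
          exact if_neg (h i i.2)
        · dsimp only
          rw [if_neg (h i hi), if_neg (h 0 (by omega))]
          exact h2 i hi
      rw [hD _ (fun i hi => ?_) (fun r hr => if_pos hr) this]
      · exact Nat.one_pos
      · exact this.1.lt ⟨i, hi⟩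

end Brute

end RAMProg

/-- Adding `1` flips the lowest bits of a number. -/
theorem Nat.exists_testBit_succ (i : ℕ) :
    ∃ p, i.testBit p = false ∧ (∀ v < p, i.testBit v = true) ∧ (i + 1).testBit p = true ∧
      (∀ v < p, (i + 1).testBit v = false) ∧ ∀ v, p < v → (i + 1).testBit v = i.testBit v := by
  induction i using Nat.strong_induction_on with
  | _ i ih =>
    rcases Nat.even_or_odd' i with ⟨m, rfl | rfl⟩
    · refine ⟨0, by simp, by simp, by simp, by simp, fun v hv => ?_⟩
      obtain ⟨v, rfl⟩ := Nat.exists_eq_succ_of_ne_zero hv.ne'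
      rw [Nat.testBit_succ, Nat.testBit_succ]
      congr 1
      omega
    · obtain ⟨p, h1, h2, h3, h4, h5⟩ := ih m (by omega)
      have hd : (2 * m + 1) / 2 = m := by omega
      have hd' : (2 * m + 1 + 1) / 2 = m + 1 := by omega
      refine ⟨p + 1, ?_, fun v hv => ?_, ?_, fun v hv => ?_, fun v hv => ?_⟩
      · rw [Nat.testBit_succ, hd, h1]
      · cases v with
        | zero => simp
        | succ v => rw [Nat.testBit_succ, hd, h2 v (by omega)]
      · rw [Nat.testBit_succ, hd', h3]
      · cases v with
        | zero => simp [Nat.testBit_zero]; omega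
        | succ v => rw [Nat.testBit_succ, hd', h4 v (by omega)]
      · cases v with
        | zero => omega
        | succ v => rw [Nat.testBit_succ, Nat.testBit_succ, hd, hd', h5 v (by omega)]

namespace RAMProg

open KGraph

variable {j n : ℕ} {H : KGraph (j + 3) n} {σ : RAMState} {ζ : ℕ → ℕ}

/-- Advances to the next coloring in memory. -/
def nextColoring : RAMProg (j + 3) :=
  .seq (.instr (.const 4 0)) (.seq (.instr (.load 5 4)) (.seq
    (.whileLT 2 5 (.seq (.instr (.store 4 2)) (.seq (.instr (.inc 4)) (.instr (.load 5 4)))))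
    (.seq (.instr (.const 5 2)) (.instr (.store 4 5)))))

/-- The marks form a binary counter with digits `1` and `2`: the `2`s at the low end become `1`, and
the first `1` becomes `2`. The carry stops before cell `n` because `i + 1 < 2 ^ n`. -/
theorem wp_nextColoring {i : ℕ} (hi : i + 1 < 2 ^ n) (hE : Env n ζ σ) (h3 : σ.reg 3 = 0)
    (hm : ∀ v < n, σ.mem v = 1 + (i.testBit v).toNat) :
    Wp H nextColoring σ (n * 10 + 20) fun σ' => Env n ζ σ' ∧ σ'.reg 3 = 0 ∧
      ∀ v < n, σ'.mem v = 1 + ((i + 1).testBit v).toNat := by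
  obtain ⟨p, h1, h2, h1', h2', h3'⟩ := i.exists_testBit_succ
  have hp : p < n := by
    by_contra hpn
    have := Nat.testBit_lt_two_pow (x := i + 1) (i := p)
      (hi.trans_le (Nat.pow_le_pow_right (by omega) (by omega)))
    rw [h1'] at this
    cases this
  apply Wp.le
  · apply Wp.seq
    apply Wp.const
    apply Wp.seq
    apply Wp.load
    apply Wp.seq
    refine (Wp.while_count (T := 5) (fun v σ' => Env n ζ σ' ∧ σ'.reg 3 = 0 ∧ σ'.reg 4 = v ∧
      σ'.reg 5 = 1 + (i.testBit v).toNat ∧ (∀ u < v, σ'.mem u = 1) ∧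
      ∀ u, v ≤ u → u < n → σ'.mem u = 1 + (i.testBit u).toNat) p ?_ ?_ ?_).imp ?_
    · rintro v hv σ₁ ⟨hE₁, h3₁, h4₁, h5₁, hlow, hhigh⟩
      refine ⟨by rw [hE₁.reg_two, h5₁, h2 v hv]; decide, ?_⟩
      refine Wp.seq (Wp.store (Wp.seq (Wp.inc (Wp.load ⟨?_, by simp [h3₁], by simp [h4₁],
        ?_, ?_, ?_⟩))))
      · refine hE₁.congr fun r hr => ?_
        dsimp only
        rw [Function.update_of_ne (by omega), Function.update_of_ne (by omega)]
      · simp [h4₁, hhigh (v + 1) (by omega) (by omega)]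
      · intro u hu
        by_cases huv : u = v
        · simp [huv, h4₁, hE₁.reg_two]
        · simp [huv, h4₁, hlow u (by omega)]
      · intro u hu hun
        have : u ≠ v := by omega
        simp [this, h4₁, hhigh u (by omega) hun]
    · rintro σ₁ ⟨hE₁, h3₁, h4₁, h5₁, hlow, hhigh⟩
      rw [hE₁.reg_two, h5₁, h1]
      decide
    · refine ⟨hE.congr fun r hr => ?_, by simp [h3], by simp, ?_, by simp, fun u _ hu => hm u hu⟩
      · dsimp only
        rw [Function.update_of_ne (by omega), Function.update_of_ne (by omega)]
      · simpa using hm 0 (by omega)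
    · rintro σ₁ ⟨hE₁, h3₁, h4₁, h5₁, hlow, hhigh⟩
      apply Wp.seq
      apply Wp.const
      refine Wp.store ⟨hE₁.update (by decide) (by decide), by simp [h3₁], fun v hv => ?_⟩
      rcases lt_trichotomy v p with hvp | rfl | hvp
      · simp [h4₁, hvp.ne, hlow v hvp, h2' v hvp]
      · simp [h4₁, h1']
      · simp [h4₁, hvp.ne', hhigh v hvp.le hv, h3' v hvp]
  · have : p * 6 ≤ n * 6 := Nat.mul_le_mul_right _ hp.le
    omega

/-- The output is a coloring of `H`. -/
def Solved (H : KGraph (j + 3) n) (σ : RAMState) : Prop :=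
  ∃ col, H.ProperOn col ∧ ∀ u < n, σ.out u = some (col u)

/-- Writes the first coloring into memory. -/
def firstColoring : RAMProg (j + 3) :=
  .seq (.instr (.const 4 0)) (.whileLT 4 0 (.seq (.instr (.store 4 2)) (.instr (.inc 4))))

/-- Tries all colorings. -/
def bruteForce (j : ℕ) : RAMProg (j + 3) :=
  .seq firstColoring (.whileLT 3 2 (.seq (checkColoring (j + 3)) (.ifLT 1 13 nextColoring emit)))

theorem wp_firstColoring (hE : Env n ζ σ) (h3 : σ.reg 3 = 0) :
    Wp H firstColoring σ (n * 10 + 10) fun σ' => Env n ζ σ' ∧ σ'.reg 3 = 0 ∧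
      ∀ v < n, σ'.mem v = 1 := by
  apply Wp.le
  · apply Wp.seq
    apply Wp.const
    refine (Wp.while_count (T := 3) (fun v σ' => Env n ζ σ' ∧ σ'.reg 3 = 0 ∧ σ'.reg 4 = v ∧
      ∀ u < v, σ'.mem u = 1) n ?_ ?_ ?_).imp ?_
    · rintro v hv σ₁ ⟨hE₁, h3₁, h4₁, hm⟩
      refine ⟨by rw [h4₁, hE₁.reg_zero]; exact hv, ?_⟩
      refine Wp.seq (Wp.store (Wp.inc ⟨hE₁.update (by decide) (by decide), by simp [h3₁],
        by simp [h4₁], fun u hu => ?_⟩))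
      by_cases huv : u = v
      · simp [huv, h4₁, hE₁.reg_two]
      · simp [huv, h4₁, hm u (by omega)]
    · rintro σ₁ ⟨hE₁, h3₁, h4₁, hm⟩
      rw [h4₁, hE₁.reg_zero]
      exact lt_irrefl _
    · exact ⟨hE.update (by decide) (by decide), by simp [h3], by simp, by simp⟩
    · rintro σ₁ ⟨hE₁, h3₁, h4₁, hm⟩
      exact ⟨hE₁, h3₁, hm⟩
  · omega

theorem _root_.KGraph.ProperOn.congr {col col' : ℕ → Bool} (h : H.ProperOn col)
    (hc : ∀ v < n, col v = col' v) : H.ProperOn col' := by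
  intro q hq
  obtain ⟨a, b, hab⟩ := h q hq
  exact ⟨a, b, by rwa [← hc _ (hq.lt a), ← hc _ (hq.lt b)]⟩

theorem badEdge_iff {μ : ℕ → ℕ} {col : ℕ → Bool} (hm : ∀ v < n, μ v = 1 + (col v).toNat) :
    (∃ ζ, BadEdge H μ ζ) ↔ ¬H.ProperOn col := by
  have hinj : ∀ u < n, ∀ v < n, μ u = μ v ↔ col u = col v := fun u hu v hv => by
    rw [hm u hu, hm v hv]
    cases col u <;> cases col v <;> simp
  constructor
  · rintro ⟨ζ, hq, hb⟩ hcol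
    obtain ⟨a, b, hab⟩ := hcol _ hq
    exact hab ((hinj _ (hq.lt a) _ (hq.lt b)).1 ((hb a a.2).trans (hb b b.2).symm))
  · intro h
    simp only [ProperOn, not_forall, not_exists, not_not] at h
    obtain ⟨q, hq, h⟩ := h
    have hζ : ∀ i (hi : i < j + 3), (fun r => if h : r - 20 < j + 3 then q ⟨r - 20, h⟩ else 0) (20 + i) =
        q ⟨i, hi⟩ := fun i hi => by simp [hi]
    refine ⟨fun r => if h : r - 20 < j + 3 then q ⟨r - 20, h⟩ else 0, ?_, fun i hi => ?_⟩
    · convert hq using 2 with i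
      exact hζ i i.2
    · rw [hζ i hi]
      refine Eq.trans ?_ (congrArg μ (hζ 0 (by omega)).symm)
      exact (hinj _ (hq.lt _) _ (hq.lt _)).2 (h _ _)

theorem exists_testBit_eq (n : ℕ) (col : ℕ → Bool) :
    ∃ i < 2 ^ n, ∀ v < n, i.testBit v = col v := by
  induction n with
  | zero => exact ⟨0, by simp, by simp⟩
  | succ n ih =>
    obtain ⟨i, hi, hv⟩ := ih
    refine ⟨2 ^ n * (col n).toNat + i, ?_, fun v hvn => ?_⟩
    · rw [pow_succ]
      cases col n <;> simp <;> omega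
    · rw [Nat.testBit_two_pow_mul_add _ hi]
      split_ifs with h
      · exact hv v h
      · obtain rfl : v = n := by omega
        cases col v <;> simp

theorem wp_bruteForce {col : ℕ → Bool} (hcol : H.ProperOn col) (hE : Env n ζ σ)
    (h3 : σ.reg 3 = 0) :
    Wp H (bruteForce j) σ (2 ^ n * (n + 3) ^ (j + 3) * (9 * j + 150)) fun σ' =>
      Solved H σ' := by
  classical
  have hex : ∃ i : ℕ, H.ProperOn i.testBit := by
    obtain ⟨i, -, hi⟩ := exists_testBit_eq n col
    exact ⟨i, hcol.congr fun v hv => (hi v hv).symm⟩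
  -- The search ends at the least number whose bits form a coloring. Every coloring is encoded by
  -- some number below `2 ^ n`, so there are at most `2 ^ n` rounds.
  set m := Nat.find hex with hmdef
  have hm : H.ProperOn m.testBit := Nat.find_spec hex
  have hlt : ∀ i < m, ¬H.ProperOn i.testBit := fun i hi => Nat.find_min hex hi
  have hm2 : m < 2 ^ n := by
    obtain ⟨i, hi, hi'⟩ := exists_testBit_eq n col
    exact (Nat.find_min' hex (hcol.congr fun v hv => (hi' v hv).symm)).trans_lt hi
  set X := (n + 3) ^ (j + 3) with hX
  have hXn : n + 3 ≤ X := by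
    rw [hX, pow_succ]
    exact Nat.le_mul_of_pos_left _ (by positivity)
  set c := ((j + 3) * 9 + 25) * X with hc
  refine Wp.le (T := n * 10 + 10 + (∑ i ∈ Finset.range m, (c + n * 10 + 22 + 1) +
    (c + n * 10 + 20)) + 1) ?_ ?_
  · refine Wp.seq ((wp_firstColoring hE h3).imp ?_)
    rintro σ₀ ⟨hE₀, h3₀, hm₀⟩
    refine Wp.while_steps (fun i σ' => (∃ ζ', Env n ζ' σ') ∧ σ'.reg 3 = 0 ∧
      ∀ v < n, σ'.mem v = 1 + (i.testBit v).toNat) m (fun _ => c + n * 10 + 22) ?_ ?_ ?_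
    · rintro i hi σ₁ ⟨⟨ζ₁, hE₁⟩, h3₁, hm₁⟩
      refine ⟨by rw [h3₁, hE₁.reg_two]; decide, ?_⟩
      refine Wp.le (Wp.seq (T₁ := c) (T₂ := n * 10 + 21) ((wp_checkColoring hE₁ h3₁).imp ?_)) (by omega)
      rintro σ₂ ⟨⟨ζ₂, hE₂⟩, hm₂, h3₂, h13₂⟩
      rw [badEdge_iff hm₁] at h13₂
      refine Wp.ifLT_pos (by rw [hE₂.reg_one, h13₂]; exact hlt i hi) ?_
      refine (wp_nextColoring (i := i) (by omega) hE₂ h3₂ (by rwa [hm₂])).imp ?_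
      rintro σ₃ ⟨hE₃, h3₃, hm₃⟩
      exact ⟨⟨ζ₂, hE₃⟩, h3₃, hm₃⟩
    · rintro σ₁ ⟨⟨ζ₁, hE₁⟩, h3₁, hm₁⟩
      refine Wp.le (Wp.while_unfold (T₁ := c + (n * 10 + 10 + 1) + 1) (T₂ := 1)
        (by rw [h3₁, hE₁.reg_two]; decide) (Wp.seq ((wp_checkColoring hE₁ h3₁).imp ?_))) (by omega)
      rintro σ₂ ⟨⟨ζ₂, hE₂⟩, hm₂, h3₂, h13₂⟩
      rw [badEdge_iff hm₁] at h13₂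
      refine Wp.ifLT_neg (by rw [hE₂.reg_one, h13₂]; exact fun h => h hm) ?_
      refine (wp_emit (col := m.testBit) hE₂ (by rwa [hm₂])).imp ?_
      rintro σ₃ ⟨hE₃, h3₃, ho⟩
      exact Wp.while_done (by rw [h3₃, hE₃.reg_two]; decide) ⟨_, hm, ho⟩
    · exact ⟨⟨ζ, hE₀⟩, h3₀, by simpa using hm₀⟩
  · rw [Finset.sum_const, Finset.card_range, smul_eq_mul]
    have h1 : c + n * 10 + 22 + 1 ≤ (9 * j + 85) * X := by
      rw [hc]
      nlinarith
    have h2 : m * (c + n * 10 + 22 + 1) + (c + n * 10 + 23) ≤ 2 ^ n * ((9 * j + 85) * X) := by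
      calc _ = (m + 1) * (c + n * 10 + 22 + 1) := by ring
        _ ≤ _ := Nat.mul_le_mul hm2 h1
    have h3 : n * 10 + 10 ≤ 2 ^ n * (10 * X) :=
      le_trans (by omega) (Nat.le_mul_of_pos_left _ (by positivity))
    have h4 : 2 ^ n * X * (9 * j + 150) = 2 ^ n * ((9 * j + 85) * X) + 2 ^ n * (10 * X) +
      2 ^ n * X * 55 := by ring
    omega

end RAMProg

/-! ### Hypergraphs on which gadgets work well -/

namespace KGraph

variable {j n t : ℕ} {H : KGraph (j + 3) n}

/-- The extension of a coloring of the vertices to all natural numbers. -/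
def extendColoring (c : Fin n → Bool) (v : ℕ) : Bool := if h : v < n then c ⟨v, h⟩ else false

@[simp]
theorem extendColoring_val (c : Fin n → Bool) (v : Fin n) : extendColoring c v = c v := by
  simp [extendColoring]

theorem isTwoColoring_iff_properOn {c : Fin n → Bool} :
    H.IsTwoColoring c ↔ H.ProperOn (extendColoring c) := by
  constructor
  · rintro h q ⟨e, he, heq⟩
    have hmem : ∀ x ∈ e, ∃ a, q a = x := fun x hx => by
      have : (x : ℕ) ∈ Finset.univ.image q := by rw [← heq]; exact Finset.mem_map_of_mem _ hx
      simpa using this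
    obtain ⟨u, hu, v, hv, huv⟩ := h e he
    obtain ⟨a, ha⟩ := hmem u hu
    obtain ⟨b, hb⟩ := hmem v hv
    exact ⟨a, b, by rwa [ha, hb, extendColoring_val, extendColoring_val]⟩
  · intro h e he
    let f := e.equivFinOfCardEq (H.2 e he)
    obtain ⟨a, b, hab⟩ := h (fun a => (f.symm a : Fin n)) ⟨e, he, by
      ext x
      simp only [Finset.mem_map, Finset.mem_image, Finset.mem_univ, true_and]
      constructor
      · rintro ⟨y, hy, rfl⟩
        exact ⟨f ⟨y, hy⟩, by simp⟩
      · rintro ⟨a, rfl⟩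
        exact ⟨f.symm a, (f.symm a).2, rfl⟩⟩
    exact ⟨_, (f.symm a).2, _, (f.symm b).2, by simpa using hab⟩

/-- All gadgets that are compatible with `c` decide all vertices quickly. -/
def NiceFor (H : KGraph (j + 3) n) (t : ℕ) (c : Fin n → Bool) : Prop :=
  ∀ z : Bool → Fin t → ℕ, H.IsGadget z → (∀ b i, extendColoring c (z b i) = b) →
    H.AllDecided z (extendColoring c) ∧ H.totalMiss z (extendColoring c) ≤ n

/-- All gadgets decide all vertices quickly. -/
def Nice (H : KGraph (j + 3) n) (t : ℕ) : Prop :=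
  ∀ c : Fin n → Bool, H.IsTwoColoring c → H.NiceFor t c

theorem IsGadget.lt {z : Bool → Fin t → ℕ} (ht : j + 3 ≤ t) (hz : H.IsGadget z) (b : Bool)
    (i : Fin t) : z b i < n := by
  obtain ⟨f, hf, hf', ⟨a, ha⟩, -⟩ := exists_gadget_query ht (b, i) (b, i)
  have := (hz f hf hf').lt a
  rwa [ha] at this

/-- The candidate that consists of `2 * t` consecutive vertices. -/
def consec (t b : ℕ) (c : Bool) (i : Fin t) : ℕ := b + 2 * i + c.toNat

end KGraph

/-! ### Trying candidates for a gadget -/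

namespace RAMProg

open KGraph

variable {j n t : ℕ} {H : KGraph (j + 3) n} {σ : RAMState} {ζ : ℕ → ℕ}

/-- If no coloring has been output, then extend the coloring of the gadget in the registers. -/
noncomputable def tryGadget (j t : ℕ) : RAMProg (j + 3) :=
  .ifLT 1 3 (.instr (.const 6 0)) (.seq (search false (gadQueries j t))
    (.ifLT 1 12 (.instr (.const 6 0)) (extend j t)))

/-- Either nothing has been output, or a coloring. -/
def Progress (H : KGraph (j + 3) n) (σ : RAMState) : Prop :=
  σ.reg 3 = 0 ∨ σ.reg 3 = 1 ∧ Solved H σ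

theorem wp_tryGadget_done (hE : Env n ζ σ) (h3 : σ.reg 3 = 1) (hs : Solved H σ) :
    Wp H (tryGadget j t) σ 2 fun σ' => Env n ζ σ' ∧ σ'.reg 3 = 1 ∧ Solved H σ' :=
  Wp.ifLT_pos (by rw [h3, hE.reg_one]; decide)
    (Wp.const ⟨hE.update (by decide) (by decide), by simp [h3], hs⟩)

theorem wp_tryGadget_miss (hE : Env n ζ σ) (h3 : σ.reg 3 = 0) (hz : ¬H.IsGadget (gadOf t ζ)) :
    Wp H (tryGadget j t) σ (searchTime j t + 4) fun σ' => Env n ζ σ' ∧ σ'.reg 3 = 0 := by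
  refine Wp.ifLT_neg (T₁ := searchTime j t + 3) (by rw [h3, hE.reg_one]; decide)
    (Wp.seq (T₂ := 2) ((wp_search_gad hE).imp ?_))
  rintro σ₁ ⟨hr, hm, ho, hc⟩
  have hE₁ : Env n ζ σ₁ := hE.congr fun r hr' => hr r (by omega) (by omega)
  refine Wp.ifLT_pos (by rw [hE₁.reg_one]; exact hc.2 hz)
    (Wp.const ⟨hE₁.update (by decide) (by decide), ?_⟩)
  simp [hr, h3]

/-- A coloring that agrees with the labels exists: any coloring or its complement does, by
`IsGadget.color`. The bound `M` is `n` on nice hypergraphs and `n * n` always. -/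
theorem wp_tryGadget_gadget (ht : j + 3 ≤ t) (hH : ∃ col, H.ProperOn col) {M : ℕ}
    (hM : ∀ c : Fin n → Bool, H.IsTwoColoring c →
      (∀ b (i : Fin t), extendColoring c (gadOf t ζ b i) = b) →
      H.totalMiss (gadOf t ζ) (extendColoring c) ≤ M) (hE : Env n ζ σ) (h3 : σ.reg 3 = 0)
    (hz : H.IsGadget (gadOf t ζ)) :
    Wp H (tryGadget j t) σ (searchTime j t + 4 + extendConst j t * (n + M + 1)) fun σ' =>
      Env n ζ σ' ∧ (σ'.reg 3 = 0 ∧ ¬H.Nice t ∨ σ'.reg 3 = 1 ∧ Solved H σ') := by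
  obtain ⟨c, hc, hzc⟩ : ∃ c : Fin n → Bool, H.IsTwoColoring c ∧
      ∀ b (i : Fin t), extendColoring c (gadOf t ζ b i) = b := by
    obtain ⟨col, hcol, h⟩ : ∃ col, H.ProperOn col ∧ ∀ b (i : Fin t), col (gadOf t ζ b i) = b := by
      obtain ⟨col, hcol⟩ := hH
      rcases hz.color ht hcol with h | h
      · exact ⟨col, hcol, h⟩
      · exact ⟨_, hcol.not, h⟩
    have hcc : ∀ v < n, extendColoring (fun v : Fin n => col v) v = col v := fun v hv => by
      simp [extendColoring, hv]
    exact ⟨fun v => col v, isTwoColoring_iff_properOn.2 (hcol.congr fun v hv => (hcc v hv).symm),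
      fun b i => by rw [hcc _ (hz.lt ht b i), h]⟩
  have hcol := isTwoColoring_iff_properOn.1 hc
  refine Wp.le (Wp.ifLT_neg (by rw [h3, hE.reg_one]; decide)
    (Wp.seq (T₂ := extendConst j t * (n + M + 1) + 1) ((wp_search_gad hE).imp ?_))) (by omega)
  rintro σ₁ ⟨hr, hm, ho, hs⟩
  have hE₁ : Env n ζ σ₁ := hE.congr fun r hr' => hr r (by omega) (by omega)
  refine Wp.ifLT_neg (by rw [hE₁.reg_one, hs]; exact fun h => h hz) ?_
  refine (wp_extend hcol hzc hE₁ (by rw [hr _ (by decide) (by decide), h3])).mono ?_ ?_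
  · have := hM c hc hzc
    exact Nat.mul_le_mul_left _ (by omega)
  · rintro σ₂ ⟨hE₂, h1, h2⟩
    refine ⟨hE₂, ?_⟩
    by_cases hall : H.AllDecided (gadOf t ζ) (extendColoring c)
    · exact Or.inr ⟨(h1 hall).1, _, hcol, (h1 hall).2⟩
    · exact Or.inl ⟨h2 hall, fun h => hall (h c hc _ hz hzc).1⟩

/-- A bound for the running time of `tryGadget`. -/
noncomputable def tryTime (j t M : ℕ) : ℕ := searchTime j t + 4 + extendConst j t * M

theorem wp_tryGadget (ht : j + 3 ≤ t) (hH : ∃ col, H.ProperOn col) (hE : Env n ζ σ)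
    (hσ : Progress H σ) :
    Wp H (tryGadget j t) σ (tryTime j t (n + n * n + 1)) fun σ' =>
      Env n ζ σ' ∧ Progress H σ' ∧ (H.Nice t → σ'.reg 3 = 1 ∨ ¬H.IsGadget (gadOf t ζ)) ∧
        (σ.reg 3 = 1 → σ'.reg 3 = 1) := by
  rcases hσ with h3 | ⟨h3, hs⟩
  · by_cases hz : H.IsGadget (gadOf t ζ)
    · refine (wp_tryGadget_gadget ht hH (fun _ _ _ => totalMiss_le _) hE h3 hz).imp ?_
      rintro σ' ⟨hE', ⟨h1, h2⟩ | ⟨h1, h2⟩⟩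
      · exact ⟨hE', Or.inl h1, fun h => absurd h h2, fun h => absurd h (by omega)⟩
      · exact ⟨hE', Or.inr ⟨h1, h2⟩, fun _ => Or.inl h1, fun _ => h1⟩
    · refine (wp_tryGadget_miss hE h3 hz).mono (by unfold tryTime; omega) ?_
      rintro σ' ⟨hE', h3'⟩
      exact ⟨hE', Or.inl h3', fun _ => Or.inr hz, fun h => absurd h (by omega)⟩
  · refine (wp_tryGadget_done hE h3 hs).mono (by unfold tryTime; omega) ?_
    rintro σ' ⟨hE', h3', hs'⟩
    exact ⟨hE', Or.inr ⟨h3', hs'⟩, fun _ => Or.inl h3', fun _ => h3'⟩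

/-- Writes the first `m` vertices into the registers `20, …`. -/
def firstBlock : ℕ → RAMProg (j + 3)
  | 0 => .instr (.const 6 0)
  | m + 1 => .seq (firstBlock m) (.instr (.const (20 + m) m))

/-- Increments `m` registers. -/
def nextBlock : ℕ → RAMProg (j + 3)
  | 0 => .instr (.const 6 0)
  | m + 1 => .seq (nextBlock m) (.instr (.inc (20 + m)))

theorem Env.update_high (hE : Env n ζ σ) {r m : ℕ} (hr : 20 ≤ r) :
    Env n (Function.update ζ r m) ⟨Function.update σ.reg r m, σ.mem, σ.out⟩ where
  reg_zero := by simp only; rw [Function.update_of_ne (by omega), hE.reg_zero]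
  reg_one := by simp only; rw [Function.update_of_ne (by omega), hE.reg_one]
  reg_two := by simp only; rw [Function.update_of_ne (by omega), hE.reg_two]
  reg_high s hs := by
    by_cases hsr : s = r
    · simp [hsr]
    · simp [hsr, hE.reg_high s hs]

theorem wp_firstBlock (hE : Env n ζ σ) (m : ℕ) :
    Wp H (firstBlock m) σ (m * 2 + 1) fun σ' => (∃ ζ', Env n ζ' σ' ∧ ∀ i < m, ζ' (20 + i) = i) ∧
      σ'.reg 3 = σ.reg 3 ∧ σ'.out = σ.out := by
  induction m with
  | zero =>
    exact Wp.const ⟨⟨ζ, hE.update (by decide) (by decide), fun i hi => absurd hi (by omega)⟩,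
      by simp, rfl⟩
  | succ m ih =>
    refine Wp.le (Wp.seq (T₂ := 1) (ih.imp ?_)) (by omega)
    rintro σ' ⟨⟨ζ', hE', hζ'⟩, h3, ho⟩
    refine Wp.const ⟨⟨_, hE'.update_high (by omega), fun i hi => ?_⟩, ?_, ho⟩
    · by_cases him : i = m
      · simp [him]
      · rw [Function.update_of_ne (by omega), hζ' i (by omega)]
    · simp only
      rw [Function.update_of_ne (by omega), h3]

theorem wp_nextBlock (hE : Env n ζ σ) (m : ℕ) :
    Wp H (nextBlock m) σ (m * 2 + 1) fun σ' => (∃ ζ', Env n ζ' σ' ∧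
      (∀ i < m, ζ' (20 + i) = ζ (20 + i) + 1) ∧ ∀ i, m ≤ i → ζ' (20 + i) = ζ (20 + i)) ∧
      σ'.reg 3 = σ.reg 3 ∧ σ'.out = σ.out := by
  induction m with
  | zero =>
    exact Wp.const ⟨⟨ζ, hE.update (by decide) (by decide), fun i hi => absurd hi (by omega),
      fun _ _ => rfl⟩, by simp, rfl⟩
  | succ m ih =>
    refine Wp.le (Wp.seq (T₂ := 1) (ih.imp ?_)) (by omega)
    rintro σ' ⟨⟨ζ', hE', hζ', hζ''⟩, h3, ho⟩
    refine Wp.inc ⟨⟨_, hE'.update_high (by omega), fun i hi => ?_, fun i hi => ?_⟩, ?_, ho⟩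
    · by_cases him : i = m
      · simp [him, hE'.reg_high, hζ'']
      · rw [Function.update_of_ne (by omega), hζ' i (by omega)]
    · rw [Function.update_of_ne (by omega), hζ'' i (by omega)]
    · simp only
      rw [Function.update_of_ne (by omega), h3]

/-- Tries all candidates that consist of consecutive vertices. -/
noncomputable def tryBlocks (j t : ℕ) : RAMProg (j + 3) :=
  .seq (firstBlock (2 * t)) (.whileLT (20 + (2 * t - 1)) 0
    (.seq (tryGadget j t) (nextBlock (2 * t))))

/-- The registers contain the block of vertices that starts with `b`. -/
def AtBlock (n t b : ℕ) (σ : RAMState) : Prop :=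
  ∃ ζ, Env n ζ σ ∧ ∀ i < 2 * t, ζ (20 + i) = b + i

theorem gadOf_eq_consec {b : ℕ} (h : ∀ i < 2 * t, ζ (20 + i) = b + i) :
    gadOf t ζ = consec t b := by
  funext c i
  unfold gadOf gadReg consec
  rw [Nat.add_assoc, h _ (by have := i.2; cases c <;> simp only [Bool.toNat_false, Bool.toNat_true] <;> omega)]
  omega

theorem AtBlock.lt_iff (ht : 0 < t) {b : ℕ} (h : AtBlock n t b σ) :
    σ.reg (20 + (2 * t - 1)) < σ.reg 0 ↔ b < n - (2 * t - 1) := by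
  obtain ⟨ζ, hE, hζ⟩ := h
  rw [hE.reg_zero, hE.reg_high _ (by omega), hζ _ (by omega)]
  omega

theorem wp_blockStep {T b : ℕ} {Q : RAMState → Prop}
    (hQ : ∀ σ σ' : RAMState, σ'.reg 3 = σ.reg 3 → σ'.out = σ.out → Q σ → Q σ')
    (hζ : ∀ i < 2 * t, ζ (20 + i) = b + i)
    (h : Wp H (tryGadget j t) σ T fun σ' => Env n ζ σ' ∧ Q σ') :
    Wp H (.seq (tryGadget j t) (nextBlock (2 * t))) σ (T + 4 * t + 2) fun σ' =>
      AtBlock n t (b + 1) σ' ∧ Q σ' := by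
  refine Wp.le (Wp.seq (T₂ := 2 * t * 2 + 1) (h.imp ?_)) (by omega)
  rintro σ₁ ⟨hE₁, hQ₁⟩
  refine (wp_nextBlock hE₁ (2 * t)).imp ?_
  rintro σ₂ ⟨⟨ζ₂, hE₂, hζ₂, -⟩, h3, ho⟩
  exact ⟨⟨ζ₂, hE₂, fun i hi => by rw [hζ₂ i hi, hζ i hi]; omega⟩, hQ _ _ h3 ho hQ₁⟩

theorem Progress.congr {σ' : RAMState} (h3 : σ'.reg 3 = σ.reg 3) (ho : σ'.out = σ.out)
    (h : Progress H σ) : Progress H σ' := by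
  unfold Progress Solved at *
  rwa [h3, ho]

theorem wp_tryBlocks (ht : j + 3 ≤ t) (hH : ∃ col, H.ProperOn col) (hE : Env n ζ σ)
    (hσ : Progress H σ) :
    Wp H (tryBlocks j t) σ (4 * t + 3 + n * (tryTime j t (n + n * n + 1) + 4 * t + 3)) fun σ' =>
      (∃ ζ', Env n ζ' σ') ∧ Progress H σ' := by
  refine Wp.le (T := 2 * t * 2 + 1 +
    ((n - (2 * t - 1)) * (tryTime j t (n + n * n + 1) + 4 * t + 2 + 1) + 1) + 1) ?_ ?_
  · refine Wp.seq ((wp_firstBlock hE (2 * t)).imp ?_)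
    rintro σ₀ ⟨⟨ζ₀, hE₀, hζ₀⟩, h3, ho⟩
    refine (Wp.while_count (fun b σ' => AtBlock n t b σ' ∧ Progress H σ') _ ?_ ?_ ?_).imp ?_
    · rintro b hb σ₁ ⟨hat, hp⟩
      refine ⟨(hat.lt_iff (by omega)).2 hb, ?_⟩
      obtain ⟨ζ₁, hE₁, hζ₁⟩ := hat
      refine wp_blockStep (fun _ _ => Progress.congr) hζ₁ ((wp_tryGadget ht hH hE₁ hp).imp ?_)
      exact fun σ₂ h => ⟨h.1, h.2.1⟩
    · rintro σ₁ ⟨hat, -⟩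
      rw [hat.lt_iff (by omega)]
      exact lt_irrefl _
    · exact ⟨⟨ζ₀, hE₀, by simpa using hζ₀⟩, hσ.congr h3 ho⟩
    · rintro σ₁ ⟨⟨ζ₁, hE₁, -⟩, hp⟩
      exact ⟨⟨ζ₁, hE₁⟩, hp⟩
  · have : (n - (2 * t - 1)) * (tryTime j t (n + n * n + 1) + 4 * t + 2 + 1) ≤
        n * (tryTime j t (n + n * n + 1) + 4 * t + 3) := Nat.mul_le_mul (by omega) le_rfl
    omega

/-- Windows before the first gadget `b₀` are rejected after a bounded number of queries, and windows
after it are skipped because the success flag is set. Only `b₀` causes an extension, which is linear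
as `totalMiss` is at most `n`. -/
theorem wp_tryBlocks_of_gadget (ht : j + 3 ≤ t) (hH : ∃ col, H.ProperOn col) (hN : H.Nice t)
    (hB : ∃ b, b < n - (2 * t - 1) ∧ H.IsGadget (consec t b)) (hE : Env n ζ σ)
    (h3 : σ.reg 3 = 0) :
    Wp H (tryBlocks j t) σ (4 * t + 3 + n * (tryTime j t 0 + 4 * t + 3) +
        extendConst j t * (n + n + 1)) fun σ' =>
      (∃ ζ', Env n ζ' σ') ∧ σ'.reg 3 = 1 ∧ Solved H σ' := by
  classical
  set b₀ := Nat.find hB with hb₀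
  obtain ⟨hb₀n, hg⟩ := Nat.find_spec hB
  rw [← hb₀] at hb₀n hg
  have hmin : ∀ b < b₀, ¬H.IsGadget (consec t b) := fun b hb hg' =>
    Nat.find_min hB hb ⟨by omega, hg'⟩
  set m := n - (2 * t - 1) with hm
  set c := tryTime j t 0 + 4 * t + 2 with hc
  refine Wp.le (T := 2 * t * 2 + 1 + (∑ b ∈ Finset.range m,
    (c + (if b = b₀ then extendConst j t * (n + n + 1) else 0) + 1) + 1) + 1) ?_ ?_
  · refine Wp.seq ((wp_firstBlock hE (2 * t)).imp ?_)
    rintro σ₀ ⟨⟨ζ₀, hE₀, hζ₀⟩, h3₀, ho₀⟩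
    refine Wp.while_steps (fun b σ' => AtBlock n t b σ' ∧
      ((b ≤ b₀ ∧ σ'.reg 3 = 0) ∨ (b₀ < b ∧ σ'.reg 3 = 1 ∧ Solved H σ'))) m _ ?_ ?_ ?_
    · rintro b hb σ₁ ⟨hat, hp⟩
      refine ⟨(hat.lt_iff (by omega)).2 hb, ?_⟩
      obtain ⟨ζ₁, hE₁, hζ₁⟩ := hat
      have hz := gadOf_eq_consec hζ₁
      rcases hp with ⟨hle, h3₁⟩ | ⟨hlt, h3₁, hs₁⟩
      · rcases hle.lt_or_eq with hlt | heq
        · rw [if_neg hlt.ne]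
          refine (wp_blockStep (Q := fun σ => σ.reg 3 = 0) (fun _ _ h _ h' => h.trans h') hζ₁
            (wp_tryGadget_miss hE₁ h3₁ (by rw [hz]; exact hmin b hlt))).mono ?_ ?_
          · rw [hc, tryTime]; omega
          · exact fun σ₂ h => ⟨h.1, Or.inl ⟨hlt, h.2⟩⟩
        · rw [if_pos heq]
          refine (wp_blockStep (Q := fun σ => σ.reg 3 = 1 ∧ Solved H σ) ?_ hζ₁
            ((wp_tryGadget_gadget ht hH (M := n) ?_ hE₁ h3₁ (by rw [hz, heq]; exact hg)).imp
              ?_)).mono ?_ ?_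
          · rintro σ σ' h ho ⟨h', hs⟩
            unfold Solved at *
            exact ⟨h.trans h', by rwa [ho]⟩
          · intro c hc hzc
            exact (hN c hc _ (by rw [hz, heq]; exact hg) hzc).2
          · rintro σ₂ ⟨hE₂, ⟨-, h⟩ | h⟩
            · exact absurd hN h
            · exact ⟨hE₂, h⟩
          · rw [hc, tryTime]; omega
          · exact fun σ₂ h => ⟨h.1, Or.inr ⟨by omega, h.2⟩⟩
      · refine (wp_blockStep (Q := fun σ => σ.reg 3 = 1 ∧ Solved H σ) ?_ hζ₁
            (wp_tryGadget_done hE₁ h3₁ hs₁)).mono ?_ ?_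
        · rintro σ σ' h ho ⟨h', hs⟩
          unfold Solved at *
          exact ⟨h.trans h', by rwa [ho]⟩
        · rw [hc, tryTime]; omega
        · exact fun σ₂ h => ⟨h.1, Or.inr ⟨by omega, h.2⟩⟩
    · rintro σ₁ ⟨hat, hp⟩
      refine Wp.while_done (by rw [hat.lt_iff (by omega)]; exact lt_irrefl _) ?_
      obtain ⟨ζ₁, hE₁, -⟩ := hat
      rcases hp with ⟨h, -⟩ | ⟨-, h⟩
      · omega
      · exact ⟨⟨ζ₁, hE₁⟩, h⟩
    · exact ⟨⟨ζ₀, hE₀, by simpa using hζ₀⟩, Or.inl ⟨Nat.zero_le _, h3₀.trans h3⟩⟩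
  · rw [Finset.sum_congr rfl fun b _ => Nat.add_right_comm _ _ 1, Finset.sum_add_distrib,
      Finset.sum_ite_eq' , if_pos (Finset.mem_range.2 hb₀n), Finset.sum_const, Finset.card_range,
      smul_eq_mul]
    have : m * (c + 1) ≤ n * (tryTime j t 0 + 4 * t + 3) := Nat.mul_le_mul (by omega) le_rfl
    omega

/-! ### The complete algorithm and its three time bounds -/

/-- The algorithm. -/
noncomputable def twoColoring (j t : ℕ) : RAMProg (j + 3) :=
  .seq (.instr (.const 2 1)) (.seq (tryBlocks j t) (.ifLT 1 3 (.instr (.const 6 0))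
    (.seq (nest (tryGadget j t) (2 * t)) (.ifLT 1 3 (.instr (.const 6 0)) (bruteForce j)))))

theorem env_start (P : RAMProg (j + 3)) (n : ℕ) :
    ∃ ζ, Env n ζ { (P.start n).2 with reg := Function.update (P.start n).2.reg 2 1 } :=
  ⟨fun _ => 0, by simp [start], by simp [start], by simp [start], fun r hr => by
    simp only [start]
    rw [Function.update_of_ne (by omega), Function.update_of_ne (by omega)]⟩

theorem wp_twoColoring_fast (ht : j + 3 ≤ t) (hH : ∃ col, H.ProperOn col) (hN : H.Nice t)
    (hB : ∃ b, b < n - (2 * t - 1) ∧ H.IsGadget (consec t b)) :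
    Wp H (twoColoring j t) ((twoColoring j t).start n).2
      (4 * t + 8 + n * (tryTime j t 0 + 4 * t + 3) + extendConst j t * (n + n + 1))
      (Solved H) := by
  obtain ⟨ζ, hE⟩ := env_start (twoColoring j t) n
  apply Wp.le
  · apply Wp.seq
    apply Wp.const
    apply Wp.seq
    refine (wp_tryBlocks_of_gadget ht hH hN hB hE (by simp [start])).imp ?_
    rintro σ₁ ⟨⟨ζ₁, hE₁⟩, h3₁, hs₁⟩
    exact Wp.ifLT_pos (by rw [h3₁, hE₁.reg_one]; decide) (Wp.const hs₁)
  · omega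

/-- The register contents that encode `z`. -/
def encode (t : ℕ) (ζ : ℕ → ℕ) (z : Bool → Fin t → ℕ) (r : ℕ) : ℕ :=
  if h : 20 ≤ r ∧ (r - 20) / 2 < t then z (decide ((r - 20) % 2 = 1)) ⟨(r - 20) / 2, h.2⟩ else ζ r

theorem gadOf_encode (z : Bool → Fin t → ℕ) : gadOf t (encode t ζ z) = z := by
  funext b i
  have h1 : (gadReg b i - 20) / 2 = i := by unfold gadReg; cases b <;> simp only [Bool.toNat_false, Bool.toNat_true] <;> omega
  have h2 : (decide ((gadReg b i - 20) % 2 = 1)) = b := by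
    cases b <;> simp [gadReg]
    omega
  unfold gadOf encode
  rw [dif_pos ⟨le_gadReg b i, by rw [h1]; exact i.2⟩, h2]
  congr 1
  exact Fin.ext h1

theorem wp_fallback (ht : j + 3 ≤ t) (hH : ∃ col, H.ProperOn col) (hE : Env n ζ σ)
    (hσ : Progress H σ) :
    Wp H (nest (tryGadget j t) (2 * t)) σ
      ((tryTime j t (n + n * n + 1) + 3) * (n + 3) ^ (2 * t)) fun σ' =>
      (∃ ζ', Env n ζ' σ') ∧ Progress H σ' ∧
        (H.Nice t → (∃ z : Bool → Fin t → ℕ, H.IsGadget z) → σ'.reg 3 = 1) := by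
  refine (wp_nest (T := tryTime j t (n + n * n + 1)) (Progress H)
    (fun ξ σ' => H.Nice t → σ'.reg 3 = 1 ∨ ¬H.IsGadget (gadOf t ξ)) ?_ ?_ ?_ (2 * t) hE hσ).mono
    (Nat.sub_le _ _) ?_
  · intro σ r m hr h
    refine Progress.congr (σ := σ) ?_ rfl h
    exact Function.update_of_ne (by omega) _ _
  · intro ξ σ r m hr h hN
    simp only
    rw [Function.update_of_ne (by omega)]
    exact h hN
  · intro ζ σ hE hσ
    refine (wp_tryGadget ht hH hE hσ).imp ?_
    rintro σ' ⟨h1, h2, h3, h4⟩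
    exact ⟨h1, h2, h3, fun ξ h hN => (h hN).imp_left h4⟩
  · rintro σ' ⟨ζ', hE', -, hp, hD, -⟩
    refine ⟨⟨ζ', hE'⟩, hp, fun hN ⟨z, hz⟩ => ?_⟩
    refine (hD (encode t ζ z) ?_ ?_ hN).resolve_right ?_
    · intro i hi
      unfold encode
      rw [dif_pos ⟨by omega, by omega⟩]
      exact hz.lt ht _ _
    · intro r hr
      unfold encode
      rw [dif_neg (by omega)]
    · rw [gadOf_encode]
      exact fun h => h hz

/-- A bound for the running time without the exhaustive search. -/
noncomputable def gadgetTime (j t n : ℕ) : ℕ :=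
  4 * t + 15 + n * (tryTime j t (n + n * n + 1) + 4 * t + 3) +
    (tryTime j t (n + n * n + 1) + 3) * (n + 3) ^ (2 * t)

/-- The second stage tries all tuples, hence also some gadget; on a nice hypergraph it succeeds
there, and the exhaustive search is not reached. -/
theorem wp_twoColoring_medium (ht : j + 3 ≤ t) (hH : ∃ col, H.ProperOn col) (hN : H.Nice t)
    (hB : ∃ z : Bool → Fin t → ℕ, H.IsGadget z) :
    Wp H (twoColoring j t) ((twoColoring j t).start n).2 (gadgetTime j t n) (Solved H) := by
  obtain ⟨ζ, hE⟩ := env_start (twoColoring j t) n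
  apply Wp.le
  · apply Wp.seq
    apply Wp.const
    apply Wp.seq
    refine (wp_tryBlocks ht hH hE (Or.inl (by simp [start]))).imp ?_
    rintro σ₁ ⟨⟨ζ₁, hE₁⟩, hp₁⟩
    apply Wp.ifLT
    · intro hlt
      rcases hp₁ with h | h
      · rw [h] at hlt; omega
      · exact Wp.const h.2
    · intro _
      apply Wp.seq
      refine (wp_fallback ht hH hE₁ hp₁).imp ?_
      rintro σ₂ ⟨⟨ζ₂, hE₂⟩, hp₂, h⟩
      have h3 := h hN hB
      refine Wp.ifLT_pos (by rw [h3, hE₂.reg_one]; decide) (Wp.const ?_)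
      rcases hp₂ with h' | h'
      · omega
      · exact h'.2
  · unfold gadgetTime
    omega

theorem wp_twoColoring (ht : j + 3 ≤ t) (hH : ∃ col, H.ProperOn col) :
    Wp H (twoColoring j t) ((twoColoring j t).start n).2
      (gadgetTime j t n + 2 ^ n * (n + 3) ^ (j + 3) * (9 * j + 150)) (Solved H) := by
  obtain ⟨ζ, hE⟩ := env_start (twoColoring j t) n
  apply Wp.le
  · apply Wp.seq
    apply Wp.const
    apply Wp.seq
    refine (wp_tryBlocks ht hH hE (Or.inl (by simp [start]))).imp ?_
    rintro σ₁ ⟨⟨ζ₁, hE₁⟩, hp₁⟩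
    apply Wp.ifLT
    · intro hlt
      rcases hp₁ with h | h
      · rw [h] at hlt; omega
      · exact Wp.const h.2
    · intro _
      apply Wp.seq
      refine (wp_fallback ht hH hE₁ hp₁).imp ?_
      rintro σ₂ ⟨⟨ζ₂, hE₂⟩, hp₂, -⟩
      apply Wp.ifLT
      · intro hlt
        rcases hp₂ with h | h
        · rw [h] at hlt; omega
        · exact Wp.const h.2
      · intro hlt
        obtain ⟨col, hcol⟩ := hH
        rcases hp₂ with h | h
        · exact wp_bruteForce hcol hE₂ h
        · rw [h.1, hE₂.reg_one] at hlt; omega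
  · unfold gadgetTime
    have : 1 ≤ 2 ^ n * (n + 3) ^ (j + 3) * (9 * j + 150) := Nat.succ_le_of_lt (by positivity)
    omega

end RAMProg

/-! ### Counting with independent fair bits -/

section Bits

open Finset
open scoped BigOperators

variable {X ι : Type*} [Fintype X] [DecidableEq X]

/-- Take two independent copies of the bits and exchange their coordinates outside `S`. This
involution turns `f ω * g ω'` into `f ω * g ω`. -/
theorem expect_mul_of_indep (S : Finset X) (f g : (X → Bool) → ℝ)
    (hf : ∀ ω ω', (∀ x ∈ S, ω x = ω' x) → f ω = f ω')
    (hg : ∀ ω ω', (∀ x ∉ S, ω x = ω' x) → g ω = g ω') :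
    𝔼 ω, f ω * g ω = (𝔼 ω, f ω) * 𝔼 ω, g ω := by
  let mix : (X → Bool) × (X → Bool) → (X → Bool) × (X → Bool) := fun p =>
    (fun x => if x ∈ S then p.1 x else p.2 x, fun x => if x ∈ S then p.2 x else p.1 x)
  have hmix : Function.Involutive mix := by
    rintro ⟨ω, ω'⟩
    refine Prod.ext (funext fun x => ?_) (funext fun x => ?_) <;> simp only [mix] <;>
      split_ifs <;> rfl
  have h1 : ∑ p : (X → Bool) × (X → Bool), f p.1 * g p.2 =
      ∑ p : (X → Bool) × (X → Bool), f p.1 * g p.1 := by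
    refine Fintype.sum_equiv hmix.toPerm _ _ fun p => ?_
    congr 1
    · refine hf _ _ fun x hx => ?_
      simp [mix, hx]
    · refine hg _ _ fun x hx => ?_
      simp [mix, hx]
  have h2 : (∑ ω, f ω) * ∑ ω, g ω = (Fintype.card (X → Bool) : ℝ) * ∑ ω, f ω * g ω := by
    rw [sum_mul_sum, ← Fintype.sum_prod_type', h1, Fintype.sum_prod_type, mul_sum]
    refine sum_congr rfl fun ω _ => ?_
    simp
  have hc : (Fintype.card (X → Bool) : ℝ) ≠ 0 := by simp
  rw [Fintype.expect_eq_sum_div_card, Fintype.expect_eq_sum_div_card,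
    Fintype.expect_eq_sum_div_card, div_mul_div_comm, h2]
  field_simp

theorem expect_prod_of_indep [DecidableEq ι] (I : Finset ι) (T : ι → Finset X)
    (g : ι → (X → Bool) → ℝ) (hT : (I : Set ι).PairwiseDisjoint T)
    (hg : ∀ i ∈ I, ∀ ω ω', (∀ x ∈ T i, ω x = ω' x) → g i ω = g i ω') :
    𝔼 ω, ∏ i ∈ I, g i ω = ∏ i ∈ I, 𝔼 ω, g i ω := by
  induction I using Finset.induction_on with
  | empty => simp
  | insert i I hi ih =>
    simp only [prod_insert hi]
    rw [expect_mul_of_indep (T i), ih]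
    · exact hT.subset (by simp)
    · exact fun i' hi' => hg i' (mem_insert_of_mem hi')
    · exact hg i (mem_insert_self _ _)
    · intro ω ω' h
      refine prod_congr rfl fun i' hi' => hg i' (mem_insert_of_mem hi') _ _ fun x hx => h x ?_
      have hne : i' ≠ i := by rintro rfl; exact hi hi'
      have := hT (mem_coe.2 (mem_insert_of_mem hi')) (mem_coe.2 (mem_insert_self i I)) hne
      exact disjoint_left.1 this hx

theorem expect_pattern (T : Finset X) (a : X → Bool) :
    𝔼 ω : X → Bool, (if ∀ x ∈ T, ω x = a x then (1 : ℝ) else 0) = (1 / 2) ^ T.card := by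
  have h : ∀ ω : X → Bool, (if ∀ x ∈ T, ω x = a x then (1 : ℝ) else 0) =
      ∏ x ∈ T, if ω x = a x then (1 : ℝ) else 0 := fun ω => by
    rw [Finset.prod_ite_zero]
    simp
  simp only [h]
  rw [expect_prod_of_indep T (fun x => {x})]
  · rw [prod_congr rfl (g := fun _ => (1 / 2 : ℝ)), prod_const]
    intro x _
    -- Flipping the bit `x` shows that its two values are equally likely.
    have h1 : 𝔼 ω : X → Bool, (if ω x = a x then (1 : ℝ) else 0) =
        𝔼 ω : X → Bool, (if ω x = !a x then (1 : ℝ) else 0) := by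
      let e : (X → Bool) → (X → Bool) := fun ω => Function.update ω x (!ω x)
      have he : Function.Involutive e := fun ω => by simp [e]
      refine Fintype.expect_equiv he.toPerm _ _ fun ω => ?_
      simp [e]
    have h2 : 𝔼 ω : X → Bool, (if ω x = a x then (1 : ℝ) else 0) +
        𝔼 ω : X → Bool, (if ω x = !a x then (1 : ℝ) else 0) = 1 := by
      rw [← expect_add_distrib, expect_congr rfl (g := fun _ => (1 : ℝ)), Fintype.expect_const]
      intro ω _
      cases ω x <;> cases a x <;> simp
    linarith
  · intro x _ y _ hxy
    simpa [Function.onFun] using hxy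
  · intro x _ ω ω' h
    rw [h x (mem_singleton_self x)]

end Bits

/-! ### The planted model -/

namespace KGraph

open Finset
open scoped BigOperators

variable {k n : ℕ}

/-- The possible edges of a `k`-graph with the coloring `c`. -/
def crossing (k : ℕ) (c : Fin n → Bool) : Finset (Finset (Fin n)) :=
  (powersetCard k univ).filter fun e => ∃ u ∈ e, ∃ v ∈ e, c u ≠ c v

theorem mem_crossing {c : Fin n → Bool} {e : Finset (Fin n)} :
    e ∈ crossing k c ↔ e.card = k ∧ ∃ u ∈ e, ∃ v ∈ e, c u ≠ c v := by
  simp [crossing]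

theorem isTwoColoring_iff {H : KGraph k n} {c : Fin n → Bool} :
    H.IsTwoColoring c ↔ H.1 ⊆ crossing k c :=
  ⟨fun h e he => mem_crossing.2 ⟨H.2 e he, h e he⟩, fun h _ he => (mem_crossing.1 (h he)).2⟩

open Classical in
/-- The `k`-graph whose edges are the possible edges with the bit `true`. -/
noncomputable def graphOf (c : Fin n → Bool) (ω : {e // e ∈ crossing k c} → Bool) : KGraph k n :=
  ⟨(univ.filter fun e => ω e = true).map (Function.Embedding.subtype _), fun _ he => by
    obtain ⟨x, -, rfl⟩ := mem_map.1 he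
    exact (mem_crossing.1 x.2).1⟩

theorem mem_graphOf {c : Fin n → Bool} {ω : {e // e ∈ crossing k c} → Bool}
    (e : {e // e ∈ crossing k c}) : e.1 ∈ (graphOf c ω).1 ↔ ω e = true := by
  simp [graphOf]

theorem isTwoColoring_graphOf (c : Fin n → Bool) (ω : {e // e ∈ crossing k c} → Bool) :
    (graphOf c ω).IsTwoColoring c := by
  rw [isTwoColoring_iff]
  intro e he
  obtain ⟨x, -, rfl⟩ := mem_map.1 he
  exact x.2

open Classical in
/-- The probability of `A` when the edges are random subject to the coloring `c`. -/
noncomputable def pr (c : Fin n → Bool) (A : KGraph k n → Prop) : ℝ :=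
  𝔼 ω : {e // e ∈ crossing k c} → Bool, if A (graphOf c ω) then 1 else 0

/-- `graphOf c` is a bijection from the bit vectors to the hypergraphs colored by `c`. This is the
passage between counting and the planted model. -/
theorem card_filter_eq_pr (c : Fin n → Bool) (A : KGraph k n → Prop)
    [DecidablePred fun H : KGraph k n => H.IsTwoColoring c ∧ A H] :
    ((univ.filter fun H : KGraph k n => H.IsTwoColoring c ∧ A H).card : ℝ) =
      2 ^ (crossing k c).card * pr c A := by
  classical
  have h1 : (univ.filter fun H : KGraph k n => H.IsTwoColoring c ∧ A H).card =
      (univ.filter fun ω : {e // e ∈ crossing k c} → Bool => A (graphOf c ω)).card := by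
    symm
    refine card_bij (fun ω _ => graphOf c ω) ?_ ?_ ?_
    · intro ω hω
      simpa using ⟨isTwoColoring_graphOf c ω, by simpa using hω⟩
    · intro ω _ ω' _ h
      funext e
      have h1 := mem_graphOf (ω := ω) e
      rw [h, mem_graphOf] at h1
      exact (Bool.eq_iff_iff.2 h1).symm
    · intro H hH
      simp only [mem_filter, mem_univ, true_and] at hH
      have hH' := isTwoColoring_iff.1 hH.1
      have : graphOf c (fun e => decide (e.1 ∈ H.1)) = H := by
        refine Subtype.ext (Finset.ext fun e => ⟨fun he => ?_, fun he => ?_⟩)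
        · obtain ⟨x, hx, rfl⟩ := mem_map.1 he
          simpa using hx
        · exact (mem_graphOf ⟨e, hH' he⟩).2 (by simpa using he)
      exact ⟨_, by simpa [this] using hH.2, this⟩
  rw [h1, pr, Fintype.expect_eq_sum_div_card, sum_boole]
  simp only [Fintype.card_pi, Fintype.card_bool, prod_const, card_univ, Fintype.card_coe,
    Nat.cast_pow, Nat.cast_ofNat]
  field_simp

theorem pr_nonneg (c : Fin n → Bool) (A : KGraph k n → Prop) : 0 ≤ pr c A := by
  classical
  exact expect_nonneg fun ω _ => by split_ifs <;> norm_num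

theorem pr_mono {c : Fin n → Bool} {A B : KGraph k n → Prop}
    (h : ∀ H : KGraph k n, H.IsTwoColoring c → A H → B H) : pr c A ≤ pr c B := by
  classical
  refine expect_le_expect fun ω _ => ?_
  by_cases hA : A (graphOf c ω)
  · rw [if_pos hA, if_pos (h _ (isTwoColoring_graphOf c ω) hA)]
  · rw [if_neg hA]
    split_ifs <;> norm_num

theorem pr_le_one (c : Fin n → Bool) (A : KGraph k n → Prop) : pr c A ≤ 1 := by
  classical
  refine (expect_le_expect (g := fun _ => (1 : ℝ)) fun ω _ => ?_).trans (by simp)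
  split_ifs <;> norm_num

theorem pr_true (c : Fin n → Bool) : pr c (fun _ : KGraph k n => True) = 1 := by
  simp [pr]

theorem pr_not (c : Fin n → Bool) (A : KGraph k n → Prop) :
    pr c (fun H => ¬A H) = 1 - pr c A := by
  classical
  rw [eq_sub_iff_add_eq, pr, pr, ← expect_add_distrib,
    expect_congr rfl (g := fun _ => (1 : ℝ)), Fintype.expect_const]
  intro ω _
  by_cases h : A (graphOf c ω) <;> simp [h]

theorem pr_or_le (c : Fin n → Bool) (A B : KGraph k n → Prop) :
    pr c (fun H => A H ∨ B H) ≤ pr c A + pr c B := by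
  classical
  rw [pr, pr, pr, ← expect_add_distrib]
  refine expect_le_expect fun ω _ => ?_
  by_cases hA : A (graphOf c ω) <;> by_cases hB : B (graphOf c ω) <;> simp [hA, hB]

theorem pr_exists_le {ι : Type*} (I : Finset ι) (c : Fin n → Bool) (A : ι → KGraph k n → Prop) :
    pr c (fun H => ∃ i ∈ I, A i H) ≤ ∑ i ∈ I, pr c (A i) := by
  classical
  induction I using Finset.induction_on with
  | empty => simp [pr]
  | insert i I hi ih =>
    rw [sum_insert hi]
    refine le_trans (le_of_eq ?_) ((pr_or_le c (A i) fun H => ∃ i ∈ I, A i H).trans (by gcongr))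
    congr 1
    funext H
    simp

theorem pr_disjoint {c : Fin n → Bool} {T : Finset (Finset (Fin n))} (hT : T ⊆ crossing k c) :
    pr c (fun H : KGraph k n => Disjoint H.1 T) = (1 / 2) ^ T.card := by
  classical
  have hcard : (T.subtype (· ∈ crossing k c)).card = T.card := by
    rw [card_subtype, filter_true_of_mem fun e he => hT he]
  rw [← hcard, ← expect_pattern _ fun _ => false, pr]
  refine expect_congr rfl fun ω _ => ?_
  congr 1
  refine propext ⟨fun h e he => ?_, fun h => disjoint_left.2 fun e he heT => ?_⟩
  · have := disjoint_right.1 h (mem_subtype.1 he)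
    rw [mem_graphOf] at this
    simpa using this
  · have := h ⟨e, hT heT⟩ (mem_subtype.2 heT)
    rw [← Bool.not_eq_true, ← mem_graphOf] at this
    exact this he

theorem pr_forall_not_subset {ι : Type*} [DecidableEq ι] {c : Fin n → Bool} {I : Finset ι}
    {T : ι → Finset (Finset (Fin n))} {G : ℕ} (hT : ∀ i ∈ I, T i ⊆ crossing k c)
    (hG : ∀ i ∈ I, (T i).card = G) (hd : (I : Set ι).PairwiseDisjoint T) :
    pr c (fun H : KGraph k n => ∀ i ∈ I, ¬T i ⊆ H.1) = (1 - (1 / 2) ^ G) ^ I.card := by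
  classical
  have hcard : ∀ i ∈ I, ((T i).subtype (· ∈ crossing k c)).card = G := fun i hi => by
    rw [card_subtype, filter_true_of_mem fun e he => hT i hi he, hG i hi]
  have hsub : ∀ i ∈ I, ∀ ω : {e // e ∈ crossing k c} → Bool, T i ⊆ (graphOf c ω).1 ↔
      ∀ e ∈ (T i).subtype (· ∈ crossing k c), ω e = true := fun i hi ω =>
    ⟨fun h e he => (mem_graphOf e).1 (h (mem_subtype.1 he)),
      fun h e he => (mem_graphOf ⟨e, hT i hi he⟩).2 (h _ (mem_subtype.2 he))⟩
  have key : pr c (fun H : KGraph k n => ∀ i ∈ I, ¬T i ⊆ H.1) =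
      𝔼 ω : {e // e ∈ crossing k c} → Bool, ∏ i ∈ I,
        if ∀ e ∈ (T i).subtype (· ∈ crossing k c), ω e = true then (0 : ℝ) else 1 := by
    refine expect_congr rfl fun ω _ => ?_
    by_cases h : ∀ i ∈ I, ¬T i ⊆ (graphOf c ω).1
    · rw [if_pos h, prod_eq_one fun i hi => if_neg (by rw [← hsub i hi]; exact h i hi)]
    · rw [if_neg h]
      push Not at h
      obtain ⟨i, hi, h⟩ := h
      refine (prod_eq_zero hi ?_).symm
      exact if_pos ((hsub i hi ω).1 h)
  rw [key, expect_prod_of_indep I fun i => (T i).subtype (· ∈ crossing k c)]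
  · rw [prod_congr rfl (g := fun _ => (1 - (1 / 2) ^ G : ℝ)), prod_const]
    intro i hi
    rw [← hcard i hi, ← expect_pattern _ fun _ => true, eq_sub_iff_add_eq, ← expect_add_distrib,
      expect_congr rfl (g := fun _ => (1 : ℝ)), Fintype.expect_const]
    intro ω _
    split_ifs <;> norm_num
  · intro i hi i' hi' hne
    refine disjoint_left.2 fun e he he' => ?_
    exact disjoint_left.1 (hd hi hi' hne) (mem_subtype.1 he) (mem_subtype.1 he')
  · intro i _ ω ω' h
    congr 1
    exact propext (forall₂_congr fun e he => by rw [h e he])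

end KGraph

/-! ### The edges of a gadget and the edges that decide vertices -/

namespace KGraph

open Finset

variable {j n t : ℕ} {H : KGraph (j + 3) n} {c : Fin n → Bool} {w : Bool × Fin t ↪ Fin n}

/-- The edges of a gadget as sets of indices. -/
def gadgetPattern (j t : ℕ) : Finset (Finset (Bool × Fin t)) :=
  (powersetCard (j + 3) univ).filter fun S => ∃ p ∈ S, ∃ q ∈ S, p.1 ≠ q.1

/-- The edges of the gadget with the vertices `w`. -/
def gadgetEdges (j : ℕ) (w : Bool × Fin t ↪ Fin n) : Finset (Finset (Fin n)) :=
  (gadgetPattern j t).map (mapEmbedding w).toEmbedding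

theorem card_gadgetEdges (w : Bool × Fin t ↪ Fin n) :
    (gadgetEdges j w).card = (gadgetPattern j t).card := card_map _

theorem mem_gadgetEdges {e : Finset (Fin n)} : e ∈ gadgetEdges j w ↔
    ∃ S : Finset (Bool × Fin t), S.card = j + 3 ∧ (∃ p ∈ S, ∃ q ∈ S, p.1 ≠ q.1) ∧ S.map w = e := by
  simp [gadgetEdges, gadgetPattern, and_assoc]

/-- The gadget has the colors that are given by its groups. -/
def Matched (c : Fin n → Bool) (w : Bool × Fin t ↪ Fin n) : Prop := ∀ p, c (w p) = p.1

theorem gadgetEdges_subset_crossing (hw : Matched c w) :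
    gadgetEdges j w ⊆ crossing (j + 3) c := by
  intro e he
  obtain ⟨S, hS, ⟨p, hp, q, hq, hpq⟩, rfl⟩ := mem_gadgetEdges.1 he
  refine mem_crossing.2 ⟨by rw [card_map, hS], w p, mem_map_of_mem _ hp, w q, mem_map_of_mem _ hq, ?_⟩
  rwa [hw, hw]

/-- The vertices of `w` as numbers. -/
def toGadget (w : Bool × Fin t ↪ Fin n) (b : Bool) (i : Fin t) : ℕ := w (b, i)

theorem isGadget_of_gadgetEdges_subset (h : gadgetEdges j w ⊆ H.1) : H.IsGadget (toGadget w) := by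
  rintro f hf ⟨a, b, hab⟩
  refine ⟨_, h (mem_gadgetEdges.2 ⟨univ.map ⟨f, hf⟩, by simp, ⟨f a, by simp, f b, by simp, hab⟩, rfl⟩), ?_⟩
  ext x
  simp [toGadget]

/-- A gadget edge meets both groups and so has two different indices; a common edge would make both
of the corresponding vertices common to the two candidates. -/
theorem disjoint_gadgetEdges {w' : Bool × Fin t ↪ Fin n}
    (h : ∀ p q p' q', w p = w' p' → w q = w' q' → p = q) :
    Disjoint (gadgetEdges j w) (gadgetEdges j w') := by
  refine disjoint_left.2 fun e he he' => ?_
  obtain ⟨S, -, ⟨p, hp, q, hq, hpq⟩, rfl⟩ := mem_gadgetEdges.1 he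
  obtain ⟨S', -, -, hSS⟩ := mem_gadgetEdges.1 he'
  have hex : ∀ p ∈ S, ∃ p', w p = w' p' := fun p hp => by
    have := mem_map_of_mem w hp
    rw [← hSS] at this
    obtain ⟨p', -, h⟩ := mem_map.1 this
    exact ⟨p', h.symm⟩
  obtain ⟨p', hp'⟩ := hex p hp
  obtain ⟨q', hq'⟩ := hex q hq
  exact hpq (by rw [h p q p' q' hp' hq'])

theorem IsGadget.exists_embedding {z : Bool → Fin t → ℕ} (ht : j + 3 ≤ t) (hz : H.IsGadget z) :
    ∃ w : Bool × Fin t ↪ Fin n, toGadget w = z := by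
  refine ⟨⟨fun p => ⟨z p.1 p.2, hz.lt ht _ _⟩, fun p q h => ?_⟩, rfl⟩
  obtain ⟨f, hf, hf', ⟨a, rfl⟩, b, rfl⟩ := exists_gadget_query ht p q
  have := (hz f hf hf').injective
  rw [this (Fin.mk.inj_iff.1 h)]

theorem inGadget_iff {v : Fin n} : InGadget (toGadget w) v ↔ v ∈ Set.range w := by
  simp [InGadget, toGadget, Fin.val_inj]

/-- The group `b` of the gadget. -/
def group (w : Bool × Fin t ↪ Fin n) (b : Bool) : Fin t ↪ Fin n :=
  ⟨fun i => w (b, i), fun i i' h => by simpa using h⟩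

theorem group_apply {b : Bool} (i : Fin t) : group w b i = w (b, i) := rfl

theorem image_cons {m : ℕ} {α : Type*} [DecidableEq α] (x : α) (f : Fin m → α) :
    univ.image (Fin.cons x f : Fin (m + 1) → α) = insert x (univ.image f) := by
  ext y
  simp only [mem_image, mem_univ, true_and, mem_insert]
  rw [Fin.exists_fin_succ]
  simp [eq_comm]

theorem image_equivFin {m : ℕ} {b : Bool} {S : Finset (Fin t)} (f : S ≃ Fin m) :
    univ.image (fun i => group w b (f.symm i)) = S.map (group w b) := by
  ext y
  simp only [mem_image, mem_univ, true_and, mem_map]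
  constructor
  · rintro ⟨i, rfl⟩
    exact ⟨_, (f.symm i).2, rfl⟩
  · rintro ⟨i, hi, rfl⟩
    exact ⟨f ⟨i, hi⟩, by simp⟩

theorem isEdge_of_eq {k : ℕ} {H : KGraph k n} {q : Fin k → Fin n} (h : univ.image q ∈ H.1) :
    H.IsEdge fun a => (q a : ℕ) := by
  refine ⟨_, h, ?_⟩
  ext x
  simp

theorem hit_of_mem {b : Bool} {v : Fin n} {S : Finset (Fin t)} (hS : S.card = j + 2)
    (h : insert v (S.map (group w b)) ∈ H.1) : H.Hit (toGadget w) b v := by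
  let f := S.equivFinOfCardEq hS
  refine ⟨fun a => f.symm a, fun a a' h => f.symm.injective (Subtype.ext h), ?_⟩
  have := isEdge_of_eq (H := H) (q := Fin.cons v fun i => group w b (f.symm i)) ?_
  · convert this using 1
    funext a
    refine Fin.cases ?_ (fun i => ?_) a <;> simp [toGadget, group_apply]
  · rwa [image_cons, image_equivFin]

theorem pairHit_of_mem {b : Bool} {v x : Fin n} {S : Finset (Fin t)} (hS : S.card = j + 1)
    (h : insert v (insert x (S.map (group w b))) ∈ H.1) : H.PairHit (toGadget w) b v x := by
  let f := S.equivFinOfCardEq hS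
  refine ⟨fun a => f.symm a, fun a a' h => f.symm.injective (Subtype.ext h), ?_⟩
  have := isEdge_of_eq (H := H)
    (q := Fin.cons v (Fin.cons x fun i => group w b (f.symm i) : Fin (j + 2) → Fin n)) ?_
  · convert this using 1
    funext a
    refine Fin.cases ?_ (fun i => ?_) a
    · simp
    · refine Fin.cases ?_ (fun i => ?_) i <;> simp [toGadget, group_apply]
  · rwa [image_cons, image_cons, image_equivFin]

/-! ### The probability that the gadget decides few vertices -/

theorem group_mem_range {b : Bool} {S : Finset (Fin t)} {y : Fin n}
    (h : y ∈ S.map (group w b)) : y ∈ Set.range w := by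
  obtain ⟨i, -, rfl⟩ := mem_map.1 h
  exact ⟨_, rfl⟩

theorem Matched.group (hw : Matched c w) {b : Bool} {S : Finset (Fin t)} {y : Fin n}
    (h : y ∈ S.map (group w b)) : c y = b := by
  obtain ⟨i, -, rfl⟩ := mem_map.1 h
  exact hw _

/-- The edges that would decide the vertices in `U`. -/
def hitEdges (j : ℕ) (c : Fin n → Bool) (w : Bool × Fin t ↪ Fin n) (U : Finset (Fin n)) :
    Finset (Finset (Fin n)) :=
  (U ×ˢ powersetCard (j + 2) univ).image fun p => insert p.1 (p.2.map (group w (!c p.1)))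

/-- No edge is counted twice: `v` is its only vertex outside the gadget, and removing `v` gives back
`S`. -/
theorem card_hitEdges {U : Finset (Fin n)} (hU : ∀ v ∈ U, v ∉ Set.range w) :
    (hitEdges j c w U).card = U.card * t.choose (j + 2) := by
  rw [hitEdges, card_image_of_injOn, card_product, card_powersetCard, card_univ, Fintype.card_fin]
  rintro ⟨v, S⟩ hv ⟨v', S'⟩ hv' h
  simp only [coe_product, Set.mem_prod, mem_coe] at hv hv' h
  have h1 : v = v' := by
    have : v ∈ insert v' (S'.map (group w (!c v'))) := by rw [← h]; simp
    rcases mem_insert.1 this with h | h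
    · exact h
    · exact absurd (group_mem_range h) (hU v hv.1)
  subst h1
  have h2 : ∀ S : Finset (Fin t), v ∉ S.map (group w (!c v)) := fun S h =>
    hU v hv.1 (group_mem_range h)
  have := congrArg (fun e => erase e v) h
  simp only [erase_insert (h2 _)] at this
  rw [map_injective _ this]

theorem hitEdges_subset_crossing {U : Finset (Fin n)} (hw : Matched c w)
    (hU : ∀ v ∈ U, v ∉ Set.range w) : hitEdges j c w U ⊆ crossing (j + 3) c := by
  intro e he
  obtain ⟨⟨v, S⟩, h, rfl⟩ := mem_image.1 he
  obtain ⟨hv, hS⟩ := mem_product.1 h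
  have hS := (mem_powersetCard.1 hS).2
  dsimp only at hS hv ⊢
  obtain ⟨i, hi⟩ := card_pos.1 (by omega : 0 < S.card)
  have hy := mem_map_of_mem (group w (!c v)) hi
  refine mem_crossing.2 ⟨?_, v, mem_insert_self _ _, _, mem_insert_of_mem hy, ?_⟩
  · rw [card_insert_of_notMem fun h => hU v hv (group_mem_range h), card_map, hS]
  · rw [hw.group hy]
    simp

/-- Every undecided vertex excludes `t.choose (j + 2) ≥ t` possible edges, different ones for
different vertices. -/
theorem pr_undecided_le (hw : Matched c w) (ht : t ≤ t.choose (j + 2)) {U : Finset (Fin n)} {m : ℕ}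
    (hU : ∀ v ∈ U, v ∉ Set.range w) (hm : m ≤ U.card) :
    pr c (fun H : KGraph (j + 3) n =>
      ∀ v ∈ U, H.Undecided (toGadget w) (extendColoring c) v) ≤ (1 / 2) ^ (t * m) := by
  refine (pr_mono (B := fun H => Disjoint H.1 (hitEdges j c w U)) fun H hH h => ?_).trans ?_
  · refine disjoint_right.2 fun e he heH => ?_
    obtain ⟨⟨v, S⟩, hvS, rfl⟩ := mem_image.1 he
    obtain ⟨hv, hS⟩ := mem_product.1 hvS
    refine (h v hv).2 ?_
    rw [extendColoring_val]
    exact hit_of_mem (mem_powersetCard.1 hS).2 heH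
  · rw [pr_disjoint (hitEdges_subset_crossing hw hU), card_hitEdges hU, mul_comm t m]
    exact pow_le_pow_of_le_one (by norm_num) (by norm_num) (Nat.mul_le_mul hm ht)

end KGraph

namespace KGraph

open Finset

theorem pr_exists_le_mul {k n : ℕ} {ι : Type*} {I : Finset ι} {c : Fin n → Bool}
    {A : ι → KGraph k n → Prop} {p : ℝ} (h : ∀ i ∈ I, pr c (A i) ≤ p) :
    pr c (fun H => ∃ i ∈ I, A i H) ≤ I.card * p :=
  (pr_exists_le I c A).trans ((sum_le_card_nsmul _ _ _ h).trans (by rw [nsmul_eq_mul]))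

variable {j n t : ℕ} {H : KGraph (j + 3) n} {c : Fin n → Bool} {w : Bool × Fin t ↪ Fin n}

open Classical in
/-- The vertices that are not decided. -/
noncomputable def undecidedSet (H : KGraph (j + 3) n) (c : Fin n → Bool)
    (w : Bool × Fin t ↪ Fin n) : Finset (Fin n) :=
  univ.filter fun v => H.Undecided (toGadget w) (extendColoring c) v

theorem mem_undecidedSet {v : Fin n} :
    v ∈ undecidedSet H c w ↔ H.Undecided (toGadget w) (extendColoring c) v := by
  simp [undecidedSet]

theorem notMem_range_of_mem_undecidedSet {v : Fin n} (h : v ∈ undecidedSet H c w) :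
    v ∉ Set.range w :=
  fun h' => (mem_undecidedSet.1 h).1 (inGadget_iff.2 h')

open Classical in
/-- The decided vertices of color `b` if `U` is the set of the vertices that are not decided. -/
noncomputable def decidedList (c : Fin n → Bool) (w : Bool × Fin t ↪ Fin n) (U : Finset (Fin n))
    (b : Bool) : List (Fin n) :=
  (List.finRange n).filter fun u => decide (u ∉ Set.range w ∧ u ∉ U ∧ c u = b)

theorem mem_decidedList {U : Finset (Fin n)} {b : Bool} {u : Fin n} :
    u ∈ decidedList c w U b ↔ u ∉ Set.range w ∧ u ∉ U ∧ c u = b := by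
  simp [decidedList]

theorem nodup_decidedList (U : Finset (Fin n)) (b : Bool) : (decidedList c w U b).Nodup :=
  (List.nodup_finRange n).filter _

/-- The lists depend on `H` only through the set of undecided vertices. Once this set is prescribed,
the edges tested in the second pass form a fixed set, and no conditioning is needed. -/
theorem decList_eq (b : Bool) : H.decList (toGadget w) (extendColoring c) b n =
    (decidedList c w (undecidedSet H c w) b).map Fin.val := by
  classical
  have h : List.range n = (List.finRange n).map Fin.val := by
    refine List.ext_getElem (by simp) fun i h1 h2 => by simp
  rw [decList, h, List.filter_map, decidedList]
  congr 2
  funext u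
  refine decide_eq_decide.2 ?_
  rw [mem_undecidedSet, ← inGadget_iff, Decided, Undecided, extendColoring_val]
  tauto

theorem le_length_decidedList (hw : Matched c w) {m : ℕ} {U : Finset (Fin n)} {b : Bool}
    (hm : 2 * m + t ≤ (univ.filter fun u => c u = b).card) (hU : U.card ≤ m) :
    m ≤ (decidedList c w U b).length := by
  classical
  have h : (univ.filter fun u => c u = b) ⊆
      ((decidedList c w U b).toFinset ∪ U) ∪ univ.map (group w b) := by
    intro u hu
    simp only [mem_filter, mem_univ, true_and] at hu
    rw [mem_union, mem_union, List.mem_toFinset, mem_decidedList]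
    by_cases h1 : u ∈ U
    · exact Or.inl (Or.inr h1)
    · by_cases h2 : u ∈ Set.range w
      · obtain ⟨⟨b', i⟩, rfl⟩ := h2
        rw [hw] at hu
        simp only at hu
        subst hu
        exact Or.inr (mem_map_of_mem _ (mem_univ i))
      · exact Or.inl (Or.inl ⟨h2, h1, hu⟩)
  have h1 := card_le_card h
  have h2 := card_union_le ((decidedList c w U b).toFinset ∪ U) (univ.map (group w b))
  have h3 := card_union_le (decidedList c w U b).toFinset U
  rw [card_map, card_univ, Fintype.card_fin] at h2
  have h4 := List.toFinset_card_le (decidedList c w U b)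
  omega

/-- The edges that would contain one of the vertices `v ∈ U` and one of the first `f v` decided
vertices of the other color. -/
noncomputable def pairEdges (j : ℕ) (c : Fin n → Bool) (w : Bool × Fin t ↪ Fin n)
    (U : Finset (Fin n)) (f : Fin n → ℕ) : Finset (Finset (Fin n)) :=
  (U.sigma fun v => ((decidedList c w U (!c v)).take (f v)).toFinset ×ˢ
    powersetCard (j + 1) univ).image fun p =>
      insert p.1 (insert p.2.1 (p.2.2.map (group w (!c p.1))))

theorem mem_take_decidedList {U : Finset (Fin n)} {b : Bool} {m : ℕ} {u : Fin n}
    (h : u ∈ (decidedList c w U b).take m) : u ∉ Set.range w ∧ u ∉ U ∧ c u = b :=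
  mem_decidedList.1 (List.mem_of_mem_take h)

/-- An edge determines its triple: `v` is its only vertex in `U`, and `x` is its only vertex outside
both `U` and the gadget. -/
theorem card_pairEdges {U : Finset (Fin n)} {f : Fin n → ℕ}
    (hU : ∀ v ∈ U, v ∉ Set.range w)
    (hf : ∀ v ∈ U, f v ≤ (decidedList c w U (!c v)).length) :
    (pairEdges j c w U f).card = (∑ v ∈ U, f v) * t.choose (j + 1) := by
  rw [pairEdges, card_image_of_injOn, card_sigma, sum_mul]
  · refine sum_congr rfl fun v hv => ?_
    rw [card_product, card_powersetCard, card_univ, Fintype.card_fin,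
      List.toFinset_card_of_nodup ((nodup_decidedList U _).sublist (List.take_sublist _ _)),
      List.length_take, min_eq_left (hf v hv)]
  rintro ⟨v, x, S⟩ hp ⟨v', x', S'⟩ hp' h
  simp only [mem_coe, mem_sigma, mem_product, List.mem_toFinset] at hp hp' h
  obtain ⟨hv, hx, -⟩ := hp
  obtain ⟨hv', hx', -⟩ := hp'
  obtain ⟨hxr, hxU, hxc⟩ := mem_take_decidedList hx
  obtain ⟨hxr', hxU', hxc'⟩ := mem_take_decidedList hx'
  have h1 : v = v' := by
    have : v ∈ insert v' (insert x' (S'.map (group w (!c v')))) := by rw [← h]; simp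
    rcases mem_insert.1 this with h | h
    · exact h
    · rcases mem_insert.1 h with h | h
      · exact absurd (h ▸ hv) hxU'
      · exact absurd (group_mem_range h) (hU v hv)
  subst h1
  have h2 : x = x' := by
    have : x ∈ insert v (insert x' (S'.map (group w (!c v)))) := by rw [← h]; simp
    rcases mem_insert.1 this with h | h
    · exact absurd (h ▸ hv) hxU
    · rcases mem_insert.1 h with h | h
      · exact h
      · exact absurd (group_mem_range h) hxr
  subst h2
  have h3 : ∀ S : Finset (Fin t), x ∉ S.map (group w (!c v)) := fun S h =>
    hxr (group_mem_range h)
  have h4 : ∀ S : Finset (Fin t), v ∉ insert x (S.map (group w (!c v))) := fun S h => by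
    rcases mem_insert.1 h with h | h
    · exact hxU (h ▸ hv)
    · exact hU v hv (group_mem_range h)
  have := congrArg (fun e => (e.erase v).erase x) h
  simp only [erase_insert (h4 _), erase_insert (h3 _)] at this
  rw [map_injective _ this]

theorem pairEdges_subset_crossing {U : Finset (Fin n)} {f : Fin n → ℕ}
    (hU : ∀ v ∈ U, v ∉ Set.range w) : pairEdges j c w U f ⊆ crossing (j + 3) c := by
  intro e he
  obtain ⟨⟨v, x, S⟩, h, rfl⟩ := mem_image.1 he
  simp only [mem_sigma, mem_product, List.mem_toFinset, mem_powersetCard] at h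
  obtain ⟨hv, hx, -, hS⟩ := h
  obtain ⟨hxr, hxU, hxc⟩ := mem_take_decidedList hx
  refine mem_crossing.2 ⟨?_, v, mem_insert_self _ _, x, by simp, ?_⟩
  · rw [card_insert_of_notMem, card_insert_of_notMem fun h => hxr (group_mem_range h), card_map, hS]
    intro h
    rcases mem_insert.1 h with h | h
    · exact hxU ((show v = x from h) ▸ hv)
    · exact hU v hv (group_mem_range h)
  · rw [hxc]
    simp

theorem disjoint_pairEdges {f : Fin n → ℕ}
    (hf : ∀ v ∈ undecidedSet H c w, f v ≤ H.missCount (toGadget w) (extendColoring c) v) :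
    Disjoint H.1 (pairEdges j c w (undecidedSet H c w) f) := by
  classical
  refine disjoint_right.2 fun e he heH => ?_
  obtain ⟨⟨v, x, S⟩, h, rfl⟩ := mem_image.1 he
  simp only [mem_sigma, mem_product, List.mem_toFinset, mem_powersetCard] at h
  obtain ⟨hv, hx, -, hS⟩ := h
  have hhit := pairHit_of_mem hS heH
  obtain ⟨i, hi, rfl⟩ := List.mem_take_iff_getElem.1 hx
  have hi' : i < f v := lt_of_lt_of_le hi (min_le_left _ _)
  have hmiss := lt_of_lt_of_le hi' (hf v hv)
  rw [missCount] at hmiss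
  have := List.not_of_lt_findIdx hmiss
  simp only [List.getElem_take, decList_eq, List.getElem_map, decide_eq_false_iff_not,
    extendColoring_val] at this
  exact this hhit

theorem pr_missCount_le (ht : t ≤ t.choose (j + 1)) {U : Finset (Fin n)}
    {f : Fin n → ℕ} :
    pr c (fun H : KGraph (j + 3) n => undecidedSet H c w = U ∧
      ∀ v ∈ U, f v ≤ H.missCount (toGadget w) (extendColoring c) v) ≤
        (1 / 2) ^ (t * ∑ v ∈ U, f v) := by
  -- If the event is empty, there is nothing to show. Otherwise a witness `H₀` guarantees that `f v`
  -- is at most the length of the list, as needed to count the absent edges.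
  by_cases h : ∃ H : KGraph (j + 3) n, undecidedSet H c w = U ∧
      ∀ v ∈ U, f v ≤ H.missCount (toGadget w) (extendColoring c) v
  · obtain ⟨H₀, rfl, hf⟩ := h
    have hU : ∀ v ∈ undecidedSet H₀ c w, v ∉ Set.range w := fun v =>
      notMem_range_of_mem_undecidedSet
    have hl : ∀ v ∈ undecidedSet H₀ c w,
        f v ≤ (decidedList c w (undecidedSet H₀ c w) (!c v)).length := fun v hv => by
      refine (hf v hv).trans ((missCount_le _).trans ((pairCount_le (!c v)).trans ?_))
      rw [decList_eq, List.length_map]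
    refine (pr_mono (B := fun H => Disjoint H.1 (pairEdges j c w (undecidedSet H₀ c w) f))
      fun H _ h => ?_).trans ?_
    · rw [← h.1]
      exact disjoint_pairEdges fun v hv => h.2 v (h.1 ▸ hv)
    · rw [pr_disjoint (pairEdges_subset_crossing hU), card_pairEdges hU hl,
        mul_comm t]
      exact pow_le_pow_of_le_one (by norm_num) (by norm_num) (Nat.mul_le_mul le_rfl ht)
  · refine (pr_mono (B := fun H => ¬True) fun H _ hH => absurd ⟨H, hH⟩ h).trans ?_
    rw [pr_not, pr_true, sub_self]
    positivity

/-- Lets miss counts with a large sum be lowered to sum exactly `m`, so that the union bound runs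
over at most `2 ^ (n + m)` functions for each `U`. -/
theorem exists_le_sum_eq {ι : Type*} [DecidableEq ι] {s : Finset ι} {f : ι → ℕ} {m : ℕ}
    (h : m ≤ ∑ i ∈ s, f i) : ∃ g ∈ s.finsuppAntidiag m, ∀ i, g i ≤ f i := by
  induction m with
  | zero => exact ⟨0, by simp, fun i => Nat.zero_le _⟩
  | succ m ih =>
    obtain ⟨g, hg, hgf⟩ := ih (by omega)
    rw [mem_finsuppAntidiag] at hg
    obtain ⟨i, hi, hlt⟩ := exists_lt_of_sum_lt (s := s) (f := g) (g := f) (by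
      have := hg.1; rw [← this] at h; exact h)
    refine ⟨g + Finsupp.single i 1, ?_, fun i' => ?_⟩
    · rw [mem_finsuppAntidiag]
      refine ⟨?_, Finsupp.support_add.trans (union_subset hg.2
        (Finsupp.support_single_subset.trans (by simpa using hi)))⟩
      simp [sum_add_distrib, hg.1, Finsupp.single_apply, hi]
    · by_cases h : i = i'
      · subst h; simpa using hlt
      · simpa [Finsupp.single_apply, h] using hgf i'

theorem card_finsuppAntidiag_le (U : Finset (Fin n)) (m : ℕ) :
    (U.finsuppAntidiag m).card ≤ 2 ^ (n + m) := by
  rw [card_finsuppAntidiag_nat_eq_choose]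
  refine (Nat.choose_le_two_pow _ _).trans (Nat.pow_le_pow_right (by norm_num) ?_)
  have := U.card_le_univ
  rw [Fintype.card_fin] at this
  omega

/-- Either at least `m` vertices are undecided (event `A`), or both lists have at least `m` entries.
In the latter case a vertex left without a color has at least `m` misses by itself, and `totalMiss >
n` also gives at least `m` misses (event `B`). -/
theorem pr_not_decided_le (hw : Matched c w) (ht₁ : t ≤ t.choose (j + 1))
    (ht₂ : t ≤ t.choose (j + 2)) {m : ℕ} (hmn : m ≤ n)
    (hm : ∀ b, 2 * m + t ≤ (univ.filter fun u => c u = b).card) :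
    pr c (fun H : KGraph (j + 3) n => ¬(H.AllDecided (toGadget w) (extendColoring c) ∧
      H.totalMiss (toGadget w) (extendColoring c) ≤ n)) ≤ 2 * (2 ^ (2 * n + m) * (1 / 2) ^ (t * m)) := by
  classical
  set A : KGraph (j + 3) n → Prop := fun H => ∃ U ∈ univ.filter fun U : Finset (Fin n) =>
    m ≤ U.card ∧ ∀ v ∈ U, v ∉ Set.range w,
      ∀ v ∈ U, H.Undecided (toGadget w) (extendColoring c) v with hA
  set B : KGraph (j + 3) n → Prop := fun H => ∃ U ∈ (univ : Finset (Finset (Fin n))),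
    ∃ f ∈ U.finsuppAntidiag m, undecidedSet H c w = U ∧
      ∀ v ∈ U, f v ≤ H.missCount (toGadget w) (extendColoring c) v with hB
  have hcardU : ∀ I : Finset (Finset (Fin n)), (I.card : ℝ) ≤ 2 ^ n := fun I => by
    have := I.card_le_univ
    rw [Fintype.card_finset, Fintype.card_fin] at this
    exact_mod_cast this
  have hprA : pr c A ≤ 2 ^ (2 * n + m) * (1 / 2) ^ (t * m) := by
    refine (pr_exists_le_mul (p := (1 / 2) ^ (t * m)) fun U hU => ?_).trans
      ((mul_le_mul_of_nonneg_right (hcardU _) (by positivity)).trans ?_)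
    · simp only [mem_filter, mem_univ, true_and] at hU
      exact pr_undecided_le hw ht₂ hU.2 hU.1
    · gcongr
      · norm_num
      · omega
  have hprB : pr c B ≤ 2 ^ (2 * n + m) * (1 / 2) ^ (t * m) := by
    refine (pr_exists_le_mul (p := 2 ^ (n + m) * (1 / 2) ^ (t * m)) fun U _ => ?_).trans ?_
    · refine (pr_exists_le_mul (p := (1 / 2) ^ (t * m)) fun f hf => ?_).trans ?_
      · refine (pr_missCount_le ht₁).trans (le_of_eq ?_)
        rw [(mem_finsuppAntidiag.1 hf).1]
      · gcongr
        exact_mod_cast card_finsuppAntidiag_le U m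
    · rw [← mul_assoc]
      gcongr
      calc ((univ : Finset (Finset (Fin n))).card : ℝ) * 2 ^ (n + m) ≤ 2 ^ n * 2 ^ (n + m) := by
            gcongr
            exact hcardU _
        _ = 2 ^ (2 * n + m) := by rw [← pow_add]; congr 1; omega
  refine (pr_mono (B := fun H => A H ∨ B H) fun H hH h => ?_).trans
    ((pr_or_le c A B).trans (by linarith))
  by_cases hcard : m ≤ (undecidedSet H c w).card
  · refine Or.inl ⟨_, mem_filter.2 ⟨mem_univ _, hcard, ?_⟩, ?_⟩
    · exact fun v => notMem_range_of_mem_undecidedSet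
    · exact fun v => mem_undecidedSet.1
  · right
    suffices hs : m ≤ ∑ v ∈ undecidedSet H c w,
        H.missCount (toGadget w) (extendColoring c) v by
      obtain ⟨g, hg, hgf⟩ := exists_le_sum_eq hs
      exact ⟨_, mem_univ _, g, hg, rfl, fun v _ => hgf v⟩
    rw [not_and_or] at h
    rcases h with h | h
    · unfold AllDecided at h
      push Not at h
      obtain ⟨v, hv, hvU, hle⟩ := h
      have hmem : (⟨v, hv⟩ : Fin n) ∈ undecidedSet H c w := mem_undecidedSet.2 hvU
      refine le_trans ?_ (single_le_sum (f := fun v : Fin n =>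
        H.missCount (toGadget w) (extendColoring c) v) (fun _ _ => Nat.zero_le _) hmem)
      refine le_trans ?_ hle
      have := fun b => le_length_decidedList hw (hm b) (not_le.1 hcard).le
      rw [pairCount, decList_eq, decList_eq, List.length_map, List.length_map]
      exact le_min (this _) (this _)
    · refine hmn.trans ((not_le.1 h).le.trans (le_of_eq ?_))
      rw [totalMiss, sum_range, undecidedSet, sum_filter]

end KGraph

/-! ### The probability that there is no gadget -/

namespace KGraph

open Finset

variable {j n t : ℕ} {c : Fin n → Bool}

/-- The position of an index of a gadget in an enumeration of all indices. -/
def indexPos (p : Bool × Fin t) : ℕ := p.2 + p.1.toNat * t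

theorem indexPos_lt (p : Bool × Fin t) : indexPos p < 2 * t := by
  have := p.2.2
  unfold indexPos
  cases p.1 <;> simp only [Bool.toNat_false, Bool.toNat_true] <;> omega

theorem indexPos_injective : Function.Injective (indexPos (t := t)) := by
  rintro ⟨b, i⟩ ⟨b', i'⟩ h
  have h1 := i.2
  have h2 := i'.2
  unfold indexPos at h
  cases b <;> cases b' <;> simp only [Bool.toNat_false, Bool.toNat_true] at h <;>
    simp only [Prod.mk.injEq, Fin.ext_iff, true_and, reduceCtorEq, false_and] <;> omega

theorem mul_add_inj {q i i' r r' : ℕ} (hr : r < q) (hr' : r' < q)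
    (h : i * q + r = i' * q + r') : i = i' ∧ r = r' := by
  have hq : 0 < q := by omega
  have h1 : (i * q + r) / q = i := by
    rw [mul_comm, Nat.mul_add_div hq, Nat.div_eq_of_lt hr, add_zero]
  have h2 : (i' * q + r') / q = i' := by
    rw [mul_comm, Nat.mul_add_div hq, Nat.div_eq_of_lt hr', add_zero]
  have h3 : i = i' := by rw [← h1, ← h2, h]
  subst h3
  exact ⟨rfl, by omega⟩

variable {q L B : ℕ}

theorem line_lt (hq : 2 * t * L + B ≤ q) (l : Fin L × Fin B) (p : Bool × Fin t) :
    l.1 * indexPos p + l.2 < q := by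
  have h1 : (l.1 : ℕ) * indexPos p ≤ L * (2 * t) :=
    Nat.mul_le_mul l.1.2.le (indexPos_lt p).le
  have h2 := l.2.2
  have : L * (2 * t) = 2 * t * L := mul_comm _ _
  omega

theorem linePos_lt (hq : 2 * t * L + B ≤ q) (l : Fin L × Fin B) (p : Bool × Fin t) :
    p.2 * q + (l.1 * indexPos p + l.2) < t * q := by
  have h1 := line_lt hq l p
  have h2 : (p.2 + 1 : ℕ) * q ≤ t * q := Nat.mul_le_mul p.2.2 le_rfl
  rw [add_mul, one_mul] at h2
  omega

/-- A candidate for a gadget; two of these candidates have at most one common vertex. -/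
def line (α : ∀ b, Fin (t * q) ↪ {u // c u = b}) (hq : 2 * t * L + B ≤ q) (l : Fin L × Fin B) :
    Bool × Fin t ↪ Fin n :=
  ⟨fun p => α p.1 ⟨_, linePos_lt hq l p⟩, by
    rintro ⟨b, i⟩ ⟨b', i'⟩ h
    have hb : b = b' := by
      have h1 := (α b ⟨_, linePos_lt hq l (b, i)⟩).2
      have h2 := (α b' ⟨_, linePos_lt hq l (b', i')⟩).2
      rw [← h1, ← h2]
      exact congrArg c h
    subst hb
    have := (α b).injective (Subtype.ext h)
    rw [Fin.mk.injEq] at this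
    exact Prod.ext rfl (Fin.ext (mul_add_inj (line_lt hq l _) (line_lt hq l _) this).1)⟩

theorem matched_line (α : ∀ b, Fin (t * q) ↪ {u // c u = b}) (hq : 2 * t * L + B ≤ q)
    (l : Fin L × Fin B) : Matched c (line α hq l) := fun p => (α p.1 _).2

theorem line_eq_line {α : ∀ b, Fin (t * q) ↪ {u // c u = b}} {hq : 2 * t * L + B ≤ q}
    {l l' : Fin L × Fin B} {p p' : Bool × Fin t} (h : line α hq l p = line α hq l' p') :
    (l.1 * indexPos p + l.2 : ℕ) = l'.1 * indexPos p + l'.2 := by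
  obtain ⟨b, i⟩ := p
  obtain ⟨b', i'⟩ := p'
  have hb : b = b' := by
    have h1 := matched_line α hq l (b, i)
    have h2 := matched_line α hq l' (b', i')
    rw [h, h2] at h1
    exact h1.symm
  subst hb
  have := (α b).injective (Subtype.ext h)
  rw [Fin.mk.injEq] at this
  obtain ⟨h1, h2⟩ := mul_add_inj (line_lt hq l _) (line_lt hq l' _) this
  have h1 : i = i' := Fin.ext h1
  subst h1
  exact h2

/-- The candidates are lines given by a slope below `L` and an intercept below `B`. Two lines agree
in at most one position, so their gadget edges are disjoint and independent. Disjoint candidates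
would not suffice: there are at most `n / (2 * t)` of them. -/
theorem pr_no_gadget_le (hq : 2 * t * L + B ≤ q)
    (hc : ∀ b, t * q ≤ (univ.filter fun u => c u = b).card) :
    pr c (fun H : KGraph (j + 3) n => ¬∃ w : Bool × Fin t ↪ Fin n,
      Matched c w ∧ gadgetEdges j w ⊆ H.1) ≤
        (1 - (1 / 2) ^ (gadgetPattern j t).card) ^ (L * B) := by
  have hα : ∀ b, Nonempty (Fin (t * q) ↪ {u // c u = b}) := fun b =>
    Function.Embedding.nonempty_of_card_le (by
      rw [Fintype.card_fin, Fintype.card_subtype]; exact hc b)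
  let α := fun b => (hα b).some
  refine (pr_mono (B := fun H : KGraph (j + 3) n => ∀ l ∈ (univ : Finset (Fin L × Fin B)),
    ¬gadgetEdges j (line α hq l) ⊆ H.1) fun H _ h l _ hl =>
      h ⟨_, matched_line α hq l, hl⟩).trans ?_
  rw [pr_forall_not_subset (fun l _ => gadgetEdges_subset_crossing (matched_line α hq l))
    (fun l _ => card_gadgetEdges _)]
  · simp
  · intro l _ l' _ hll
    refine disjoint_gadgetEdges fun p p₁ p' p₁' h h₁ => ?_
    have e := line_eq_line h
    have e₁ := line_eq_line h₁
    by_contra hp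
    refine hll ?_
    have hs : (indexPos p : ℤ) ≠ indexPos p₁ := fun h => hp (indexPos_injective (by exact_mod_cast h))
    zify at e e₁
    -- The difference of the two incidences: equal slopes, hence equal lines, or equal positions.
    have hz : ((l.1 : ℕ) - (l'.1 : ℕ) : ℤ) * (indexPos p - indexPos p₁) = 0 := by linarith
    rcases mul_eq_zero.1 hz with h0 | h0
    · have h1 : ((l.1 : ℕ) : ℤ) = (l'.1 : ℕ) := by linarith
      rw [h1] at e
      refine Prod.ext (Fin.ext (by exact_mod_cast h1)) (Fin.ext ?_)
      have : ((l.2 : ℕ) : ℤ) = (l'.2 : ℕ) := by linarith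
      exact_mod_cast this
    · exact absurd (by linarith) hs

/-! ### The probability that the algorithm is slow -/

/-- There is a compatible gadget, and all compatible gadgets decide all vertices quickly. -/
def Good (t : ℕ) (c : Fin n → Bool) (H : KGraph (j + 3) n) : Prop :=
  (∃ w : Bool × Fin t ↪ Fin n, Matched c w ∧ H.IsGadget (toGadget w)) ∧ H.NiceFor t c

theorem pr_not_good_le (ht : j + 3 ≤ t) (ht₁ : t ≤ t.choose (j + 1))
    (ht₂ : t ≤ t.choose (j + 2)) {m : ℕ} (hmn : m ≤ n)
    (hm : ∀ b, 2 * m + t ≤ (univ.filter fun u => c u = b).card) (hq : 2 * t * L + B ≤ q)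
    (hc : ∀ b, t * q ≤ (univ.filter fun u => c u = b).card) :
    pr c (fun H : KGraph (j + 3) n => ¬Good t c H) ≤
      (1 - (1 / 2) ^ (gadgetPattern j t).card) ^ (L * B) +
        n ^ (2 * t) * (2 * (2 ^ (2 * n + m) * (1 / 2) ^ (t * m))) := by
  classical
  have key : ∀ H : KGraph (j + 3) n, ¬Good t c H →
      (¬∃ w : Bool × Fin t ↪ Fin n, Matched c w ∧ gadgetEdges j w ⊆ H.1) ∨
      ∃ w ∈ univ.filter fun w : Bool × Fin t ↪ Fin n => Matched c w,
        ¬(H.AllDecided (toGadget w) (extendColoring c) ∧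
          H.totalMiss (toGadget w) (extendColoring c) ≤ n) := by
    intro H h
    rw [Good, not_and_or] at h
    rcases h with h | h
    · exact Or.inl fun ⟨w, hw, hw'⟩ => h ⟨w, hw, isGadget_of_gadgetEdges_subset hw'⟩
    · right
      unfold NiceFor at h
      push Not at h
      obtain ⟨z, hz, hzc, h⟩ := h
      obtain ⟨w, rfl⟩ := hz.exists_embedding ht
      refine ⟨w, mem_filter.2 ⟨mem_univ _, fun p => ?_⟩, fun h' => absurd h'.2 (not_le.2 (h h'.1))⟩
      have := hzc p.1 p.2
      rwa [toGadget, extendColoring_val] at this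
  refine (pr_mono fun H _ => key H).trans ((pr_or_le _ _ _).trans
    (add_le_add (pr_no_gadget_le hq hc) ?_))
  refine (pr_exists_le_mul fun w hw => pr_not_decided_le (mem_filter.1 hw).2 ht₁ ht₂ hmn hm).trans ?_
  refine mul_le_mul_of_nonneg_right ?_ (by positivity)
  have h1 := (univ.filter fun w : Bool × Fin t ↪ Fin n => Matched c w).card_le_univ
  have h2 : Fintype.card (Bool × Fin t ↪ Fin n) ≤ n ^ (2 * t) := by
    rw [Fintype.card_embedding_eq, Fintype.card_fin, Fintype.card_prod, Fintype.card_bool,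
      Fintype.card_fin]
    exact Nat.descFactorial_le_pow _ _
  exact_mod_cast h1.trans h2

end KGraph

/-! ### The number of possible edges -/

namespace KGraph

open Finset

/-- The number of monochromatic `k`-sets if `a` of the `n` vertices have one of the colors. -/
def mono (k n a : ℕ) : ℕ := a.choose k + (n - a).choose k

theorem card_crossing_add {k n : ℕ} (hk : 1 ≤ k) (c : Fin n → Bool) :
    (crossing k c).card + mono k n (univ.filter fun u => c u = true).card = n.choose k := by
  classical
  have h1 : ((powersetCard k univ).filter fun e : Finset (Fin n) =>
      ¬∃ u ∈ e, ∃ v ∈ e, c u ≠ c v) = powersetCard k (univ.filter fun u => c u = true) ∪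
        powersetCard k (univ.filter fun u => c u = false) := by
    ext e
    simp only [mem_filter, mem_powersetCard, mem_union, not_exists, not_and, not_not, subset_iff,
      mem_univ, implies_true, true_and]
    constructor
    · rintro ⟨h, he⟩
      obtain ⟨u, hu⟩ := card_pos.1 (by omega : 0 < e.card)
      cases hc : c u
      · exact Or.inr ⟨fun v hv => by rw [he v hv u hu, hc], h⟩
      · exact Or.inl ⟨fun v hv => by rw [he v hv u hu, hc], h⟩
    · rintro (⟨he, h⟩ | ⟨he, h⟩)
      · exact ⟨h, fun u hu v hv => by rw [he hu, he hv]⟩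
      · exact ⟨h, fun u hu v hv => by rw [he hu, he hv]⟩
  have h2 : Disjoint (powersetCard k (univ.filter fun u => c u = true))
      (powersetCard k (univ.filter fun u => c u = false)) := by
    refine disjoint_left.2 fun e he he' => ?_
    rw [mem_powersetCard] at he he'
    obtain ⟨u, hu⟩ := card_pos.1 (by omega : 0 < e.card)
    have h1 := (mem_filter.1 (he.1 hu)).2
    have h2 := (mem_filter.1 (he'.1 hu)).2
    rw [h1] at h2
    cases h2
  have h3 : (univ.filter fun u => c u = false).card =
      n - (univ.filter fun u => c u = true).card := by
    have := card_filter_add_card_filter_not (s := (univ : Finset (Fin n))) (fun u => c u = true)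
    simp only [Bool.not_eq_true, card_univ, Fintype.card_fin] at this
    omega
  have h4 := card_filter_add_card_filter_not (s := powersetCard k (univ : Finset (Fin n)))
    (fun e => ∃ u ∈ e, ∃ v ∈ e, c u ≠ c v)
  rw [h1, card_union_of_disjoint h2, card_powersetCard, card_powersetCard, card_powersetCard,
    h3, card_univ, Fintype.card_fin] at h4
  exact h4

theorem mono_symm {k n a : ℕ} (ha : a ≤ n) : mono k n (n - a) = mono k n a := by
  rw [mono, mono, Nat.sub_sub_self ha, add_comm]

theorem mono_succ_le {k n a : ℕ} (ha : 2 * a + 1 ≤ n) :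
    mono (k + 1) n (a + 1) ≤ mono (k + 1) n a := by
  obtain ⟨d, rfl⟩ := Nat.exists_eq_add_of_le ha
  have h1 : 2 * a + 1 + d - (a + 1) = a + d := by omega
  have h2 : 2 * a + 1 + d - a = a + d + 1 := by omega
  rw [mono, mono, h1, h2, Nat.choose_succ_succ' a k, Nat.choose_succ_succ' (a + d) k]
  have := Nat.choose_le_choose k (Nat.le_add_right a d)
  omega

/-- By Pascal's rule, moving a vertex from the larger class to the smaller one loses `(n - a -
1).choose (k + 1)` monochromatic sets and creates `a.choose (k + 1)`. As `n - a - 1 ≥ a + 1`, the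
gain is at least `a.choose k`. -/
theorem mono_succ_add_le {k n a : ℕ} (ha : 2 * a + 2 ≤ n) :
    mono (k + 2) n (a + 1) + a.choose k ≤ mono (k + 2) n a := by
  change mono (k + 1 + 1) n (a + 1) + a.choose k ≤ mono (k + 1 + 1) n a
  obtain ⟨d, rfl⟩ := Nat.exists_eq_add_of_le ha
  have h1 : 2 * a + 2 + d - (a + 1) = a + d + 1 := by omega
  have h2 : 2 * a + 2 + d - a = a + d + 1 + 1 := by omega
  rw [mono, mono, h1, h2, Nat.choose_succ_succ' a (k + 1), Nat.choose_succ_succ' (a + d + 1) (k + 1)]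
  have h3 := Nat.choose_le_choose (k + 1) (by omega : a + 1 ≤ a + d + 1)
  rw [Nat.choose_succ_succ' a k] at h3
  omega

theorem mono_antitone {k n a b : ℕ} (hab : a ≤ b) (hb : 2 * b ≤ n + 1) :
    mono (k + 1) n b ≤ mono (k + 1) n a := by
  induction b, hab using Nat.le_induction with
  | base => exact le_rfl
  | succ b _ ih => exact (mono_succ_le (by omega)).trans (ih (by omega))

theorem le_choose {k a : ℕ} (hk : 1 ≤ k) (ha : k < a) : a ≤ a.choose k := by
  induction a, (show k + 1 ≤ a from ha) using Nat.le_induction with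
  | base => rw [Nat.choose_succ_self_right]
  | succ a ha' ih =>
    obtain ⟨k, rfl⟩ := Nat.exists_eq_add_of_le' hk
    rw [Nat.choose_succ_succ']
    have := ih ha'
    have : 0 < a.choose k := Nat.choose_pos (by omega)
    omega

theorem mono_add_le {k n p r : ℕ} (hp : k < p) (hk : 1 ≤ k) (hr : 2 * (p + r) ≤ n) :
    mono (k + 2) n (p + r) + r * p ≤ mono (k + 2) n p := by
  induction r with
  | zero => simp
  | succ r ih =>
    have h1 := ih (by omega)
    have h2 := mono_succ_add_le (k := k) (n := n) (a := p + r) (by omega)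
    have h3 : p + r ≤ (p + r).choose k := le_choose hk (by omega)
    rw [add_mul, one_mul, ← add_assoc p r 1]
    omega

/-- The maximum number of possible edges. -/
def maxCrossing (k n : ℕ) : ℕ := n.choose k - mono k n (n / 2)

/-- Both colors are used for at least a fourth of the vertices. -/
def Balanced {n : ℕ} (c : Fin n → Bool) : Prop :=
  ∀ b, n / 4 ≤ (univ.filter fun u => c u = b).card

theorem card_filter_false {n : ℕ} (c : Fin n → Bool) : (univ.filter fun u => c u = true).card +
    (univ.filter fun u => c u = false).card = n := by
  have := card_filter_add_card_filter_not (s := (univ : Finset (Fin n))) (fun u => c u = true)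
  simpa only [Bool.not_eq_true, card_univ, Fintype.card_fin] using this

theorem exists_mono_eq {n k : ℕ} (c : Fin n → Bool) : ∃ a, 2 * a ≤ n ∧
    mono k n (univ.filter fun u => c u = true).card = mono k n a ∧
      (¬Balanced c → a ≤ n / 4) := by
  have h := card_filter_false c
  have hB : ¬Balanced c → (univ.filter fun u => c u = true).card ≤ n / 4 ∨
      (univ.filter fun u => c u = false).card ≤ n / 4 := by
    intro hB
    unfold Balanced at hB
    push Not at hB
    obtain ⟨b, hb⟩ := hB
    cases b
    · exact Or.inr hb.le
    · exact Or.inl hb.le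
  by_cases ha : 2 * (univ.filter fun u => c u = true).card ≤ n
  · refine ⟨_, ha, rfl, fun h' => ?_⟩
    have := hB h'
    omega
  · refine ⟨n - (univ.filter fun u => c u = true).card, by omega,
      (mono_symm (by omega)).symm, fun h' => ?_⟩
    have := hB h'
    omega

theorem card_crossing_le {k n : ℕ} (hk : 1 ≤ k) (c : Fin n → Bool) :
    (crossing k c).card ≤ maxCrossing k n := by
  obtain ⟨a, ha, hac, -⟩ := exists_mono_eq (k := k) c
  have h1 := card_crossing_add hk c
  obtain ⟨k, rfl⟩ := Nat.exists_eq_add_of_le' hk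
  have h2 := mono_antitone (k := k) (n := n) (a := a) (b := n / 2) (by omega) (by omega)
  rw [maxCrossing]
  omega

theorem card_crossing_of_eq {k n : ℕ} (hk : 1 ≤ k) {c : Fin n → Bool}
    (hc : (univ.filter fun u => c u = true).card = n / 2) :
    (crossing k c).card = maxCrossing k n := by
  have h1 := card_crossing_add hk c
  rw [hc] at h1
  rw [maxCrossing]
  omega

/-- From class size `n / 4` to `n / 4 + n / 8`, each of the `n / 8` steps gains at least `n / 4`
edges; this quadratic gain exceeds `5 * n` for `n ≥ 200`. -/
theorem card_crossing_add_le {k n : ℕ} (hk : 3 ≤ k) (hn : 4 * k ≤ n) (hn' : 200 ≤ n)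
    {c : Fin n → Bool} (hc : ¬Balanced c) :
    (crossing k c).card + 5 * n ≤ maxCrossing k n := by
  obtain ⟨a, ha, hac, hac'⟩ := exists_mono_eq (k := k) c
  have h1 := card_crossing_add (k := k) (by omega) c
  obtain ⟨k, rfl⟩ := Nat.exists_eq_add_of_le' (by omega : 2 ≤ k)
  have h2 : mono (k + 2) n (n / 4) ≤ mono (k + 2) n a :=
    mono_antitone (k := k + 1) (hac' hc) (by omega)
  have h3 := mono_add_le (k := k) (n := n) (p := n / 4) (r := n / 8) (by omega) (by omega) (by omega)
  have h4 : mono (k + 2) n (n / 2) ≤ mono (k + 2) n (n / 4 + n / 8) :=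
    mono_antitone (k := k + 1) (by omega) (by omega)
  rw [maxCrossing]
  have h6 : n / 8 * (n / 4) ≥ 5 * n := by
    have h7 : 25 ≤ n / 8 := by omega
    have h8 : 2 * (n / 8) ≤ n / 4 := by omega
    have h9 : n / 8 * (2 * (n / 8)) ≤ n / 8 * (n / 4) := Nat.mul_le_mul le_rfl h8
    have h10 : 25 * (n / 8) ≤ n / 8 * (n / 8) := Nat.mul_le_mul h7 le_rfl
    have h11 : n / 8 * (2 * (n / 8)) = 2 * (n / 8 * (n / 8)) := by ring
    omega
  omega

end KGraph

/-! ### The number of `2`-colorable `k`-graphs -/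

namespace KGraph

open Finset

variable {j n t : ℕ} {H : KGraph (j + 3) n} {c c' : Fin n → Bool}

theorem Decided.color_eq {z : Bool → Fin t → ℕ} {col col' : ℕ → Bool} (hcol' : H.ProperOn col')
    (hz : ∀ b i, col' (z b i) = b) {v : ℕ} (h : H.Decided z col v) : col' v = col v := by
  simpa using hcol'.hit hz h.2

/-- The colors propagate from the gadget to the decided vertices, and from these, through the pair
hit behind `missCount < pairCount`, to all others. -/
theorem AllDecided.color_eq {z : Bool → Fin t → ℕ} {col col' : ℕ → Bool}
    (hA : H.AllDecided z col) (hz : ∀ b i, col (z b i) = b) (hcol' : H.ProperOn col')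
    (hz' : ∀ b i, col' (z b i) = b) {v : ℕ} (hv : v < n) : col' v = col v := by
  classical
  by_cases h1 : InGadget z v
  · obtain ⟨b, i, rfl⟩ := h1
    rw [hz, hz']
  by_cases h2 : H.Hit z (!col v) v
  · exact Decided.color_eq hcol' hz' ⟨h1, h2⟩
  have h3 := hA v hv ⟨h1, h2⟩
  have h4 : H.missCount z col v <
      ((H.decList z col (!col v) n).take (H.pairCount z col)).length := by
    rw [List.length_take, min_eq_left (pairCount_le _)]
    exact h3
  rw [missCount] at h4
  have h5 := List.findIdx_getElem (w := h4)
  rw [decide_eq_true_eq] at h5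
  have h6 := List.mem_of_mem_take (List.getElem_mem h4)
  simp only [decList, List.mem_filter, decide_eq_true_eq] at h6
  obtain ⟨-, h7, h8⟩ := h6
  have h9 := Decided.color_eq hcol' hz' h7
  have := hcol'.pairHit hz' (h9.trans h8) h5
  simpa using this

theorem Good.eq_or_eq_not (ht : j + 3 ≤ t) (h : Good t c H) (hc' : H.IsTwoColoring c') :
    c' = c ∨ c' = fun v => !c v := by
  obtain ⟨⟨w, hw, hg⟩, hN⟩ := h
  have hz : ∀ b i, extendColoring c (toGadget w b i) = b := fun b i => by
    rw [toGadget, extendColoring_val, hw]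
  have hA := (hN _ hg hz).1
  have hcol' := isTwoColoring_iff_properOn.1 hc'
  rcases hg.color ht hcol' with h | h
  · left
    funext v
    have := hA.color_eq hz hcol' h v.2
    simpa using this
  · right
    funext v
    have := hA.color_eq hz hcol'.not h v.2
    simp only [extendColoring_val] at this
    rw [← this, Bool.not_not]

open Classical in
/-- The number of `2`-colorable `k`-graphs. -/
noncomputable def numColorable (k n : ℕ) : ℕ :=
  (univ.filter fun H : KGraph k n => H.TwoColorable).card

open Classical in
-- Double counting: a hypergraph occurs for at most two colorings, by `Good.eq_or_eq_not`.
theorem sum_card_good_le (ht : j + 3 ≤ t) (C : Finset (Fin n → Bool)) :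
    ∑ c ∈ C, (univ.filter fun H : KGraph (j + 3) n => H.IsTwoColoring c ∧ Good t c H).card ≤
      2 * numColorable (j + 3) n := by
  have h1 : ∀ c ∈ C, (univ.filter fun H : KGraph (j + 3) n => H.IsTwoColoring c ∧ Good t c H).card =
      ∑ H ∈ univ.filter fun H : KGraph (j + 3) n => H.TwoColorable,
        if H.IsTwoColoring c ∧ Good t c H then 1 else 0 := by
    intro c _
    rw [sum_boole, filter_filter, Nat.cast_id]
    congr 1
    ext H
    simp only [mem_filter, mem_univ, true_and]
    exact ⟨fun h => ⟨⟨c, h.1⟩, h⟩, fun h => h.2⟩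
  rw [sum_congr rfl h1, sum_comm, mul_comm, numColorable, ← smul_eq_mul]
  refine sum_le_card_nsmul _ _ _ fun H _ => ?_
  rw [sum_boole, Nat.cast_id]
  by_cases hex : ∃ c, H.IsTwoColoring c ∧ Good t c H
  · obtain ⟨c, hc, hG⟩ := hex
    refine (card_le_card (t := {c, fun v => !c v}) ?_).trans card_le_two
    intro c' hc'
    have := hG.eq_or_eq_not ht (mem_filter.1 hc').2.1
    simpa using this
  · rw [filter_false_of_mem fun c _ h => hex ⟨c, h⟩]
    simp

theorem card_coloring (n a : ℕ) :
    (univ.filter fun c : Fin n → Bool => (univ.filter fun u => c u = true).card = a).card =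
      n.choose a := by
  classical
  rw [← card_fin n, ← card_powersetCard, card_fin]
  refine card_bij' (fun c _ => univ.filter fun u => c u = true) (fun s _ u => decide (u ∈ s))
    ?_ ?_ ?_ ?_
  · intro c hc
    simpa [mem_powersetCard] using hc
  · intro s hs
    simpa [mem_powersetCard] using hs
  · intro c _
    funext u
    simp
  · intro s _
    ext u
    simp

theorem two_pow_le_choose_middle (n : ℕ) : 2 ^ n ≤ (n + 1) * n.choose (n / 2) := by
  rw [← Nat.sum_range_choose, ← smul_eq_mul]
  refine (sum_le_card_nsmul _ _ _ fun i _ => Nat.choose_le_middle i n).trans ?_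
  rw [card_range]

/-- Only the colorings with `n / 2` vertices of color `true` are used. There are at least `2 ^ n /
(n + 1)` of them, each has the maximum number of possible edges, and at least half of its
hypergraphs are good. -/
theorem le_numColorable (ht : j + 3 ≤ t)
    (h : ∀ c : Fin n → Bool, Balanced c →
      pr c (fun H : KGraph (j + 3) n => ¬Good t c H) ≤ 1 / 2) :
    (2 : ℝ) ^ (n + maxCrossing (j + 3) n) ≤ 4 * (n + 1) * numColorable (j + 3) n := by
  classical
  set C := univ.filter fun c : Fin n → Bool => (univ.filter fun u => c u = true).card = n / 2
    with hC
  have h1 : ∀ c ∈ C, (2 : ℝ) ^ maxCrossing (j + 3) n / 2 ≤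
      ((univ.filter fun H : KGraph (j + 3) n => H.IsTwoColoring c ∧ Good t c H).card : ℝ) := by
    intro c hc
    have hc' := (mem_filter.1 hc).2
    rw [card_filter_eq_pr, card_crossing_of_eq (by omega) hc']
    have hB : Balanced c := by
      have := card_filter_false c
      intro b
      cases b <;> omega
    have := h c hB
    rw [pr_not] at this
    rw [div_eq_mul_inv]
    gcongr
    linarith
  have h2 : (C.card : ℝ) * ((2 : ℝ) ^ maxCrossing (j + 3) n / 2) ≤ 2 * numColorable (j + 3) n := by
    rw [← nsmul_eq_mul]
    refine (card_nsmul_le_sum _ _ _ h1).trans ?_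
    exact_mod_cast sum_card_good_le ht C
  have h3 : (2 : ℝ) ^ n ≤ (n + 1) * C.card := by
    rw [hC, card_coloring]
    exact_mod_cast two_pow_le_choose_middle n
  calc (2 : ℝ) ^ (n + maxCrossing (j + 3) n) = 2 ^ n * 2 ^ maxCrossing (j + 3) n := pow_add _ _ _
    _ ≤ (n + 1) * C.card * 2 ^ maxCrossing (j + 3) n := by gcongr
    _ = (n + 1) * 2 * (C.card * ((2 : ℝ) ^ maxCrossing (j + 3) n / 2)) := by ring
    _ ≤ (n + 1) * 2 * (2 * numColorable (j + 3) n) := by gcongr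
    _ = _ := by ring

open Classical in
/-- The `k`-graphs on which the algorithm may have to resort to an exhaustive search. -/
noncomputable def hardGraphs (j n t : ℕ) : Finset (KGraph (j + 3) n) :=
  univ.filter fun H => ∃ c : Fin n → Bool, H.IsTwoColoring c ∧ ¬Good t c H

theorem card_hardGraphs_le (hn : 4 * (j + 3) ≤ n) (hn' : 200 ≤ n)
    (h : ∀ c : Fin n → Bool, Balanced c →
      pr c (fun H : KGraph (j + 3) n => ¬Good t c H) ≤ (1 / 2) ^ (5 * n)) :
    ((hardGraphs j n t).card : ℝ) ≤
      2 ^ (n + maxCrossing (j + 3) n) * (1 / 2) ^ (5 * n) := by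
  classical
  have h1 : hardGraphs j n t ⊆ univ.biUnion fun c : Fin n → Bool =>
      univ.filter fun H : KGraph (j + 3) n => H.IsTwoColoring c ∧ ¬Good t c H := by
    intro H hH
    simpa [hardGraphs] using hH
  have h2 : ((hardGraphs j n t).card : ℝ) ≤ ∑ c : Fin n → Bool,
      ((univ.filter fun H : KGraph (j + 3) n => H.IsTwoColoring c ∧ ¬Good t c H).card : ℝ) := by
    exact_mod_cast (card_le_card h1).trans card_biUnion_le
  refine h2.trans ((sum_le_card_nsmul _ _ (2 ^ maxCrossing (j + 3) n * (1 / 2) ^ (5 * n))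
    fun c _ => ?_).trans (le_of_eq ?_))
  · rw [card_filter_eq_pr]
    by_cases hc : Balanced c
    · gcongr
      · exact pr_nonneg _ _
      · norm_num
      · exact card_crossing_le (by omega) c
      · exact h c hc
    -- For unbalanced `c` the probability is bounded by `1`; the factor `2 ^ (-5 * n)` comes from
    -- the missing `5 * n` possible edges.
    · obtain ⟨d, hd⟩ := Nat.exists_eq_add_of_le (card_crossing_add_le (by omega) hn hn' hc)
      rw [hd, add_assoc, pow_add, pow_add, mul_assoc]
      refine mul_le_mul_of_nonneg_left ((pr_le_one _ _).trans ?_) (by positivity)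
      rw [mul_right_comm, ← mul_pow]
      norm_num
      exact one_le_pow₀ (by norm_num)
  · rw [card_univ, Fintype.card_pi, prod_const, Fintype.card_bool, card_univ, Fintype.card_fin,
      nsmul_eq_mul, pow_add, mul_assoc]
    push_cast
    rfl

end KGraph

/-! ### Gadgets with consecutive vertices -/

namespace KGraph

open Finset
open scoped BigOperators

variable {j n t m : ℕ} {c : Fin n → Bool}

theorem consec_lt (p : Bool × Fin t) : 2 * p.2 + p.1.toNat < 2 * t := by
  have := p.2.2
  cases p.1 <;> simp only [Bool.toNat_false, Bool.toNat_true] <;> omega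

/-- The block number `i` of consecutive vertices. -/
def block (hm : 2 * t * m ≤ n) (i : Fin m) : Bool × Fin t ↪ Fin n :=
  ⟨fun p => ⟨i * (2 * t) + (2 * p.2 + p.1.toNat), by
    have h1 := consec_lt p
    have h2 : (i + 1 : ℕ) * (2 * t) ≤ m * (2 * t) := Nat.mul_le_mul i.2 le_rfl
    rw [add_mul, one_mul, mul_comm m] at h2
    omega⟩, by
    rintro ⟨b, x⟩ ⟨b', x'⟩ h
    rw [Fin.mk.injEq] at h
    cases b <;> cases b' <;> simp only [Bool.toNat_false, Bool.toNat_true] at h <;>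
      simp only [Prod.mk.injEq, Fin.ext_iff, true_and, reduceCtorEq, false_and] <;> omega⟩

theorem val_block (hm : 2 * t * m ≤ n) (i : Fin m) (p : Bool × Fin t) :
    (block hm i p : ℕ) = i * (2 * t) + (2 * p.2 + p.1.toNat) := rfl

theorem toGadget_block (hm : 2 * t * m ≤ n) (i : Fin m) :
    toGadget (block hm i) = consec t (i * (2 * t)) := by
  funext b x
  simp only [toGadget, val_block, consec]
  omega

/-- Blocks start at even numbers and alternate between the groups, so the label of a vertex is its
parity and a match is a fixed pattern of bits of `c`. -/
theorem matched_block_iff (hm : 2 * t * m ≤ n) (i : Fin m) : Matched c (block hm i) ↔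
    ∀ v ∈ univ.map (block hm i), c v = decide ((v : ℕ) % 2 = 1) := by
  simp only [mem_map, mem_univ, true_and, forall_exists_index, forall_apply_eq_imp_iff, Matched]
  refine forall_congr' fun p => ?_
  have : decide ((block hm i p : ℕ) % 2 = 1) = p.1 := by
    have h : (block hm i p : ℕ) = 2 * (i * t + p.2) + p.1.toNat := by
      rw [val_block]
      ring
    rw [h]
    cases p.1 <;> simp [Nat.add_mod]
  rw [this]

theorem block_eq_block {hm : 2 * t * m ≤ n} {i i' : Fin m} {p p' : Bool × Fin t}
    (h : block hm i p = block hm i' p') : i = i' := by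
  rw [Fin.ext_iff, val_block, val_block] at h
  exact Fin.ext (mul_add_inj (consec_lt p) (consec_lt p') h).1

open Classical in
theorem expect_matched_block (hm : 2 * t * m ≤ n) (ε : ℝ) :
    𝔼 c : Fin n → Bool, ∏ i : Fin m, (if Matched c (block hm i) then 1 - ε else 1) =
      (1 - ε * (1 / 2) ^ (2 * t)) ^ m := by
  rw [expect_prod_of_indep univ (fun i => univ.map (block hm i))
    fun i c => if Matched c (block hm i) then 1 - ε else 1]
  · rw [prod_congr rfl (g := fun _ => 1 - ε * (1 / 2) ^ (2 * t)), prod_const, card_univ,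
      Fintype.card_fin]
    intro i _
    have h1 : ((1 : ℝ) / 2) ^ (2 * t) = 𝔼 c : Fin n → Bool,
        if Matched c (block hm i) then (1 : ℝ) else 0 := by
      have := expect_pattern (univ.map (block hm i)) fun v => decide ((v : ℕ) % 2 = 1)
      rw [card_map, card_univ, Fintype.card_prod, Fintype.card_bool, Fintype.card_fin] at this
      rw [← this]
      refine expect_congr rfl fun c _ => ?_
      by_cases h : Matched c (block hm i)
      · rw [if_pos h, if_pos ((matched_block_iff hm i).1 h)]
      · rw [if_neg h, if_neg fun h' => h ((matched_block_iff hm i).2 h')]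
    rw [h1, mul_expect, eq_sub_iff_add_eq, ← expect_add_distrib,
      expect_congr rfl (g := fun _ => (1 : ℝ)), Fintype.expect_const]
    intro c _
    split_ifs <;> ring
  · intro i _ i' _ hne
    refine disjoint_left.2 fun v hv hv' => hne ?_
    obtain ⟨p, -, rfl⟩ := mem_map.1 hv
    obtain ⟨p', -, h⟩ := mem_map.1 hv'
    exact (block_eq_block h).symm
  · intro i _ c c' h
    simp only [matched_block_iff]
    congr 1
    exact propext (forall₂_congr fun v hv => by rw [h v hv])

theorem pr_no_block_le (hm : 2 * t * m ≤ n) (c : Fin n → Bool) [DecidablePred (Matched (t := t) c)] :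
    pr c (fun H : KGraph (j + 3) n => ∀ i : Fin m, ¬gadgetEdges j (block hm i) ⊆ H.1) ≤
      ∏ i : Fin m, (if Matched c (block hm i) then
        1 - (1 / 2) ^ (gadgetPattern j t).card else (1 : ℝ)) := by
  rw [prod_ite, prod_const, prod_const_one, mul_one,
    ← pr_forall_not_subset (c := c) (k := j + 3) (T := fun i => gadgetEdges j (block hm i))]
  · exact pr_mono fun H _ h i _ => h i
  · exact fun i hi => gadgetEdges_subset_crossing (mem_filter.1 hi).2
  · exact fun i _ => card_gadgetEdges _
  · intro i _ i' _ hne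
    refine disjoint_gadgetEdges fun p q p' q' h _ => absurd (block_eq_block h) hne

open Classical in
/-- The `2`-colorable `k`-graphs without a gadget of consecutive vertices. -/
noncomputable def blockFree (j n t : ℕ) : Finset (KGraph (j + 3) n) :=
  univ.filter fun H => H.TwoColorable ∧ ¬∃ b, b < n - (2 * t - 1) ∧ H.IsGadget (consec t b)

/-- The estimate uses the average over `c`, since a given `c` may match no block at all. For random
`c` the disjoint blocks behave independently, and each is a matched gadget with probability `2 ^ (-2
* t)` times that of its edges. -/
theorem card_blockFree_le (ht : 0 < t) (hm : 2 * t * m ≤ n) :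
    ((blockFree j n t).card : ℝ) ≤ 2 ^ (n + maxCrossing (j + 3) n) *
      (1 - (1 / 2) ^ (gadgetPattern j t).card * (1 / 2) ^ (2 * t)) ^ m := by
  classical
  have h1 : blockFree j n t ⊆ univ.biUnion fun c : Fin n → Bool =>
      univ.filter fun H : KGraph (j + 3) n => H.IsTwoColoring c ∧
        ∀ i : Fin m, ¬gadgetEdges j (block hm i) ⊆ H.1 := by
    intro H hH
    obtain ⟨⟨c, hc⟩, h⟩ := (mem_filter.1 hH).2
    refine mem_biUnion.2 ⟨c, mem_univ _, mem_filter.2 ⟨mem_univ _, hc, fun i hi => h ?_⟩⟩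
    refine ⟨i * (2 * t), ?_, by
      rw [← toGadget_block hm]; exact isGadget_of_gadgetEdges_subset hi⟩
    have h2 : (i + 1 : ℕ) * (2 * t) ≤ m * (2 * t) := Nat.mul_le_mul i.2 le_rfl
    rw [add_mul, one_mul, mul_comm m] at h2
    omega
  have h2 : ((blockFree j n t).card : ℝ) ≤ ∑ c : Fin n → Bool,
      ((univ.filter fun H : KGraph (j + 3) n => H.IsTwoColoring c ∧
        ∀ i : Fin m, ¬gadgetEdges j (block hm i) ⊆ H.1).card : ℝ) := by
    exact_mod_cast (card_le_card h1).trans card_biUnion_le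
  rw [← expect_matched_block hm, Fintype.expect_eq_sum_div_card, Fintype.card_pi, prod_const,
    Fintype.card_bool, card_univ, Fintype.card_fin, pow_add, Nat.cast_pow, Nat.cast_ofNat]
  have h3 : ∀ x : ℝ, (2 : ℝ) ^ n * 2 ^ maxCrossing (j + 3) n * (x / 2 ^ n) =
      2 ^ maxCrossing (j + 3) n * x := fun x => by field_simp
  rw [h3, mul_sum]
  refine h2.trans (sum_le_sum fun c _ => ?_)
  rw [card_filter_eq_pr]
  gcongr
  · exact pr_nonneg _ _
  · norm_num
  · exact card_crossing_le (by omega) c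
  · exact pr_no_block_le hm c

end KGraph

/-! ### Large numbers of vertices -/

namespace KGraph

open Finset Filter

theorem eventually_pow_mul_le {r : ℝ} (hr : 0 ≤ r) (hr' : r < 1) (C : ℝ) (d : ℕ) :
    ∀ᶠ n : ℕ in atTop, C * (n : ℝ) ^ d * r ^ n ≤ 1 := by
  have h := (tendsto_pow_const_mul_const_pow_of_abs_lt_one d
    (by rwa [abs_of_nonneg hr] : |r| < 1)).const_mul C
  rw [mul_zero] at h
  filter_upwards [h.eventually_le_const one_pos] with n hn
  rwa [mul_assoc]

variable {j : ℕ}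

theorem eventually_pr_not_good_le (j : ℕ) : ∀ᶠ n : ℕ in atTop, ∀ c : Fin n → Bool, Balanced c →
    pr c (fun H : KGraph (j + 3) n => ¬Good (j + 320) c H) ≤ (1 / 2) ^ (5 * n) := by
  obtain ⟨t, ht⟩ : ∃ t, t = j + 320 := ⟨_, rfl⟩
  rw [← ht]
  set δ : ℝ := 1 - (1 / 2) ^ (gadgetPattern j t).card with hδ
  have hδ0 : 0 ≤ δ := sub_nonneg.2 (pow_le_one₀ (by norm_num) (by norm_num))
  have hδ1 : δ < 1 := sub_lt_self _ (by positivity)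
  -- Since `n ≤ 16 * t * B` below, the exponent `96 * t` yields `δ ^ (L * B) ≤ 2 ^ (-6 * n)`. The
  -- number `L` of slopes does not depend on `n`.
  obtain ⟨L, hL⟩ := exists_pow_lt_of_lt_one (y := δ) (by positivity : (0 : ℝ) < (1 / 2) ^ (96 * t)) hδ1
  filter_upwards [eventually_pow_mul_le (r := 1 / 2) (by norm_num) (by norm_num) 1 (2 * t),
    eventually_ge_atTop (64 * t + 1000 + 64 * t * (t * L))] with n hn1 hn2 c hc
  set q := n / 4 / t with hq
  set B := q - 2 * t * L with hB
  have hn3 : 64 * t + 1000 ≤ n := le_trans (Nat.le_add_right _ _) hn2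
  have hqt : t * q ≤ n / 4 := Nat.mul_div_le _ _
  have hqt' : n / 4 < t * q + t := by
    have := Nat.lt_div_mul_add (a := n / 4) (b := t) (by omega)
    rwa [mul_comm] at this
  have hBn : n ≤ 16 * t * B := by
    have h1 : 16 * t * B + 16 * t * (2 * t * L) ≥ 16 * t * q := by
      rw [← mul_add]
      exact Nat.mul_le_mul le_rfl (by omega)
    have h2 : 16 * t * q = 16 * (t * q) := by ring
    have h3 : 16 * t * (2 * t * L) = 32 * (t * (t * L)) := by ring
    have h4 : 64 * t * (t * L) = 64 * (t * (t * L)) := by ring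
    omega
  have hLq : 2 * t * L + B ≤ q := by
    have : 0 < B := by
      by_contra h
      rw [Nat.eq_zero_of_not_pos h] at hBn
      omega
    omega
  -- With `m = n / 16`, the exponent `t * m` is about `20 * n` or more and exceeds the required `9 *
  -- n + 1 + m`: `2 * n + m + 1` for the union bounds, `n` for `n ^ (2 * t)` embeddings, and `6 * n`
  -- to spare.
  have htm : 320 * (n / 16) ≤ t * (n / 16) := Nat.mul_le_mul (by omega) le_rfl
  refine (pr_not_good_le (m := n / 16) (q := q) (L := L) (B := B) (by omega)
    (le_choose (by omega) (by omega)) (le_choose (by omega) (by omega)) (by omega)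
    (fun b => le_trans (by omega) (hc b)) hLq (fun b => hqt.trans (hc b))).trans ?_
  have h1 : δ ^ (L * B) ≤ (1 / 2) ^ (6 * n) := by
    rw [pow_mul]
    refine (pow_le_pow_left₀ (pow_nonneg hδ0 _) hL.le B).trans ?_
    rw [← pow_mul]
    refine pow_le_pow_of_le_one (by norm_num) (by norm_num) ?_
    have : 96 * t * B = 6 * (16 * t * B) := by ring
    omega
  have h2 : (n : ℝ) ^ (2 * t) ≤ 2 ^ n := by
    rw [one_mul, one_div, inv_pow, ← div_eq_mul_inv, div_le_one (by positivity)] at hn1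
    exact hn1
  have h3 : (n : ℝ) ^ (2 * t) * (2 * (2 ^ (2 * n + n / 16) * (1 / 2) ^ (t * (n / 16)))) ≤
      (1 / 2) ^ (6 * n) := by
    have h4 : ((1 : ℝ) / 2) ^ (t * (n / 16)) ≤ (1 / 2) ^ (9 * n + 1 + n / 16) :=
      pow_le_pow_of_le_one (by norm_num) (by norm_num) (by omega)
    calc (n : ℝ) ^ (2 * t) * (2 * (2 ^ (2 * n + n / 16) * (1 / 2) ^ (t * (n / 16))))
        ≤ 2 ^ n * (2 * (2 ^ (2 * n + n / 16) * (1 / 2) ^ (9 * n + 1 + n / 16))) := by gcongr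
      _ = (2 ^ (3 * n + 1 + n / 16) * (1 / 2) ^ (3 * n + 1 + n / 16)) * (1 / 2) ^ (6 * n) := by
          rw [mul_assoc, ← pow_add]
          have e1 : 3 * n + 1 + n / 16 + 6 * n = 9 * n + 1 + n / 16 := by ring
          have e2 : 3 * n + 1 + n / 16 = n + (2 * n + n / 16) + 1 := by ring
          rw [e1, e2, pow_succ (2 : ℝ), pow_add (2 : ℝ) n]
          ring
      _ = (1 / 2) ^ (6 * n) := by
          rw [← mul_pow]
          norm_num
  refine (add_le_add h1 h3).trans ?_
  have : ((1 : ℝ) / 2) ^ (6 * n) ≤ (1 / 2) ^ (5 * n + 1) :=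
    pow_le_pow_of_le_one (by norm_num) (by norm_num) (by omega)
  rw [pow_succ] at this
  linarith

/-! ### The average running time -/

end KGraph

/-! ### The average running time -/

/-- Functions that are bounded by a polynomial. -/
def PolyBounded (f : ℕ → ℕ) : Prop := ∃ C d, ∀ n, f n ≤ C * (n + 1) ^ d

namespace PolyBounded

variable {f g : ℕ → ℕ}

theorem const (C : ℕ) : PolyBounded fun _ => C := ⟨C, 0, fun n => by simp⟩

theorem id : PolyBounded fun n => n := ⟨1, 1, fun n => by simp⟩

theorem add (hf : PolyBounded f) (hg : PolyBounded g) : PolyBounded fun n => f n + g n := by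
  obtain ⟨C, d, hf⟩ := hf
  obtain ⟨C', d', hg⟩ := hg
  refine ⟨C + C', d + d', fun n => ?_⟩
  rw [add_mul]
  refine add_le_add ((hf n).trans ?_) ((hg n).trans ?_) <;>
    exact Nat.mul_le_mul le_rfl (Nat.pow_le_pow_right n.succ_pos (by omega))

theorem mul (hf : PolyBounded f) (hg : PolyBounded g) : PolyBounded fun n => f n * g n := by
  obtain ⟨C, d, hf⟩ := hf
  obtain ⟨C', d', hg⟩ := hg
  refine ⟨C * C', d + d', fun n => (Nat.mul_le_mul (hf n) (hg n)).trans (le_of_eq ?_)⟩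
  rw [pow_add]
  ring

theorem pow (hf : PolyBounded f) (e : ℕ) : PolyBounded fun n => f n ^ e := by
  obtain ⟨C, d, hf⟩ := hf
  refine ⟨C ^ e, d * e, fun n => (Nat.pow_le_pow_left (hf n) e).trans (le_of_eq ?_)⟩
  rw [mul_pow, pow_mul]

open Filter in
theorem eventually_mul_pow_div_le (hf : PolyBounded f) {r : ℝ} (hr : 0 ≤ r) (hr' : r < 1) {s : ℕ}
    (hs : 0 < s) : ∀ᶠ n : ℕ in atTop, (f n : ℝ) * r ^ (n / s) ≤ 1 := by
  obtain ⟨C, d, hf⟩ := hf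
  have h1 := KGraph.eventually_pow_mul_le hr hr' (C * (2 * s) ^ d : ℝ) d
  filter_upwards [(Nat.tendsto_div_const_atTop hs.ne').eventually h1, eventually_ge_atTop s]
    with n hn hns
  refine le_trans ?_ hn
  gcongr
  -- Turns a polynomial in `n` into one in `n / s`, the exponent of `r`.
  have h2 : n + 1 ≤ 2 * s * (n / s) := by
    have h3 := Nat.lt_div_mul_add (a := n) hs
    have h4 : 1 ≤ n / s := (Nat.one_le_div_iff hs).2 hns
    have h5 : s * 1 ≤ s * (n / s) := Nat.mul_le_mul le_rfl h4
    have h6 : 2 * s * (n / s) = 2 * (s * (n / s)) := by ring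
    rw [mul_comm] at h3
    omega
  rw [mul_assoc, ← mul_pow]
  calc (f n : ℝ) ≤ ((C * (n + 1) ^ d : ℕ) : ℝ) := by exact_mod_cast hf n
    _ ≤ ((C * (2 * s * (n / s)) ^ d : ℕ) : ℝ) := by gcongr
    _ = _ := by push_cast; rfl

end PolyBounded

namespace RAMProg

open KGraph Finset

variable {k j n t : ℕ}

instance [NeZero n] : IsProbabilityMeasure (randomSource n) := by
  unfold randomSource
  infer_instance

theorem expectedTime_le [NeZero n] {P : RAMProg k} {H : KGraph k n} {T : ℕ} {Q : RAMState → Prop}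
    (h : Wp H P (P.start n).2 T Q) : P.expectedTime H ≤ T := by
  obtain ⟨-, -, h, -⟩ := h.run
  refine (lintegral_mono h).trans ?_
  rw [lintegral_const, measure_univ, mul_one]

open Classical in
theorem averageTime_le [NeZero n] {P : RAMProg k} {τ : KGraph k n → ℕ} {M : ℕ}
    (h : ∀ H : KGraph k n, H.TwoColorable → P.expectedTime H ≤ τ H)
    (hτ : ∑ H ∈ univ.filter fun H : KGraph k n => H.TwoColorable, τ H ≤ M * numColorable k n) :
    P.averageTime n ≤ M := by
  refine ENNReal.div_le_of_le_mul ?_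
  calc ∑ H : {H : KGraph k n // H.TwoColorable}, P.expectedTime H.1
      ≤ ∑ H : {H : KGraph k n // H.TwoColorable}, (τ H.1 : ℝ≥0∞) :=
        sum_le_sum fun H _ => h H.1 H.2
    _ = ((∑ H ∈ univ.filter fun H : KGraph k n => H.TwoColorable, τ H : ℕ) : ℝ≥0∞) := by
        rw [Nat.cast_sum]
        exact (sum_subtype _ (by simp) fun H => (τ H : ℝ≥0∞)).symm
    _ ≤ ((M * numColorable k n : ℕ) : ℝ≥0∞) := by exact_mod_cast hτ
    _ = _ := by
        rw [Nat.cast_mul, numColorable, Fintype.card_subtype]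

theorem exists_properOn {H : KGraph (j + 3) n} (hH : H.TwoColorable) : ∃ col, H.ProperOn col := by
  obtain ⟨c, hc⟩ := hH
  exact ⟨_, isTwoColoring_iff_properOn.1 hc⟩

theorem isTwoColoringAlgorithm_twoColoring (ht : j + 3 ≤ t) :
    (twoColoring j t).IsTwoColoringAlgorithm := by
  intro n _ H hH
  obtain ⟨σ, ⟨col, hcol, hσ⟩, -, hhalt, hout⟩ := (wp_twoColoring ht (exists_properOn hH)).run
  refine ⟨.of_forall fun ω => ⟨_, hhalt ω⟩, fun ω s hs => ⟨fun v => col v, ?_, fun v => ?_⟩⟩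
  · refine isTwoColoring_iff_properOn.2 (hcol.congr fun v hv => ?_)
    simp [extendColoring, hv]
  · rw [hout ω s hs, hσ v v.2]

/-- A bound for the running time on typical inputs. -/
noncomputable def fastTime (j t n : ℕ) : ℕ :=
  4 * t + 8 + n * (tryTime j t 0 + 4 * t + 3) + extendConst j t * (n + n + 1)

/-- A bound for the running time on all inputs. -/
noncomputable def worstTime (j t n : ℕ) : ℕ :=
  gadgetTime j t n + 2 ^ n * (n + 3) ^ (j + 3) * (9 * j + 150)

theorem fastTime_le (hn : 1 ≤ n) : fastTime j t n ≤
    (4 * t + 8 + (tryTime j t 0 + 4 * t + 3) + extendConst j t * 3) * n := by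
  have h1 : 4 * t + 8 ≤ (4 * t + 8) * n := Nat.le_mul_of_pos_right _ hn
  have h2 : extendConst j t * (n + n + 1) ≤ extendConst j t * (3 * n) :=
    Nat.mul_le_mul le_rfl (by omega)
  rw [fastTime, add_mul, add_mul, mul_assoc (extendConst j t), mul_comm n]
  omega

theorem polyBounded_gadgetTime : PolyBounded (gadgetTime j t) := by
  have h : PolyBounded fun n => tryTime j t (n + n * n + 1) :=
    (PolyBounded.const _).add ((PolyBounded.const _).mul
      ((PolyBounded.id.add (PolyBounded.id.mul PolyBounded.id)).add (PolyBounded.const 1)))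
  exact ((PolyBounded.const _).add (PolyBounded.id.mul
    ((h.add (PolyBounded.const _)).add (PolyBounded.const _)))).add
      ((h.add (PolyBounded.const _)).mul ((PolyBounded.id.add (PolyBounded.const _)).pow _))

open Classical in
-- Outside `hardGraphs` every coloring is good, so the hypergraph is nice and has a gadget; outside
-- `blockFree` some window is a gadget.
theorem expectedTime_twoColoring_le [NeZero n] (ht : j + 3 ≤ t) {H : KGraph (j + 3) n}
    (hH : H.TwoColorable) : (twoColoring j t).expectedTime H ≤
      ((fastTime j t n + (if H ∈ blockFree j n t then gadgetTime j t n else 0) +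
        if H ∈ hardGraphs j n t then worstTime j t n else 0 : ℕ) : ℝ≥0∞) := by
  by_cases h1 : H ∈ hardGraphs j n t
  · rw [if_pos h1]
    exact (expectedTime_le (wp_twoColoring ht (exists_properOn hH))).trans
      (by exact_mod_cast Nat.le_add_left _ _)
  have hgood : ∀ c : Fin n → Bool, H.IsTwoColoring c → Good t c H := fun c hc => by
    by_contra hG
    exact h1 (mem_filter.2 ⟨mem_univ _, c, hc, hG⟩)
  have hN : H.Nice t := fun c hc => (hgood c hc).2
  rw [if_neg h1, add_zero]
  by_cases h2 : H ∈ blockFree j n t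
  · rw [if_pos h2]
    obtain ⟨c, hc⟩ := id hH
    obtain ⟨⟨w, -, hw⟩, -⟩ := hgood c hc
    exact (expectedTime_le (wp_twoColoring_medium ht (exists_properOn hH) hN ⟨_, hw⟩)).trans
      (by exact_mod_cast Nat.le_add_left _ _)
  · rw [if_neg h2, add_zero]
    refine expectedTime_le (wp_twoColoring_fast ht (exists_properOn hH) hN ?_)
    by_contra h
    exact h2 (mem_filter.2 ⟨mem_univ _, hH, h⟩)

open Classical in
theorem sum_time_le (M₀ M₁ M₂ : ℕ) :
    ∑ H ∈ univ.filter fun H : KGraph (j + 3) n => H.TwoColorable,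
      (M₀ + (if H ∈ blockFree j n t then M₁ else 0) + if H ∈ hardGraphs j n t then M₂ else 0) ≤
    numColorable (j + 3) n * M₀ + (blockFree j n t).card * M₁ + (hardGraphs j n t).card * M₂ := by
  have h : ∀ (S : Finset (KGraph (j + 3) n)) (M : ℕ),
      ∑ H ∈ univ.filter fun H : KGraph (j + 3) n => H.TwoColorable, (if H ∈ S then M else 0) ≤
        S.card * M := fun S M => by
    rw [← sum_filter, sum_const, smul_eq_mul]
    exact Nat.mul_le_mul (card_le_card fun H hH => (mem_filter.1 hH).2) le_rfl
  rw [sum_add_distrib, sum_add_distrib, sum_const, smul_eq_mul]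
  exact add_le_add (add_le_add le_rfl (h _ _)) (h _ _)

open Filter in
theorem eventually_averageTime_le (j : ℕ) : ∃ C : ℕ, ∀ᶠ n : ℕ in atTop, ∀ [NeZero n],
    (twoColoring j (j + 320)).averageTime n ≤ (C * n : ℕ) := by
  have hgood := eventually_pr_not_good_le j
  obtain ⟨t, ht⟩ : ∃ t, t = j + 320 := ⟨_, rfl⟩
  rw [← ht] at hgood ⊢
  set ρ : ℝ := 1 - (1 / 2) ^ (gadgetPattern j t).card * (1 / 2) ^ (2 * t) with hρ
  have hρ0 : 0 ≤ ρ := by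
    rw [hρ, ← pow_add]
    exact sub_nonneg.2 (pow_le_one₀ (by norm_num) (by norm_num))
  have hρ1 : ρ < 1 := sub_lt_self _ (by positivity)
  have hlin : PolyBounded fun n => 4 * (n + 1) :=
    (PolyBounded.const 4).mul (PolyBounded.id.add (PolyBounded.const 1))
  have h1 := (hlin.mul (polyBounded_gadgetTime (j := j) (t := t))).eventually_mul_pow_div_le
    hρ0 hρ1 (s := 2 * t) (by omega)
  have h2 := (hlin.mul ((polyBounded_gadgetTime (j := j) (t := t)).add
    (((PolyBounded.id.add (PolyBounded.const 3)).pow (j + 3)).mul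
      (PolyBounded.const (9 * j + 150))))).eventually_mul_pow_div_le
        (r := 1 / 2) (by norm_num) (by norm_num) one_pos
  -- All but the last summand come from `fastTime_le`. The two exceptional classes each contribute
  -- at most `1` to the average, hence the `2`.
  refine ⟨4 * t + 8 + (tryTime j t 0 + 4 * t + 3) + extendConst j t * 3 + 2, ?_⟩
  filter_upwards [hgood, h1, h2, eventually_ge_atTop (4 * (j + 3) + 200)] with n hgood h1 h2 hn _
  have hN := le_numColorable (n := n) (j := j) (t := t) (by omega) fun c hc =>
    (hgood c hc).trans ((pow_le_pow_of_le_one (by norm_num) (by norm_num)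
      (by omega : 1 ≤ 5 * n)).trans (by norm_num))
  have hA : (blockFree j n t).card * gadgetTime j t n ≤ numColorable (j + 3) n := by
    have h := card_blockFree_le (j := j) (n := n) (t := t) (m := n / (2 * t)) (by omega)
      (Nat.mul_div_le _ _)
    rw [← hρ] at h
    have : ((blockFree j n t).card : ℝ) * gadgetTime j t n ≤ numColorable (j + 3) n := by
      calc ((blockFree j n t).card : ℝ) * gadgetTime j t n
          ≤ (4 * (n + 1) * numColorable (j + 3) n * ρ ^ (n / (2 * t))) * gadgetTime j t n := by
            refine mul_le_mul_of_nonneg_right (h.trans ?_) (by positivity)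
            exact mul_le_mul_of_nonneg_right hN (by positivity)
        _ = numColorable (j + 3) n *
              (((4 * (n + 1) * gadgetTime j t n : ℕ) : ℝ) * ρ ^ (n / (2 * t))) := by
            push_cast
            ring
        _ ≤ numColorable (j + 3) n * 1 := by gcongr
        _ = _ := mul_one _
    exact_mod_cast this
  have hB : (hardGraphs j n t).card * worstTime j t n ≤ numColorable (j + 3) n := by
    have h := card_hardGraphs_le (j := j) (n := n) (t := t) (by omega) (by omega) hgood
    have hw : ((1 : ℝ) / 2) ^ (5 * n) * worstTime j t n ≤ (1 / 2) ^ n *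
        (gadgetTime j t n + (n + 3) ^ (j + 3) * (9 * j + 150)) := by
      have e1 : ((1 : ℝ) / 2) ^ (5 * n) ≤ (1 / 2) ^ n * (1 / 2) ^ n := by
        rw [← pow_add]
        exact pow_le_pow_of_le_one (by norm_num) (by norm_num) (by omega)
      have e2 : (worstTime j t n : ℝ) ≤ 2 ^ n *
          (gadgetTime j t n + (n + 3) ^ (j + 3) * (9 * j + 150)) := by
        rw [worstTime]
        push_cast
        rw [mul_add ((2 : ℝ) ^ n), mul_assoc]
        refine add_le_add ?_ le_rfl
        exact le_mul_of_one_le_left (by positivity) (one_le_pow₀ (by norm_num))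
      refine (mul_le_mul e1 e2 (by positivity) (by positivity)).trans (le_of_eq ?_)
      rw [mul_assoc, ← mul_assoc _ ((2 : ℝ) ^ n), ← mul_pow]
      norm_num
    have : ((hardGraphs j n t).card : ℝ) * worstTime j t n ≤ numColorable (j + 3) n := by
      calc ((hardGraphs j n t).card : ℝ) * worstTime j t n
          ≤ (4 * (n + 1) * numColorable (j + 3) n * (1 / 2) ^ (5 * n)) * worstTime j t n := by
            refine mul_le_mul_of_nonneg_right (h.trans ?_) (by positivity)
            exact mul_le_mul_of_nonneg_right hN (by positivity)
        _ = 4 * (n + 1) * numColorable (j + 3) n * ((1 / 2) ^ (5 * n) * worstTime j t n) :=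
            mul_assoc _ _ _
        _ ≤ 4 * (n + 1) * numColorable (j + 3) n * ((1 / 2) ^ n *
              (gadgetTime j t n + (n + 3) ^ (j + 3) * (9 * j + 150))) := by gcongr
        _ = numColorable (j + 3) n * (((4 * (n + 1) * (gadgetTime j t n +
              (n + 3) ^ (j + 3) * (9 * j + 150)) : ℕ) : ℝ) * (1 / 2) ^ (n / 1)) := by
            rw [Nat.div_one]
            push_cast
            ring
        _ ≤ numColorable (j + 3) n * 1 := by gcongr
        _ = _ := mul_one _
    exact_mod_cast this
  classical
  refine averageTime_le (fun H hH => expectedTime_twoColoring_le (by omega) hH)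
    ((sum_time_le _ _ _).trans ?_)
  have hF := Nat.mul_le_mul (le_refl (numColorable (j + 3) n))
    (fastTime_le (j := j) (t := t) (n := n) (by omega))
  have hn1 : numColorable (j + 3) n * 2 ≤ 2 * n * numColorable (j + 3) n := by
    rw [mul_comm]
    exact Nat.mul_le_mul (by omega) le_rfl
  rw [add_mul _ 2 n, add_mul, mul_comm _ (numColorable (j + 3) n)]
  omega

end RAMProg

theorem mainTheorem4 (k : ℕ) (hk : 3 ≤ k) :
    ∃ P : RAMProg k, P.IsTwoColoringAlgorithm ∧
      ∃ C : ℕ, ∀ (n : ℕ) [NeZero n], P.averageTime n ≤ C * n := by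
  classical
  obtain ⟨j, rfl⟩ := Nat.exists_eq_add_of_le' hk
  refine ⟨RAMProg.twoColoring j (j + 320),
    RAMProg.isTwoColoringAlgorithm_twoColoring (by omega), ?_⟩
  obtain ⟨C, hC⟩ := RAMProg.eventually_averageTime_le j
  obtain ⟨n₀, hn₀⟩ := Filter.eventually_atTop.1 hC
  -- The sum dominates the worst running time for each of the finitely many `n < n₀`.
  refine ⟨C + ∑ i ∈ Finset.range n₀, RAMProg.worstTime j (j + 320) i, fun n _ => ?_⟩
  rw [← Nat.cast_mul]
  by_cases hn : n₀ ≤ n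
  · refine (hn₀ n hn).trans ?_
    exact_mod_cast Nat.mul_le_mul (Nat.le_add_right _ _) le_rfl
  · have h1 : RAMProg.worstTime j (j + 320) n ≤
        ∑ i ∈ Finset.range n₀, RAMProg.worstTime j (j + 320) i :=
      Finset.single_le_sum (f := RAMProg.worstTime j (j + 320)) (fun _ _ => Nat.zero_le _)
        (Finset.mem_range.2 (by omega))
    have h2 : RAMProg.worstTime j (j + 320) n ≤
        (C + ∑ i ∈ Finset.range n₀, RAMProg.worstTime j (j + 320) i) * n :=
      (h1.trans (Nat.le_add_left _ _)).trans (Nat.le_mul_of_pos_right _ (NeZero.pos n))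
    refine RAMProg.averageTime_le (τ := fun _ => RAMProg.worstTime j (j + 320) n)
      (fun H hH => RAMProg.expectedTime_le
        (RAMProg.wp_twoColoring (by omega) (RAMProg.exists_properOn hH))) ?_
    rw [Finset.sum_const, smul_eq_mul, mul_comm, KGraph.numColorable]
    exact Nat.mul_le_mul h2 le_rfl
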